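/- **Setting.** Let $N\ge 0$, let $[\lambda_j^{\min},\lambda_j^{\max}]$ ($1\le j\le N$) be fixed intervals with $\lambda_j^{\max}<\lambda_k^{\min}$ for $j<k$, and let $\bar r_1,\dots,\bar r_N$ be a fixed basis of $\mathbb R^N$. Use the Euclidean norm on $\mathbb R^N$ and the operator norm on matrices. A field on $\{t\ge 0\}\times\mathbb R$ is *piecewise constant* if it is locally constant off finitely many polygonal lines with finitely many vertices and finite slopes $dx/dt$. A *jump point* ($t>0$) of a field is a point near which the field takes two distinct constant values, denoted $\pm$, on the left and right of a line through the point, whose slope is the shock speed. For a matrix with $N$ real distinct eigenvalues $\lambda_1<\dots<\lambda_N$ let $r_j$ be the unit eigenvector for $\lambda_j$ with $r_j\cdot\bar r_j>0$. Let $\delta_0>0$, $V,c\in\mathbb R$. A piecewise constant matrix field $A=A(t,x)$ is *uniformly hyperbolic with bounded variation* if, wherever $A$ is locally constant, it has $N$ real distinct eigenvalues $\lambda_j\in[\lambda_j^{\min},\lambda_j^{\max}]$ and $|r_j-\bar r_j|\le\delta_0$; if at each jump point of $A$ the speed $\bar\lambda$ lies in some $[\lambda_i^{\min},\lambda_i^{\max}]$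 (the jump is then an *$i$-shock*); and if $TV(A(t))\le V$ for all $t\ge0$. Assume moreover that at every $i$-shock $$|r_{i+}-r_{i-}|\le c\,|\lambda_{i+}-\lambda_{i-}|,$$ and that shocks have small amplitude: $|A^+-A^-|\le\delta_0$ and $|\bar\lambda-\lambda_{i\pm}|\le\delta_0$ at every $i$-shock. An $i$-shock is *slow* if $\bar\lambda\le\min(\lambda_{i-},\lambda_{i+})$, *fast* if $\bar\lambda\ge\max(\lambda_{i-},\lambda_{i+})$, and a *rarefaction shock* if $\lambda_{i-}<\bar\lambda<\lambda_{i+}$. Let $\psi$ be a piecewise constant solution, in the sense of distributions on $t>0$, of $\partial_t\psi+\partial_x(A\psi)=0$ with $\psi(0)\in L^1(\mathbb R)$. Write $\psi=\sum_j\alpha_jr_j$, and at shocks of $A$ put $\beta_j^-=(\bar\lambda-\lambda_{j-})|\alpha_j^-|$. For fixed $\kappa_1,\kappa_2>0$, at an $i$-shock the index $j$ is *dominant* if $$\kappa_1|\beta_j^-|\ge|r_{i+}-r_{i-}|\,|\beta_i^-|+|A^+-A^-|\sum_{k\ne i}|\beta_k^-|,$$ and the $i$-component is *strongly dominant* if $\kappa_2|\lambda_{i+}-\lambda_{i-}|\,|\alpha_i^\pm|\ge|A^+-A^-|\sum_{k\ne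 i}|\alpha_k^-|$ for both signs. Let $0<w^{\min}$ and let $w=(w_1,\dots,w_N)$ be a weight with $w^{\min}\le w_j\le w^{\max}$, locally constant off finitely many polygonal lines as above and finitely many times, which formally solves the adjoint system: at all but finitely many of its jump points, either the point is a jump point of $A$, or $A$ has no jump there, the speed of the jump of $w$ is some $\lambda_i$, and $w_j^+=w_j^-$ for $j\neq i$; and $w_j(t+,x)\le w_j(t-,x)$ for each $t>0$ and all but finitely many $x$. Let $K>0$ and assume that at every $i$-shock of $A$ (at which $\psi$ and $w$ have left and right limits) - $w_j^+-w_j^-\ge K|A^+-A^-|$ if $j<i$ is dominant, and $w_j^+-w_j^-\le -K|A^+-A^-|$ if $j>i$ is dominant; - if the $i$-component is strongly dominant: $w_i^+-w_i^-\le-K|\lambda_{i+}-\lambda_{i-}|$ for slow shocks and $w_i^+-w_i^-\ge K|\lambda_{i+}-\lambda_{i-}|$ for fast shocks; - if $i$ is dominant but not strongly dominant: $w_i^+-w_i^-\le K|\lambda_{i+}-\lambda_{i-}|$ for slow shocks and $w_i^+-w_i^-\ge-K|\lambda_{i+}-\lambda_{i-}|$ for fast shocks. Let $\|\psi(t)\|_{w(t)}=\int_{\mathbb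 R}\sum_j|\alpha_j(t,x)|\,w_j(t,x)\,dx$, and let $\sigma(t)$ be the supremum of $|\psi^+(t,x)-\psi^-(t,x)|$ over all $x$ at which $A(t,\cdot)$ has, for some $i$, an $i$-rarefaction shock whose $i$-component is strongly dominant ($\sigma(t)=0$ if there is none). **Proposition.** There are constants $K_0,\delta_0,C>0$, depending only on $N$, the intervals $[\lambda_j^{\min},\lambda_j^{\max}]$, the basis $(\bar r_j)$, $V,c,w^{\min},w^{\max},\kappa_1,\kappa_2$, such that, for every $K\ge K_0$ and all $A,\psi,w$ as above: 1. for all but finitely many $t>0$, the weighted norm is finite and differentiable at $t$, and $$\frac{d}{dt}\|\psi(t)\|_{w(t)}\le C\,\sigma(t);$$ 2. for all $t\ge0$, $\psi(t)\in L^1(\mathbb R)$, $\sigma$ is integrable on $[0,t]$, and $$\|\psi(t)\|_{L^1(\mathbb R)}\le C\Big(\|\psi(0)\|_{L^1(\mathbb R)}+\int_0^t\sigma(s)\,ds\Big).$$ -/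

import Mathlib

open Set Filter Topology MeasureTheory
open scoped ContDiff

noncomputable section

namespace LinHyp

/-- State space `ℝ^N` with the Euclidean norm. -/
abbrev Vec (N : ℕ) := EuclideanSpace ℝ (Fin N)

/-- Real `N × N` matrices, seen as operators on `ℝ^N`, with the operator norm. -/
abbrev Mat (N : ℕ) := Vec N →L[ℝ] Vec N

/-! ### Piecewise constant fields on the half plane `t ≥ 0` -/

/-- An affine piece of a polygonal line `x = pos + speed * t`, carried by a closed interval of times
(bounded or not). -/
structure Front where
  dom : Set ℝ
  isClosed_dom : IsClosed dom
  ordConnected_dom : dom.OrdConnected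
  pos : ℝ
  speed : ℝ

/-- The segment (or half-line) of the `(t, x)` plane carrying the front. -/
def Front.graph (φ : Front) : Set (ℝ × ℝ) :=
  {p | p.1 ∈ φ.dom ∧ p.2 = φ.pos + φ.speed * p.1}

/-- `f` is constant near `(t, x)`, relatively to the half plane of nonnegative times. -/
def LocConstAt {X : Type*} (f : ℝ → ℝ → X) (t x : ℝ) : Prop :=
  ∀ᶠ p in 𝓝[{p : ℝ × ℝ | 0 ≤ p.1}] (t, x), f p.1 p.2 = f t x

/-- `f` is piecewise constant on `t ≥ 0`: it is locally constant off finitely many segments and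
half-lines of finite slope `dx/dt`. -/
def IsPiecewiseConstant {X : Type*} (f : ℝ → ℝ → X) : Prop :=
  ∃ S : Set Front, S.Finite ∧
    ∀ t x : ℝ, 0 ≤ t → (∀ φ ∈ S, (t, x) ∉ φ.graph) → LocConstAt f t x

/-- The same notion, where jumps in time are also allowed, at finitely many times. -/
def IsPiecewiseConstantWithTimeJumps {X : Type*} (f : ℝ → ℝ → X) : Prop :=
  ∃ (S : Set Front) (Θ : Set ℝ), S.Finite ∧ Θ.Finite ∧
    ∀ t x : ℝ, 0 ≤ t → t ∉ Θ → (∀ φ ∈ S, (t, x) ∉ φ.graph) → LocConstAt f t x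

/-- Near `(t, x)`, the field `f` equals `fm` on the left and `fp` on the right of the line of speed
`s` through `(t, x)`. -/
def HasTraces {X : Type*} (f : ℝ → ℝ → X) (t x s : ℝ) (fm fp : X) : Prop :=
  ∀ᶠ p in 𝓝 (t, x),
    (p.2 < x + s * (p.1 - t) → f p.1 p.2 = fm) ∧ (x + s * (p.1 - t) < p.2 → f p.1 p.2 = fp)

/-- `(t, x)` is a jump point of `f`, on a discontinuity line of speed `s` with limits `fm ≠ fp`. -/
def IsJump {X : Type*} (f : ℝ → ℝ → X) (t x s : ℝ) (fm fp : X) : Prop :=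
  0 < t ∧ fm ≠ fp ∧ HasTraces f t x s fm fp

/-- The (essential) total variation of `f : ℝ → X` is at most `V`. -/
def EssVariationLE {X : Type*} [PseudoEMetricSpace X] (f : ℝ → X) (V : ℝ) : Prop :=
  ∃ g : ℝ → X, g =ᵐ[volume] f ∧ eVariationOn g univ ≤ ENNReal.ofReal V

/-! ### Eigenvalues, eigenvectors and characteristic components -/

variable {N : ℕ}

/-- `l` enumerates increasingly `N` real distinct eigenvalues of `M`. -/
def EnumeratesEigenvalues (M : Mat N) (l : Fin N → ℝ) : Prop :=
  StrictMono l ∧ ∀ j, Module.End.HasEigenvalue (M : Vec N →ₗ[ℝ] Vec N) (l j)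

open Classical in
/-- The eigenvalues `λ_1 < ... < λ_N` of `M` (when there are `N` real distinct ones). -/
def eigval (M : Mat N) : Fin N → ℝ :=
  if h : ∃ l, EnumeratesEigenvalues M l then h.choose else 0

open Classical in
/-- The unit eigenvector `r_j` of `M` for `λ_j`, oriented as the reference vector `rbar j`. -/
def eigvec (rbar : Fin N → Vec N) (M : Mat N) (j : Fin N) : Vec N :=
  if h : ∃ v : Vec N, M v = eigval M j • v ∧ ‖v‖ = 1 ∧ 0 < inner ℝ (rbar j) v
  then h.choose else 0

open Classical in
/-- The characteristic components `α` of `v`, defined by `v = ∑ j, α j • r_j(M)`. -/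
def charComp (rbar : Fin N → Vec N) (M : Mat N) (v : Vec N) : Fin N → ℝ :=
  if h : ∃ a : Fin N → ℝ, v = ∑ j, a j • eigvec rbar M j then h.choose else 0

/-! ### Shocks -/

/-- Speed of a shock of the matrix field, with the left and right limits of the matrix field and of
the solution. -/
structure Shock (N : ℕ) where
  speed : ℝ
  Am : Mat N
  Ap : Mat N
  ψm : Vec N
  ψp : Vec N

/-- `S` describes the fields `A` and `ψ` at the jump point `(t, x)` of `A`. -/
def IsShockAt (A : ℝ → ℝ → Mat N) (ψ : ℝ → ℝ → Vec N) (t x : ℝ) (S : Shock N) : Prop :=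
  IsJump A t x S.speed S.Am S.Ap ∧ HasTraces ψ t x S.speed S.ψm S.ψp

namespace Shock

/-- The shock belongs to the `i`-th family. -/
def InFamily (S : Shock N) (lo hi : Fin N → ℝ) (i : Fin N) : Prop :=
  S.speed ∈ Icc (lo i) (hi i)

/-- `|A⁺ - A⁻|` -/
def strength (S : Shock N) : ℝ := ‖S.Ap - S.Am‖

/-- `|λ_i⁺ - λ_i⁻|` -/
def lamJump (S : Shock N) (i : Fin N) : ℝ := |eigval S.Ap i - eigval S.Am i|

/-- `|r_i⁺ - r_i⁻|` -/
def eigvecJump (S : Shock N) (rbar : Fin N → Vec N) (i : Fin N) : ℝ :=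
  ‖eigvec rbar S.Ap i - eigvec rbar S.Am i‖

/-- `α_j⁻` -/
def αm (S : Shock N) (rbar : Fin N → Vec N) (j : Fin N) : ℝ := charComp rbar S.Am S.ψm j

/-- `α_j⁺` -/
def αp (S : Shock N) (rbar : Fin N → Vec N) (j : Fin N) : ℝ := charComp rbar S.Ap S.ψp j

/-- The left characteristic flux `β_j⁻ = (speed - λ_j⁻) |α_j⁻|`. -/
def βm (S : Shock N) (rbar : Fin N → Vec N) (j : Fin N) : ℝ :=
  (S.speed - eigval S.Am j) * |S.αm rbar j|

/-- Slow undercompressive `i`-shock. -/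
def IsSlow (S : Shock N) (i : Fin N) : Prop := S.speed ≤ min (eigval S.Am i) (eigval S.Ap i)

/-- Fast undercompressive `i`-shock. -/
def IsFast (S : Shock N) (i : Fin N) : Prop := max (eigval S.Am i) (eigval S.Ap i) ≤ S.speed

/-- Rarefaction `i`-shock. -/
def IsRarefaction (S : Shock N) (i : Fin N) : Prop :=
  eigval S.Am i < S.speed ∧ S.speed < eigval S.Ap i

/-- The `j`-characteristic flux is dominant at the `i`-shock `S`. -/
def IsDominant (S : Shock N) (rbar : Fin N → Vec N) (κ₁ : ℝ) (i j : Fin N) : Prop :=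
  S.eigvecJump rbar i * |S.βm rbar i| + S.strength * ∑ k ∈ Finset.univ.erase i, |S.βm rbar k|
    ≤ κ₁ * |S.βm rbar j|

/-- The `i`-characteristic component is strongly dominant at the `i`-shock `S`. -/
def IsStronglyDominant (S : Shock N) (rbar : Fin N → Vec N) (κ₂ : ℝ) (i : Fin N) : Prop :=
  S.strength * ∑ k ∈ Finset.univ.erase i, |S.αm rbar k| ≤ κ₂ * S.lamJump i * |S.αm rbar i| ∧
  S.strength * ∑ k ∈ Finset.univ.erase i, |S.αm rbar k| ≤ κ₂ * S.lamJump i * |S.αp rbar i|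

end Shock

/-! ### The matrix field -/

/-- Uniformly hyperbolic matrix field with bounded variation: eigenvalues and shock speeds lie in
the fixed intervals `[lo j, hi j]`, the eigenvectors are `δ`-close to a fixed basis `rbar`, and the
total variation in space is at most `V` at all times. -/
structure IsUniformlyHyperbolicBV (lo hi : Fin N → ℝ) (rbar : Fin N → Vec N) (δ V : ℝ)
    (A : ℝ → ℝ → Mat N) : Prop where
  piecewiseConstant : IsPiecewiseConstant A
  distinct : ∀ t x, 0 ≤ t → LocConstAt A t x → ∃ l, EnumeratesEigenvalues (A t x) l
  eigval_mem : ∀ t x, 0 ≤ t → LocConstAt A t x → ∀ j, eigval (A t x) j ∈ Icc (lo j) (hi j)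
  eigvec_close : ∀ t x, 0 ≤ t → LocConstAt A t x → ∀ j, ‖eigvec rbar (A t x) j - rbar j‖ ≤ δ
  speed_mem : ∀ t x s Am Ap, IsJump A t x s Am Ap → ∃ i, s ∈ Icc (lo i) (hi i)
  variation : ∀ t, 0 ≤ t → EssVariationLE (A t) V

/-- At every `i`-shock of `A`, `|r_i⁺ - r_i⁻| ≤ c |λ_i⁺ - λ_i⁻|`. -/
def EigvecJumpBound (lo hi : Fin N → ℝ) (rbar : Fin N → Vec N) (c : ℝ)
    (A : ℝ → ℝ → Mat N) : Prop :=
  ∀ (t x s : ℝ) (Am Ap : Mat N) (i : Fin N), IsJump A t x s Am Ap → s ∈ Icc (lo i) (hi i) →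
    ‖eigvec rbar Ap i - eigvec rbar Am i‖ ≤ c * |eigval Ap i - eigval Am i|

/-- Small amplitude: at every `i`-shock of `A` the jump of `A` is at most `δ`, and the speed of the
shock is `δ`-close to the `i`-th eigenvalues on both sides. -/
def HasSmallShocks (lo hi : Fin N → ℝ) (δ : ℝ) (A : ℝ → ℝ → Mat N) : Prop :=
  ∀ (t x s : ℝ) (Am Ap : Mat N) (i : Fin N), IsJump A t x s Am Ap → s ∈ Icc (lo i) (hi i) →
    ‖Ap - Am‖ ≤ δ ∧ |s - eigval Am i| ≤ δ ∧ |s - eigval Ap i| ≤ δ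

/-- `∂_t ψ + ∂_x (A ψ) = 0` in the sense of distributions on `t > 0`. -/
def IsWeakSolution (A : ℝ → ℝ → Mat N) (ψ : ℝ → ℝ → Vec N) : Prop :=
  ∀ φ : ℝ × ℝ → ℝ, ContDiff ℝ ∞ φ → HasCompactSupport φ → tsupport φ ⊆ {p | 0 < p.1} →
    ∫ p : ℝ × ℝ, (fderiv ℝ φ p (1, 0) • ψ p.1 p.2 + fderiv ℝ φ p (0, 1) • A p.1 p.2 (ψ p.1 p.2)) = 0

/-! ### The weight -/

/-- A piecewise constant weight with values in `[wmin, wmax]` that formally solves the adjoint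
system: apart from finitely many points, a discontinuity in space is either on a shock of `A`, or on
an `i`-characteristic line of `A` with a jump of the `i`-th component only; and jumps in time are
decreasing. -/
structure IsAdjointWeight (A : ℝ → ℝ → Mat N) (wmin wmax : ℝ)
    (w : ℝ → ℝ → Fin N → ℝ) : Prop where
  piecewiseConstant : IsPiecewiseConstantWithTimeJumps w
  bounds : ∀ t x j, 0 ≤ t → w t x j ∈ Icc wmin wmax
  adjoint : ∃ E : Set (ℝ × ℝ), E.Finite ∧ ∀ t x s wm wp, (t, x) ∉ E → IsJump w t x s wm wp →
    (∃ s' Am Ap, IsJump A t x s' Am Ap) ∨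
    (∃ M, HasTraces A t x s M M ∧ ∃ i, s = eigval M i ∧ ∀ j, j ≠ i → wp j = wm j)
  decreasing : ∀ t, 0 < t → ∀ᶠ x in cofinite, ∀ j,
    ∀ᶠ τ in 𝓝[>] t, ∀ᶠ σ in 𝓝[<] t, w τ x j ≤ w σ x j

/-- The constraints on the jumps of the weight at the shocks of `A`. -/
structure WeightConstraints (lo hi : Fin N → ℝ) (rbar : Fin N → Vec N) (κ₁ κ₂ K : ℝ)
    (A : ℝ → ℝ → Mat N) (ψ : ℝ → ℝ → Vec N) (w : ℝ → ℝ → Fin N → ℝ) : Prop where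
  lower : ∀ t x S wm wp i j, IsShockAt A ψ t x S → HasTraces w t x S.speed wm wp →
    S.InFamily lo hi i → S.IsDominant rbar κ₁ i j → j < i →
    K * S.strength ≤ wp j - wm j
  upper : ∀ t x S wm wp i j, IsShockAt A ψ t x S → HasTraces w t x S.speed wm wp →
    S.InFamily lo hi i → S.IsDominant rbar κ₁ i j → i < j →
    wp j - wm j ≤ -(K * S.strength)
  slow_strong : ∀ t x S wm wp i, IsShockAt A ψ t x S → HasTraces w t x S.speed wm wp →
    S.InFamily lo hi i → S.IsSlow i → S.IsStronglyDominant rbar κ₂ i →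
    wp i - wm i ≤ -(K * S.lamJump i)
  fast_strong : ∀ t x S wm wp i, IsShockAt A ψ t x S → HasTraces w t x S.speed wm wp →
    S.InFamily lo hi i → S.IsFast i → S.IsStronglyDominant rbar κ₂ i →
    K * S.lamJump i ≤ wp i - wm i
  slow_weak : ∀ t x S wm wp i, IsShockAt A ψ t x S → HasTraces w t x S.speed wm wp →
    S.InFamily lo hi i → S.IsSlow i → S.IsDominant rbar κ₁ i i → ¬ S.IsStronglyDominant rbar κ₂ i →
    wp i - wm i ≤ K * S.lamJump i
  fast_weak : ∀ t x S wm wp i, IsShockAt A ψ t x S → HasTraces w t x S.speed wm wp →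
    S.InFamily lo hi i → S.IsFast i → S.IsDominant rbar κ₁ i i → ¬ S.IsStronglyDominant rbar κ₂ i →
    -(K * S.lamJump i) ≤ wp i - wm i

/-! ### The quantities in the estimates -/

/-- The density `∑ j, |α_j(t, x)| w_j(t, x)` of the weighted norm. -/
def weightedDensity (rbar : Fin N → Vec N) (A : ℝ → ℝ → Mat N) (ψ : ℝ → ℝ → Vec N)
    (w : ℝ → ℝ → Fin N → ℝ) (t x : ℝ) : ℝ :=
  ∑ j, |charComp rbar (A t x) (ψ t x) j| * w t x j

/-- The weighted norm of `ψ(t)`. -/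
def weightedNorm (rbar : Fin N → Vec N) (A : ℝ → ℝ → Mat N) (ψ : ℝ → ℝ → Vec N)
    (w : ℝ → ℝ → Fin N → ℝ) (t : ℝ) : ℝ :=
  ∫ x, weightedDensity rbar A ψ w t x

/-- The supremum of `|ψ⁺ - ψ⁻|` over all rarefaction shocks of `A` at time `t`, of any family `i`,
whose `i`-characteristic component is strongly dominant (zero if there is none). -/
def rarefactionSup (lo hi : Fin N → ℝ) (rbar : Fin N → Vec N) (κ₂ : ℝ)
    (A : ℝ → ℝ → Mat N) (ψ : ℝ → ℝ → Vec N) (t : ℝ) : ℝ :=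
  sSup {d | ∃ (x : ℝ) (S : Shock N) (i : Fin N), IsShockAt A ψ t x S ∧ S.InFamily lo hi i ∧
    S.IsRarefaction i ∧ S.IsStronglyDominant rbar κ₂ i ∧ d = ‖S.ψp - S.ψm‖}

end LinHyp

end

/-!
The weighted norm of `ψ(t)` is the integral of a piecewise constant function of `x`, so that it is
piecewise affine in time, and its derivative is a sum over the discontinuity lines. The
Rankine–Hugoniot relation (`LinHyp.IsWeakSolution.rankineHugoniot`) makes this derivative equal to
the sum over the lines of the weighted fluxes `∑ j, (β_j⁻ w_j⁻ - β_j⁺ w_j⁺)`, with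
`β_j = (s - λ_j) |α_j|` and `s` the speed of the line.

On a line where `A` does not jump this sum vanishes (`LinHyp.sum_flux_eq_zero`). At an `i`-shock
(`LinHyp.Shock.sum_flux_le`), the Rankine–Hugoniot relation and the Lipschitz dependence of the
eigenvectors on the matrix (`LinHyp.IsRegularMat.lipschitz`) bound all the jumps of the fluxes by
the interaction term `D = |r_i⁺ - r_i⁻| |β_i⁻| + |A⁺ - A⁻| ∑_{k ≠ i} |β_k⁻|`. The jumps of the
weight contribute `-K |A⁺ - A⁻| |β_j⁻|` for each dominant `j ≠ i`, and when `j` is not dominant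
`|A⁺ - A⁻| |β_j⁻|` is at most a small multiple of `D`; hence the other families lose a large
multiple of `D`, up to the part of `D` that comes from `β_i⁻`. That part is small with respect to
`D` when `i` is not dominant or when `α_i` is not strongly dominant. Otherwise it is absorbed by
the jump of `w_i` at slow and fast shocks, and by the lower bound of the weight at compressive
shocks, whose two fluxes point inwards. At a rarefaction shock the two fluxes point outwards: if
`α_i⁻` and `α_i⁺` have the same sign their sum is bounded by `D`; otherwise
`|α_i⁻| + |α_i⁺| = |α_i⁺ - α_i⁻|` is controlled by the jump of `ψ`, which produces the only
positive term, `|A⁺ - A⁻| |ψ⁺ - ψ⁻|`. The bound on the total variation of `A`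
(`LinHyp.IsCarriedBy.sum_strength_le`) sums these terms.

At the exceptional times `A` and `ψ` are continuous in time for almost every `x` and the weight
decreases, so that the weighted norm has nonpositive jumps (`LinHyp.IsCarriedBy.weightedNorm_jump`);
integration in time gives the bound of the `L¹` norm.

The bookkeeping of the discontinuity lines rests on one remark: a field that is locally constant off
finitely many full lines only depends on the set of lines to the left of the point
(`LinHyp.exists_eq_comp_below`), because the region where this set is prescribed is convex.
Segments are replaced by the full lines that carry them, and a line without any jump contributes
nothing.
-/

namespace LinHyp

/-! ### Piecewise constant fields and the lines that carry their jumps -/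

/-- The position at time `t` of the line `x = p.1 + p.2 * t` of the `(t, x)` plane. -/
def linePos (p : ℝ × ℝ) (t : ℝ) : ℝ := p.1 + p.2 * t

/-- The lines of `L` that pass to the left of the point `(t, x)`. -/
noncomputable def below (L : Finset (ℝ × ℝ)) (t x : ℝ) : Finset (ℝ × ℝ) :=
  L.filter fun p => linePos p t < x

/-- The point `(t, x)` lies on no line of `L`. -/
def OffLines (L : Finset (ℝ × ℝ)) (t x : ℝ) : Prop := ∀ p ∈ L, x ≠ linePos p t

/-- No two lines of `L` meet at time `t`. -/
def IsGeneric (L : Finset (ℝ × ℝ)) (t : ℝ) : Prop :=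
  ∀ p ∈ L, ∀ q ∈ L, linePos p t = linePos q t → p = q

theorem OffLines.mono {L L' : Finset (ℝ × ℝ)} (h : L ⊆ L') {t x : ℝ} (hx : OffLines L' t x) :
    OffLines L t x := fun p hp => hx p (h hp)

theorem mem_below {L : Finset (ℝ × ℝ)} {t x : ℝ} {p : ℝ × ℝ} :
    p ∈ below L t x ↔ p ∈ L ∧ linePos p t < x := by
  simp [below]

theorem continuous_linePos (p : ℝ × ℝ) : Continuous (linePos p) := by
  unfold linePos; fun_prop

theorem finite_not_offLines (L : Finset (ℝ × ℝ)) (t : ℝ) : {x | ¬ OffLines L t x}.Finite := by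
  refine (L.finite_toSet.image (fun p => linePos p t)).subset ?_
  intro x hx
  simp only [mem_ofPred_eq, OffLines, not_forall, not_not] at hx
  obtain ⟨p, hp, h⟩ := hx
  exact ⟨p, hp, h.symm⟩

theorem ae_offLines (L : Finset (ℝ × ℝ)) (t : ℝ) : ∀ᵐ x : ℝ, OffLines L t x := by
  rw [ae_iff]
  exact (finite_not_offLines L t).measure_zero _

/-- A finite set of fronts may be replaced by the full lines that carry them. -/
theorem exists_lines_of_fronts {S : Set Front} (hS : S.Finite) :
    ∃ L : Finset (ℝ × ℝ), ∀ t x, OffLines L t x → ∀ φ ∈ S, (t, x) ∉ φ.graph := by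
  refine ⟨(hS.image fun φ => (φ.pos, φ.speed)).toFinset, ?_⟩
  intro t x h φ hφ hmem
  exact h (φ.pos, φ.speed) (by simpa using ⟨φ, hφ, rfl, rfl⟩) hmem.2

theorem IsPiecewiseConstant.exists_lines {X : Type*} {f : ℝ → ℝ → X}
    (hf : IsPiecewiseConstant f) :
    ∃ L : Finset (ℝ × ℝ), ∀ t x, 0 ≤ t → OffLines L t x → LocConstAt f t x := by
  obtain ⟨S, hS, h⟩ := hf
  obtain ⟨L, hL⟩ := exists_lines_of_fronts hS
  exact ⟨L, fun t x ht hx => h t x ht (hL t x hx)⟩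

theorem IsPiecewiseConstantWithTimeJumps.exists_lines {X : Type*} {f : ℝ → ℝ → X}
    (hf : IsPiecewiseConstantWithTimeJumps f) :
    ∃ (L : Finset (ℝ × ℝ)) (Θ : Set ℝ), Θ.Finite ∧
      ∀ t x, 0 ≤ t → t ∉ Θ → OffLines L t x → LocConstAt f t x := by
  obtain ⟨S, Θ, hS, hΘ, h⟩ := hf
  obtain ⟨L, hL⟩ := exists_lines_of_fronts hS
  exact ⟨L, Θ, hΘ, fun t x ht ht' hx => h t x ht ht' (hL t x hx)⟩

theorem finite_not_isGeneric (L : Finset (ℝ × ℝ)) : {t | ¬ IsGeneric L t}.Finite := by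
  have : {t | ¬ IsGeneric L t} ⊆
      ⋃ p ∈ L, ⋃ q ∈ L, {t | p ≠ q ∧ linePos p t = linePos q t} := by
    intro t ht
    simp only [IsGeneric, mem_ofPred_eq, not_forall] at ht
    obtain ⟨p, hp, q, hq, h, hne⟩ := ht
    simp only [mem_iUnion]
    exact ⟨p, hp, q, hq, hne, h⟩
  refine Set.Finite.subset ?_ this
  refine L.finite_toSet.biUnion fun p _ => L.finite_toSet.biUnion fun q _ => ?_
  refine Set.Subsingleton.finite ?_
  rintro t ⟨hne, ht⟩ t' ⟨-, ht'⟩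
  simp only [linePos] at ht ht'
  by_contra hcon
  have hs : p.2 = q.2 := by
    have : (p.2 - q.2) * (t - t') = 0 := by linarith
    rcases mul_eq_zero.1 this with h | h
    · linarith
    · exact absurd (by linarith) hcon
  refine hne (Prod.ext ?_ hs)
  rw [hs] at ht
  linarith

/-- On a time interval where it is locally constant off the lines of `L`, a field only depends on
the set of lines to the left of the point: the region where this set is prescribed is convex. -/
theorem exists_eq_comp_below {X : Type*} {f : ℝ → ℝ → X} {L : Finset (ℝ × ℝ)} {J : Set ℝ}
    (hJ : J.OrdConnected) (hJ0 : ∀ t ∈ J, 0 ≤ t)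
    (hf : ∀ t ∈ J, ∀ x, OffLines L t x → LocConstAt f t x) :
    ∃ u : Finset (ℝ × ℝ) → X, ∀ t ∈ J, ∀ x, OffLines L t x → f t x = u (below L t x) := by
  classical
  let R : Finset (ℝ × ℝ) → Set (ℝ × ℝ) := fun B =>
    {z | z.1 ∈ J ∧ OffLines L z.1 z.2 ∧ below L z.1 z.2 = B}
  have hconv : ∀ B, IsPreconnected (R B) := by
    intro B
    refine Convex.isPreconnected ?_
    intro z hz z' hz' a b ha hb hab
    obtain ⟨h1, h2, h3⟩ := hz
    obtain ⟨h1', h2', h3'⟩ := hz'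
    have hpos : ∀ p, linePos p (a • z + b • z').1 = a * linePos p z.1 + b * linePos p z'.1 := by
      intro p
      have : p.1 = (a + b) * p.1 := by rw [hab, one_mul]
      simp only [linePos, Prod.fst_add, Prod.smul_fst, smul_eq_mul]
      linear_combination this
    have hlt : ∀ p ∈ L, p ∈ B → linePos p (a • z + b • z').1 < (a • z + b • z').2 := by
      intro p hp hpB
      rw [hpos]
      have e1 : linePos p z.1 < z.2 := (mem_below.1 (h3 ▸ hpB)).2
      have e2 : linePos p z'.1 < z'.2 := (mem_below.1 (h3' ▸ hpB)).2
      simp only [Prod.snd_add, Prod.smul_snd, smul_eq_mul]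
      rcases ha.eq_or_lt with rfl | ha'
      · have : b = 1 := by linarith
        subst this; linarith
      · nlinarith
    have hgt : ∀ p ∈ L, p ∉ B → (a • z + b • z').2 < linePos p (a • z + b • z').1 := by
      intro p hp hpB
      rw [hpos]
      have e1 : z.2 < linePos p z.1 := by
        refine lt_of_le_of_ne ?_ (h2 p hp)
        by_contra hcon
        exact hpB (h3 ▸ mem_below.2 ⟨hp, not_le.1 hcon⟩)
      have e2 : z'.2 < linePos p z'.1 := by
        refine lt_of_le_of_ne ?_ (h2' p hp)
        by_contra hcon
        exact hpB (h3' ▸ mem_below.2 ⟨hp, not_le.1 hcon⟩)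
      simp only [Prod.snd_add, Prod.smul_snd, smul_eq_mul]
      rcases ha.eq_or_lt with rfl | ha'
      · have : b = 1 := by linarith
        subst this; linarith
      · nlinarith
    refine ⟨?_, ?_, ?_⟩
    · exact hJ.convex h1 h1' ha hb hab
    · intro p hp
      by_cases hpB : p ∈ B
      · exact (hlt p hp hpB).ne'
      · exact (hgt p hp hpB).ne
    · ext p
      rw [mem_below]
      constructor
      · rintro ⟨hp, hp'⟩
        by_contra hpB
        exact lt_asymm hp' (hgt p hp hpB)
      · intro hpB
        have hp : p ∈ L := (mem_below.1 (h3.symm ▸ hpB)).1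
        exact ⟨hp, hlt p hp hpB⟩
  have hconst : ∀ B, ∀ z ∈ R B, ∀ z' ∈ R B, f z.1 z.2 = f z'.1 z'.2 := by
    intro B z hz z' hz'
    have : PreconnectedSpace (R B) := Subtype.preconnectedSpace (hconv B)
    have hloc : IsLocallyConstant (fun y : R B => f y.1.1 y.1.2) := by
      rw [IsLocallyConstant.iff_eventually_eq]
      rintro ⟨y, hy⟩
      have := hf y.1 hy.1 y.2 hy.2.1
      have h2 : Tendsto (Subtype.val : R B → ℝ × ℝ) (𝓝 ⟨y, hy⟩)
          (𝓝[{p : ℝ × ℝ | 0 ≤ p.1}] (y.1, y.2)) := by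
        refine tendsto_nhdsWithin_iff.2 ⟨continuous_subtype_val.continuousAt, ?_⟩
        exact Eventually.of_forall fun z => hJ0 _ z.2.1
      exact h2.eventually this
    exact hloc.apply_eq_of_preconnectedSpace ⟨z, hz⟩ ⟨z', hz'⟩
  refine ⟨fun B => if h : (R B).Nonempty then f h.some.1 h.some.2 else f 0 0, ?_⟩
  intro t ht x hx
  have hmem : (t, x) ∈ R (below L t x) := ⟨ht, hx, rfl⟩
  have hne : (R (below L t x)).Nonempty := ⟨_, hmem⟩
  simp only [dif_pos hne]
  exact hconst _ _ hmem _ hne.some_mem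

theorem linePos_add (p : ℝ × ℝ) (t τ : ℝ) : linePos p t + p.2 * (τ - t) = linePos p τ := by
  simp only [linePos]; ring

/-- Near a point off the lines, the set of lines to the left is constant. -/
theorem eventually_below_eq {L : Finset (ℝ × ℝ)} {t x : ℝ} (hx : OffLines L t x) :
    ∀ᶠ z : ℝ × ℝ in 𝓝 (t, x), OffLines L z.1 z.2 ∧ below L z.1 z.2 = below L t x := by
  have key : ∀ᶠ z : ℝ × ℝ in 𝓝 (t, x), ∀ q ∈ L,
      (linePos q t < x → linePos q z.1 < z.2) ∧ (x < linePos q t → z.2 < linePos q z.1) := by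
    rw [Filter.eventually_all_finset]
    intro q _
    have c1 : ContinuousAt (fun z : ℝ × ℝ => linePos q z.1) (t, x) :=
      ((continuous_linePos q).comp continuous_fst).continuousAt
    have c2 : ContinuousAt (fun z : ℝ × ℝ => z.2) (t, x) := continuous_snd.continuousAt
    refine Eventually.and ?_ ?_
    · by_cases h : linePos q t < x
      · exact (c1.eventually_lt c2 h).mono fun z hz _ => hz
      · exact Eventually.of_forall fun z hz => absurd hz h
    · by_cases h : x < linePos q t
      · exact (c2.eventually_lt c1 h).mono fun z hz _ => hz
      · exact Eventually.of_forall fun z hz => absurd hz h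
  filter_upwards [key] with z hz
  refine ⟨fun q hq => ?_, ?_⟩
  · rcases lt_or_gt_of_ne (hx q hq) with h | h
    · exact ((hz q hq).2 h).ne
    · exact ((hz q hq).1 h).ne'
  · ext q
    simp only [mem_below]
    refine and_congr_right fun hq => ⟨fun h => ?_, (hz q hq).1⟩
    by_contra hcon
    exact lt_asymm h ((hz q hq).2 (lt_of_le_of_ne (not_lt.1 hcon) (hx q hq)))

/-- At a time when no two lines meet, crossing the line `p` adds `p` to the set of lines to the
left, and nothing else. -/
theorem eventually_below_near_line {L : Finset (ℝ × ℝ)} {t : ℝ} (ht : IsGeneric L t) {p : ℝ × ℝ}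
    (hp : p ∈ L) :
    ∀ᶠ z : ℝ × ℝ in 𝓝 (t, linePos p t),
      (z.2 < linePos p z.1 →
        OffLines L z.1 z.2 ∧ below L z.1 z.2 = below L t (linePos p t)) ∧
      (linePos p z.1 < z.2 →
        OffLines L z.1 z.2 ∧ below L z.1 z.2 = insert p (below L t (linePos p t))) := by
  have hx : OffLines (L.erase p) t (linePos p t) := by
    intro q hq h
    rw [Finset.mem_erase] at hq
    exact hq.1 (ht p hp q hq.2 h).symm
  have key : ∀ z : ℝ × ℝ, OffLines (L.erase p) z.1 z.2 → z.2 ≠ linePos p z.1 →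
      OffLines L z.1 z.2 := by
    intro z h1 h2 q hq
    by_cases hqp : q = p
    · rwa [hqp]
    · exact h1 q (Finset.mem_erase.2 ⟨hqp, hq⟩)
  filter_upwards [eventually_below_eq hx] with z hz
  have hq : ∀ q ∈ L, q ≠ p → (linePos q z.1 < z.2 ↔ linePos q t < linePos p t) := by
    intro q hq hqp
    have := Finset.ext_iff.1 hz.2 q
    simpa [mem_below, hq, hqp] using this
  refine ⟨fun h => ⟨key z hz.1 h.ne, ?_⟩, fun h => ⟨key z hz.1 h.ne', ?_⟩⟩
  · ext q
    by_cases hqp : q = p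
    · subst hqp; simp [mem_below, h.le]
    · simp only [mem_below]
      exact and_congr_right fun hqL => hq q hqL hqp
  · ext q
    by_cases hqp : q = p
    · subst hqp; simp [mem_below, h, hp]
    · simp only [mem_below, Finset.mem_insert, hqp, false_or]
      exact and_congr_right fun hqL => hq q hqL hqp

/-- The order of the lines does not change near a time when no two lines meet. -/
theorem eventually_isGeneric {L : Finset (ℝ × ℝ)} {t : ℝ} (ht : IsGeneric L t) :
    ∀ᶠ τ in 𝓝 t, IsGeneric L τ ∧
      ∀ p ∈ L, below L τ (linePos p τ) = below L t (linePos p t) := by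
  have key : ∀ᶠ τ in 𝓝 t, ∀ p ∈ L, ∀ q ∈ L,
      linePos p t < linePos q t → linePos p τ < linePos q τ := by
    rw [Filter.eventually_all_finset]
    intro p _
    rw [Filter.eventually_all_finset]
    intro q _
    by_cases h : linePos p t < linePos q t
    · exact ((continuous_linePos p).continuousAt.eventually_lt
        (continuous_linePos q).continuousAt h).mono fun z hz _ => hz
    · exact Eventually.of_forall fun z hz => absurd hz h
  filter_upwards [key] with τ hτ
  refine ⟨fun p hp q hq h => ?_, fun p hp => ?_⟩
  · by_contra hne
    rcases lt_trichotomy (linePos p t) (linePos q t) with h1 | h1 | h1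
    · exact (hτ p hp q hq h1).ne h
    · exact hne (ht p hp q hq h1)
    · exact (hτ q hq p hp h1).ne' h
  · ext q
    simp only [mem_below]
    refine and_congr_right fun hq => ⟨fun h => ?_, hτ q hq p hp⟩
    rcases lt_trichotomy (linePos p t) (linePos q t) with h1 | h1 | h1
    · exact absurd h (hτ p hp q hq h1).not_gt
    · rw [ht p hp q hq h1] at h
      exact absurd h (lt_irrefl _)
    · exact h1

theorem hasTraces_of_comp_below {X : Type*} {f : ℝ → ℝ → X} {L : Finset (ℝ × ℝ)} {J : Set ℝ}
    {u : Finset (ℝ × ℝ) → X} (hu : ∀ t ∈ J, ∀ x, OffLines L t x → f t x = u (below L t x))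
    {t : ℝ} (hJ : J ∈ 𝓝 t) (ht : IsGeneric L t) {p : ℝ × ℝ} (hp : p ∈ L) :
    HasTraces f t (linePos p t) p.2 (u (below L t (linePos p t)))
      (u (insert p (below L t (linePos p t)))) := by
  have h1 : ∀ᶠ z : ℝ × ℝ in 𝓝 (t, linePos p t), z.1 ∈ J :=
    continuous_fst.continuousAt.eventually hJ
  unfold HasTraces
  filter_upwards [h1, eventually_below_near_line ht hp] with z hz hz'
  rw [linePos_add]
  refine ⟨fun h => ?_, fun h => ?_⟩
  · rw [hu _ hz _ (hz'.1 h).1, (hz'.1 h).2]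
  · rw [hu _ hz _ (hz'.2 h).1, (hz'.2 h).2]

/-! ### Traces of fields -/

theorem HasTraces.eventually_left {X : Type*} {f : ℝ → ℝ → X} {t x s : ℝ} {fm fp : X}
    (h : HasTraces f t x s fm fp) : ∀ᶠ y in 𝓝[<] x, f t y = fm := by
  have h1 : Tendsto (fun y : ℝ => (t, y)) (𝓝[<] x) (𝓝 (t, x)) :=
    ((by fun_prop : Continuous fun y : ℝ => (t, y)).tendsto x).mono_left nhdsWithin_le_nhds
  filter_upwards [h1.eventually h, self_mem_nhdsWithin] with y hy hyx
  exact hy.1 (by simpa using hyx)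

theorem HasTraces.eventually_right {X : Type*} {f : ℝ → ℝ → X} {t x s : ℝ} {fm fp : X}
    (h : HasTraces f t x s fm fp) : ∀ᶠ y in 𝓝[>] x, f t y = fp := by
  have h1 : Tendsto (fun y : ℝ => (t, y)) (𝓝[>] x) (𝓝 (t, x)) :=
    ((by fun_prop : Continuous fun y : ℝ => (t, y)).tendsto x).mono_left nhdsWithin_le_nhds
  filter_upwards [h1.eventually h, self_mem_nhdsWithin] with y hy hyx
  exact hy.2 (by simpa using hyx)

theorem HasTraces.left_unique {X : Type*} {f : ℝ → ℝ → X} {t x s s' : ℝ} {fm fp gm gp : X}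
    (h : HasTraces f t x s fm fp) (h' : HasTraces f t x s' gm gp) : fm = gm := by
  obtain ⟨y, h1, h2⟩ := (h.eventually_left.and h'.eventually_left).exists
  exact h1.symm.trans h2

theorem HasTraces.right_unique {X : Type*} {f : ℝ → ℝ → X} {t x s s' : ℝ} {fm fp gm gp : X}
    (h : HasTraces f t x s fm fp) (h' : HasTraces f t x s' gm gp) : fp = gp := by
  obtain ⟨y, h1, h2⟩ := (h.eventually_right.and h'.eventually_right).exists
  exact h1.symm.trans h2

theorem HasTraces.speed_le {X : Type*} {f : ℝ → ℝ → X} {t x s s' : ℝ} {fm fp : X}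
    (h : HasTraces f t x s fm fp) (h' : HasTraces f t x s' fm fp) (hne : fm ≠ fp) : s' ≤ s := by
  by_contra hlt
  push Not at hlt
  -- points between the two lines, just after time `t`
  have h1 : Tendsto (fun τ : ℝ => (τ, x + (s + s') / 2 * (τ - t))) (𝓝[>] t) (𝓝 (t, x)) := by
    have hc : Continuous fun τ : ℝ => (τ, x + (s + s') / 2 * (τ - t)) := by fun_prop
    have := hc.tendsto t
    simp only [sub_self, mul_zero, add_zero] at this
    exact this.mono_left nhdsWithin_le_nhds
  obtain ⟨τ, ⟨h2, h3⟩, h4⟩ :=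
    (((h1.eventually h).and (h1.eventually h')).and self_mem_nhdsWithin).exists
  have h4 : t < τ := h4
  have e1 := h2.2 (by nlinarith)
  have e2 := h3.1 (by nlinarith)
  exact hne (e2.symm.trans e1)

theorem HasTraces.speed_unique {X : Type*} {f : ℝ → ℝ → X} {t x s s' : ℝ} {fm fp gm gp : X}
    (h : HasTraces f t x s fm fp) (h' : HasTraces f t x s' gm gp) (hne : fm ≠ fp) : s' = s := by
  obtain rfl := h.left_unique h'
  obtain rfl := h.right_unique h'
  exact le_antisymm (h.speed_le h' hne) (h'.speed_le h hne)

/-- The traces of a field are values at nearby points of local constancy. -/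
theorem HasTraces.exists_locConstAt {X : Type*} {f : ℝ → ℝ → X} {t x s : ℝ} {fm fp : X}
    (h : HasTraces f t x s fm fp) :
    (∃ y, LocConstAt f t y ∧ f t y = fm) ∧ (∃ y, LocConstAt f t y ∧ f t y = fp) := by
  have h1 : ∀ l : Filter ℝ, l ≤ 𝓝 x → Tendsto (fun y : ℝ => (t, y)) l (𝓝 (t, x)) := fun l hl =>
    ((by fun_prop : Continuous fun y : ℝ => (t, y)).tendsto x).mono_left hl
  have h2 := eventually_eventually_nhds.2 h
  constructor
  · obtain ⟨y, hy, hyx⟩ := (((h1 _ (nhdsWithin_le_nhds (s := Iio x))).eventually h2).and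
      self_mem_nhdsWithin).exists
    have hlt : y < x + s * (t - t) := by simpa using hyx
    have e1 : f t y = fm := hy.self_of_nhds.1 hlt
    refine ⟨y, ?_, e1⟩
    refine Filter.Eventually.filter_mono nhdsWithin_le_nhds ?_
    have c1 : ∀ᶠ z : ℝ × ℝ in 𝓝 (t, y), z.2 < x + s * (z.1 - t) :=
      (continuous_snd.continuousAt).eventually_lt
        ((by fun_prop : Continuous fun z : ℝ × ℝ => x + s * (z.1 - t)).continuousAt) hlt
    filter_upwards [hy, c1] with z hz hz'
    rw [e1, hz.1 hz']
  · obtain ⟨y, hy, hyx⟩ := (((h1 _ (nhdsWithin_le_nhds (s := Ioi x))).eventually h2).and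
      self_mem_nhdsWithin).exists
    have hlt : x + s * (t - t) < y := by simpa using hyx
    have e1 : f t y = fp := hy.self_of_nhds.2 hlt
    refine ⟨y, ?_, e1⟩
    refine Filter.Eventually.filter_mono nhdsWithin_le_nhds ?_
    have c1 : ∀ᶠ z : ℝ × ℝ in 𝓝 (t, y), x + s * (z.1 - t) < z.2 :=
      ((by fun_prop : Continuous fun z : ℝ × ℝ => x + s * (z.1 - t)).continuousAt).eventually_lt
        continuous_snd.continuousAt hlt
    filter_upwards [hy, c1] with z hz hz'
    rw [e1, hz.2 hz']

theorem LocConstAt.not_isJump {X : Type*} {f : ℝ → ℝ → X} {t x s : ℝ} {fm fp : X}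
    (h : LocConstAt f t x) : ¬ IsJump f t x s fm fp := by
  rintro ⟨ht, hne, hT⟩
  have h2 : HasTraces f t x s (f t x) (f t x) := by
    have : {p : ℝ × ℝ | 0 ≤ p.1} ∈ 𝓝 (t, x) :=
      continuous_fst.continuousAt.eventually (le_mem_nhds (show (t, x).1 > 0 from ht))
    unfold LocConstAt at h
    rw [nhdsWithin_eq_nhds.2 this] at h
    exact h.mono fun z hz => ⟨fun _ => hz, fun _ => hz⟩
  exact hne ((hT.left_unique h2).trans (hT.right_unique h2).symm)

/-! ### Integrals in space of piecewise constant functions -/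

/-- Telescoping along a finite set ordered by an injective function. -/
theorem sum_insert_sub_eq {ι E : Type*} [DecidableEq ι] [AddCommGroup E] (f : ι → ℝ)
    (g : Finset ι → E) (s : Finset ι) (hf : ∀ p ∈ s, ∀ q ∈ s, f p = f q → p = q) :
    ∑ p ∈ s, (g (insert p (s.filter fun q => f q < f p)) - g (s.filter fun q => f q < f p)) =
      g s - g ∅ := by
  induction s using Finset.induction_on_max_value f with
  | empty => simp
  | insert a s ha hmax ih =>
    have hlt : ∀ q ∈ s, f q < f a := fun q hq => lt_of_le_of_ne (hmax q hq) fun h =>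
      ha (hf q (Finset.mem_insert_of_mem hq) a (Finset.mem_insert_self _ _) h ▸ hq)
    have h1 : (insert a s).filter (fun q => f q < f a) = s := by
      ext q
      simp only [Finset.mem_filter, Finset.mem_insert]
      refine ⟨?_, fun h => ⟨Or.inr h, hlt q h⟩⟩
      rintro ⟨rfl | h, h'⟩
      · exact absurd h' (lt_irrefl _)
      · exact h
    have h2 : ∀ p ∈ s, (insert a s).filter (fun q => f q < f p) = s.filter fun q => f q < f p := by
      intro p hp
      rw [Finset.filter_insert, if_neg (hlt p hp).not_gt]
    rw [Finset.sum_insert ha, h1, Finset.sum_congr rfl fun p hp => by rw [h2 p hp],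
      ih fun p hp q hq => hf p (Finset.mem_insert_of_mem hp) q (Finset.mem_insert_of_mem hq)]
    abel

/-- The jump across the line `p`, at time `t`, of a function of the set of lines to the left. -/
noncomputable def lineJump {E : Type*} [AddCommGroup E] (L : Finset (ℝ × ℝ))
    (u : Finset (ℝ × ℝ) → E) (t : ℝ) (p : ℝ × ℝ) : E :=
  u (insert p (below L t (linePos p t))) - u (below L t (linePos p t))

theorem comp_below_eq_sum {E : Type*} [AddCommGroup E] {L : Finset (ℝ × ℝ)} {t : ℝ}
    (ht : IsGeneric L t) (u : Finset (ℝ × ℝ) → E) (x : ℝ) :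
    ∑ p ∈ L, (if linePos p t < x then lineJump L u t p else 0) = u (below L t x) - u ∅ := by
  classical
  rw [← sum_insert_sub_eq (fun p => linePos p t) u (below L t x)
    fun p hp q hq => ht p (mem_below.1 hp).1 q (mem_below.1 hq).1]
  have h0 : below L t x = L.filter fun p => linePos p t < x := by
    ext p; simp [mem_below]
  rw [← Finset.sum_filter, ← h0]
  refine Finset.sum_congr rfl fun p hp => ?_
  have h1 : (below L t x).filter (fun q => linePos q t < linePos p t) =
      below L t (linePos p t) := by
    ext q
    simp only [Finset.mem_filter, mem_below]
    exact ⟨fun h => ⟨h.1.1, h.2⟩, fun h => ⟨⟨h.1, h.2.trans (mem_below.1 hp).2⟩, h.2⟩⟩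
  rw [h1, lineJump]

theorem sum_lineJump {E : Type*} [AddCommGroup E] {L : Finset (ℝ × ℝ)} {t : ℝ}
    (ht : IsGeneric L t) (u : Finset (ℝ × ℝ) → E) :
    ∑ p ∈ L, lineJump L u t p = u L - u ∅ := by
  obtain ⟨R, hR⟩ := (L.image fun p => linePos p t).bddAbove
  have hlt : ∀ p ∈ L, linePos p t < R + 1 := fun p hp => by
    have := hR (Finset.mem_coe.2 (Finset.mem_image_of_mem _ hp))
    linarith
  have h1 := comp_below_eq_sum ht u (R + 1)
  have h2 : below L t (R + 1) = L := by
    ext p; simp only [mem_below]; exact ⟨fun h => h.1, fun h => ⟨h, hlt p h⟩⟩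
  rw [h2] at h1
  rw [← h1]
  exact Finset.sum_congr rfl fun p hp => (if_pos (hlt p hp)).symm

theorem measurable_comp_below {E : Type*} [MeasurableSpace E] (L : Finset (ℝ × ℝ))
    (u : Finset (ℝ × ℝ) → E) (t : ℝ) : Measurable fun x => u (below L t x) := by
  classical
  have h1 : Measurable fun x : ℝ => fun p : L => linePos p.1 t < x := by
    refine measurable_pi_iff.2 fun p => ?_
    exact measurableSet_setOfPred.1 measurableSet_Ioi
  have h2 : Measurable fun b : L → Prop =>
      u ((Finset.univ.filter b).map (Function.Embedding.subtype _)) := measurable_of_finite _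
  convert h2.comp h1 using 2 with x
  simp only [Function.comp_apply]
  congr 1
  ext p
  simp [mem_below, and_comm]

/-- For bounded times, all the lines of `L` remain in a bounded interval. -/
theorem exists_linePos_bound (L : Finset (ℝ × ℝ)) (b : ℝ) :
    ∃ R : ℝ, 0 ≤ R ∧ ∀ t, |t| ≤ b → ∀ p ∈ L, |linePos p t| < R := by
  obtain ⟨R, hR⟩ := (L.image fun p => |p.1| + |p.2| * b).bddAbove
  refine ⟨|R| + 1, by positivity, fun t ht p hp => ?_⟩
  have h1 := hR (Finset.mem_coe.2 (Finset.mem_image_of_mem _ hp))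
  have h2 : |linePos p t| ≤ |p.1| + |p.2| * b := by
    unfold linePos
    refine (abs_add_le _ _).trans ?_
    rw [abs_mul]
    gcongr
  linarith [le_abs_self R]

theorem below_eq_empty {L : Finset (ℝ × ℝ)} {t x : ℝ} (h : ∀ p ∈ L, x < linePos p t) :
    below L t x = ∅ := by
  ext p
  simp only [mem_below, Finset.notMem_empty, iff_false, not_and, not_lt]
  exact fun hp => (h p hp).le

theorem below_eq_self {L : Finset (ℝ × ℝ)} {t x : ℝ} (h : ∀ p ∈ L, linePos p t < x) :
    below L t x = L := by
  ext p
  simp only [mem_below, and_iff_left_iff_imp]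
  exact h p

theorem below_subset (L : Finset (ℝ × ℝ)) (t x : ℝ) : below L t x ⊆ L :=
  fun _ hp => (mem_below.1 hp).1

theorem exists_norm_comp_below_le {E : Type*} [NormedAddCommGroup E] (L : Finset (ℝ × ℝ))
    (u : Finset (ℝ × ℝ) → E) : ∃ B : ℝ, 0 ≤ B ∧ ∀ t x, ‖u (below L t x)‖ ≤ B := by
  obtain ⟨B, hB⟩ := (L.powerset.image fun s => ‖u s‖).bddAbove
  refine ⟨|B|, abs_nonneg _, fun t x => ?_⟩
  exact (hB (Finset.mem_coe.2 (Finset.mem_image_of_mem _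
    (Finset.mem_powerset.2 (below_subset L t x))))).trans (le_abs_self B)

/-- A function of the set of lines to the left is bounded, with compact support in space, when it
vanishes at both ends. -/
theorem exists_indicator_bound {E : Type*} [NormedAddCommGroup E] (L : Finset (ℝ × ℝ))
    {u : Finset (ℝ × ℝ) → E} (h0 : u ∅ = 0) (h1 : u L = 0) (b : ℝ) :
    ∃ B R : ℝ, ∀ t, |t| ≤ b → ∀ x,
      ‖u (below L t x)‖ ≤ (Icc (-R) R).indicator (fun _ => B) x := by
  obtain ⟨B, hB0, hB⟩ := exists_norm_comp_below_le L u
  obtain ⟨R, hR0, hR⟩ := exists_linePos_bound L b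
  refine ⟨B, R, fun t ht x => ?_⟩
  by_cases hx : x ∈ Icc (-R) R
  · rw [indicator_of_mem hx]; exact hB t x
  · rw [indicator_of_notMem hx]
    rw [mem_Icc, not_and_or, not_le, not_le] at hx
    rcases hx with hx | hx
    · rw [below_eq_empty fun p hp => hx.trans (abs_lt.1 (hR t ht p hp)).1, h0, norm_zero]
    · rw [below_eq_self fun p hp => (abs_lt.1 (hR t ht p hp)).2.trans hx, h1, norm_zero]

section slices

variable {E : Type*} [NormedAddCommGroup E] [MeasurableSpace E] [BorelSpace E]
  [SecondCountableTopology E]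

theorem integrable_comp_below {L : Finset (ℝ × ℝ)} {u : Finset (ℝ × ℝ) → E} (h0 : u ∅ = 0)
    (h1 : u L = 0) (t : ℝ) : Integrable fun x => u (below L t x) := by
  obtain ⟨B, R, hB⟩ := exists_indicator_bound L h0 h1 |t|
  refine Integrable.mono' (g := (Icc (-R) R).indicator fun _ => B) ?_
    (measurable_comp_below L u t).aestronglyMeasurable (ae_of_all _ (hB t le_rfl))
  exact (integrable_indicator_iff measurableSet_Icc).2 (integrableOn_const (by simp))

theorem continuous_integral_comp_below [NormedSpace ℝ E] {L : Finset (ℝ × ℝ)}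
    {u : Finset (ℝ × ℝ) → E} (h0 : u ∅ = 0) (h1 : u L = 0) :
    Continuous fun t => ∫ x, u (below L t x) := by
  rw [continuous_iff_continuousAt]
  intro t
  obtain ⟨B, R, hB⟩ := exists_indicator_bound L h0 h1 (|t| + 1)
  have hev : ∀ᶠ τ in 𝓝 t, |τ| ≤ |t| + 1 :=
    (continuous_abs.continuousAt.eventually_lt continuousAt_const (lt_add_one |t|)).mono
      fun _ h => le_of_lt h
  refine tendsto_integral_filter_of_dominated_convergence ((Icc (-R) R).indicator fun _ => B)
    (Eventually.of_forall fun τ => (measurable_comp_below L u τ).aestronglyMeasurable)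
    (hev.mono fun τ hτ => ae_of_all _ (hB τ hτ))
    ((integrable_indicator_iff measurableSet_Icc).2 (integrableOn_const (by simp))) ?_
  filter_upwards [ae_offLines L t] with x hx
  have h2 : Tendsto (fun τ : ℝ => (τ, x)) (𝓝 t) (𝓝 (t, x)) :=
    (by fun_prop : Continuous fun τ : ℝ => (τ, x)).tendsto t
  refine tendsto_const_nhds.congr' ?_
  filter_upwards [h2.eventually (eventually_below_eq hx)] with τ hτ
  rw [hτ.2]

end slices

theorem integral_comp_below {L : Finset (ℝ × ℝ)} {u : Finset (ℝ × ℝ) → ℝ} (h0 : u ∅ = 0)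
    (h1 : u L = 0) {t : ℝ} (ht : IsGeneric L t) :
    ∫ x, u (below L t x) = -∑ p ∈ L, lineJump L u t p * linePos p t := by
  obtain ⟨R, hR0, hR⟩ := exists_linePos_bound L |t|
  have hsum : ∑ p ∈ L, lineJump L u t p = 0 := by rw [sum_lineJump ht u, h0, h1, sub_zero]
  have hrep : ∀ x, u (below L t x) =
      ∑ p ∈ L, (Ioc (linePos p t) R).indicator (fun _ => lineJump L u t p) x := by
    intro x
    have h2 := comp_below_eq_sum ht u x
    rw [h0, sub_zero] at h2
    rw [← h2]
    by_cases hx : x ≤ R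
    · refine Finset.sum_congr rfl fun p _ => ?_
      simp [indicator, hx]
    · rw [Finset.sum_congr rfl fun p hp => if_pos
        ((abs_lt.1 (hR t le_rfl p hp)).2.trans (not_le.1 hx)), hsum]
      symm
      refine Finset.sum_eq_zero fun p _ => ?_
      simp [indicator, hx]
  simp_rw [hrep]
  rw [integral_finsetSum _ fun p _ =>
    (integrable_indicator_iff measurableSet_Ioc).2 (integrableOn_const (by simp))]
  have h3 : ∀ p ∈ L, ∫ x, (Ioc (linePos p t) R).indicator (fun _ => lineJump L u t p) x =
      (R - linePos p t) * lineJump L u t p := by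
    intro p hp
    rw [integral_indicator_const _ measurableSet_Ioc]
    have := (abs_lt.1 (hR t le_rfl p hp)).2.le
    simp [Measure.real, Real.volume_Ioc, ENNReal.toReal_ofReal (sub_nonneg.2 this)]
  rw [Finset.sum_congr rfl h3]
  simp only [sub_mul, Finset.sum_sub_distrib]
  rw [← Finset.mul_sum, hsum]
  simp [mul_comm]

theorem hasDerivAt_integral_comp_below {L : Finset (ℝ × ℝ)} {u : Finset (ℝ × ℝ) → ℝ}
    (h0 : u ∅ = 0) (h1 : u L = 0) {t : ℝ} (ht : IsGeneric L t) :
    HasDerivAt (fun τ => ∫ x, u (below L τ x)) (-∑ p ∈ L, lineJump L u t p * p.2) t := by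
  have hd : HasDerivAt (fun τ => -∑ p ∈ L, lineJump L u t p * linePos p τ)
      (-∑ p ∈ L, lineJump L u t p * p.2) t := by
    refine HasDerivAt.neg (HasDerivAt.fun_sum fun p _ => HasDerivAt.const_mul _ ?_)
    have h2 := ((hasDerivAt_id t).const_mul p.2).const_add p.1
    rw [mul_one] at h2
    exact h2
  refine hd.congr_of_eventuallyEq ?_
  filter_upwards [eventually_isGeneric ht] with τ hτ
  rw [integral_comp_below h0 h1 hτ.1]
  congr 1
  refine Finset.sum_congr rfl fun p hp => ?_
  rw [lineJump, lineJump, hτ.2 p hp]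

/-! ### The Rankine–Hugoniot relation -/

/-- Integration of a compactly supported derivative against a step function. -/
theorem integral_deriv_smul_step {E : Type*} [NormedAddCommGroup E] [NormedSpace ℝ E]
    [CompleteSpace E] {b : ℝ → ℝ} (hb : ContDiff ℝ ∞ b) (hbc : HasCompactSupport b) (em ep : E) :
    ∫ y, deriv b y • (if y < 0 then em else ep) = b 0 • (em - ep) := by
  have hd : ∀ y, HasDerivAt b (deriv b y) y := fun y =>
    ((hb.differentiable (by simp)) y).hasDerivAt
  have hi : Integrable (deriv b) :=
    (hb.continuous_deriv (by simp)).integrable_of_hasCompactSupport hbc.deriv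
  have hzero : ∀ l : Filter ℝ, l ≤ cocompact ℝ → Tendsto b l (𝓝 0) := fun l hl =>
    tendsto_const_nhds.congr' (Filter.EventuallyEq.symm
      (hl (coclosedCompact_eq_cocompact (X := ℝ) ▸ hasCompactSupport_iff_eventuallyEq.1 hbc)))
  have hm : ∫ y in Iic 0, deriv b y = b 0 := by
    rw [integral_Iic_of_hasDerivAt_of_tendsto' (fun y _ => hd y) hi.integrableOn
      (hzero atBot atBot_le_cocompact), sub_zero]
  have hp : ∫ y in Ioi 0, deriv b y = -b 0 := by
    rw [integral_Ioi_of_hasDerivAt_of_tendsto' (fun y _ => hd y) hi.integrableOn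
      (hzero atTop atTop_le_cocompact), zero_sub]
  have hsplit : ∀ y, y ≠ 0 → deriv b y • (if y < 0 then em else ep) =
      (Iic 0).indicator (fun y => deriv b y • em) y +
        (Ioi 0).indicator (fun y => deriv b y • ep) y := by
    intro y hy
    rcases lt_or_gt_of_ne hy with h | h
    · simp [h, h.le, h.not_gt]
    · simp [h, h.not_gt, h.not_ge]
  have hae : ∀ᵐ y : ℝ, deriv b y • (if y < 0 then em else ep) =
      (Iic 0).indicator (fun y => deriv b y • em) y +
        (Ioi 0).indicator (fun y => deriv b y • ep) y := by
    have : ∀ᵐ y : ℝ, y ≠ 0 := by simp [ae_iff]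
    exact this.mono hsplit
  rw [integral_congr_ae hae, integral_add
    ((hi.smul_const em).indicator measurableSet_Iic)
    ((hi.smul_const ep).indicator measurableSet_Ioi),
    integral_indicator measurableSet_Iic, integral_indicator measurableSet_Ioi,
    integral_smul_const, integral_smul_const, hm, hp]
  module

/-- The Rankine–Hugoniot relation `s [ψ] = [A ψ]` at a regular point of a discontinuity line. -/
theorem IsWeakSolution.rankineHugoniot {N : ℕ} {A : ℝ → ℝ → Mat N} {ψ : ℝ → ℝ → Vec N}
    (h : IsWeakSolution A ψ) {t₀ x₀ s : ℝ} (ht₀ : 0 < t₀) {Am Ap : Mat N} {ψm ψp : Vec N}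
    (hA : HasTraces A t₀ x₀ s Am Ap) (hψ : HasTraces ψ t₀ x₀ s ψm ψp) :
    s • (ψm - ψp) = Am ψm - Ap ψp := by
  have hev : ∀ᶠ z : ℝ × ℝ in 𝓝 (t₀, x₀), 0 < z.1 ∧
      (z.2 < x₀ + s * (z.1 - t₀) → A z.1 z.2 = Am ∧ ψ z.1 z.2 = ψm) ∧
      (x₀ + s * (z.1 - t₀) < z.2 → A z.1 z.2 = Ap ∧ ψ z.1 z.2 = ψp) := by
    have h1 : ∀ᶠ z : ℝ × ℝ in 𝓝 (t₀, x₀), 0 < z.1 :=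
      continuous_fst.continuousAt.eventually (lt_mem_nhds ht₀)
    filter_upwards [h1, hA, hψ] with z h1 h2 h3
    exact ⟨h1, fun hz => ⟨h2.1 hz, h3.1 hz⟩, fun hz => ⟨h2.2 hz, h3.2 hz⟩⟩
  -- in the coordinates `(t, y)` with `y` the distance to the line
  have hev' : ∀ᶠ z : ℝ × ℝ in 𝓝 (t₀, (0 : ℝ)), 0 < z.1 ∧
      (z.2 < 0 → A z.1 (x₀ + s * (z.1 - t₀) + z.2) = Am ∧
        ψ z.1 (x₀ + s * (z.1 - t₀) + z.2) = ψm) ∧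
      (0 < z.2 → A z.1 (x₀ + s * (z.1 - t₀) + z.2) = Ap ∧
        ψ z.1 (x₀ + s * (z.1 - t₀) + z.2) = ψp) := by
    have hc : Tendsto (fun z : ℝ × ℝ => (z.1, x₀ + s * (z.1 - t₀) + z.2)) (𝓝 (t₀, 0))
        (𝓝 (t₀, x₀)) := by
      have : Continuous fun z : ℝ × ℝ => (z.1, x₀ + s * (z.1 - t₀) + z.2) := by fun_prop
      simpa using this.tendsto (t₀, 0)
    filter_upwards [hc.eventually hev] with z hz
    exact ⟨hz.1, fun h' => hz.2.1 (by simpa using h'), fun h' => hz.2.2 (by simpa using h')⟩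
  obtain ⟨ε, hε, hball⟩ := Metric.eventually_nhds_iff_ball.1 hev'
  let a : ContDiffBump t₀ := ⟨ε / 4, ε / 2, by positivity, by linarith⟩
  let b : ContDiffBump (0 : ℝ) := ⟨ε / 4, ε / 2, by positivity, by linarith⟩
  have ha : ContDiff ℝ ∞ a := a.contDiff
  have hb : ContDiff ℝ ∞ b := b.contDiff
  have hac : HasCompactSupport a := a.hasCompactSupport
  have hbc : HasCompactSupport b := b.hasCompactSupport
  have hsupp : ∀ t y : ℝ, |t - t₀| ≤ ε / 2 → |y| ≤ ε / 2 →
      (t, y) ∈ Metric.ball (t₀, (0 : ℝ)) ε := by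
    intro t y h1 h2
    rw [Metric.mem_ball, Prod.dist_eq, max_lt_iff]
    simp only [Real.dist_eq, sub_zero]
    constructor <;> linarith
  let φ : ℝ × ℝ → ℝ := fun z => a z.1 * b (z.2 - x₀ - s * (z.1 - t₀))
  have hφ : ContDiff ℝ ∞ φ := by
    refine (ha.comp contDiff_fst).mul (hb.comp ?_)
    fun_prop
  have hφ0 : ∀ z : ℝ × ℝ, φ z ≠ 0 → |z.1 - t₀| ≤ ε / 2 ∧ |z.2 - x₀ - s * (z.1 - t₀)| ≤ ε / 2 := by
    intro z hz
    obtain ⟨h1, h2⟩ := mul_ne_zero_iff.1 hz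
    constructor
    · by_contra hcon
      exact h1 (a.zero_of_le_dist (by simpa [Real.dist_eq] using (not_le.1 hcon).le))
    · by_contra hcon
      exact h2 (b.zero_of_le_dist (by simpa [Real.dist_eq] using (not_le.1 hcon).le))
  let Kc : Set (ℝ × ℝ) := {z | |z.1 - t₀| ≤ ε / 2 ∧ |z.2 - x₀ - s * (z.1 - t₀)| ≤ ε / 2}
  have hKclosed : IsClosed Kc := by
    have c1 : Continuous fun z : ℝ × ℝ => |z.1 - t₀| := by fun_prop
    have c2 : Continuous fun z : ℝ × ℝ => |z.2 - x₀ - s * (z.1 - t₀)| := by fun_prop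
    exact (isClosed_le c1 continuous_const).inter (isClosed_le c2 continuous_const)
  have hts : tsupport φ ⊆ Kc := closure_minimal (fun z hz => hφ0 z hz) hKclosed
  have hφc : HasCompactSupport φ := by
    have hK : IsCompact ((fun z : ℝ × ℝ => (z.1, x₀ + s * (z.1 - t₀) + z.2)) ''
        (Metric.closedBall t₀ (ε / 2) ×ˢ Metric.closedBall (0 : ℝ) (ε / 2))) :=
      ((isCompact_closedBall _ _).prod (isCompact_closedBall _ _)).image (by fun_prop)
    refine hK.of_isClosed_subset (isClosed_tsupport _) (hts.trans ?_)
    rintro ⟨t, x⟩ ⟨h1, h2⟩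
    refine ⟨(t, x - x₀ - s * (t - t₀)), ⟨?_, ?_⟩, ?_⟩
    · simpa [Real.dist_eq] using h1
    · simpa [Real.dist_eq] using h2
    · simp only [Prod.mk.injEq, true_and]; ring
  have hφpos : tsupport φ ⊆ {p | 0 < p.1} := by
    intro z hz
    obtain ⟨h1, h2⟩ := hts hz
    exact (hball _ (hsupp z.1 _ h1 h2)).1
  have hw := h φ hφ hφc hφpos
  have hda : ∀ t, HasDerivAt a (deriv a t) t := fun t =>
    ((ha.differentiable (by simp)) t).hasDerivAt
  have hdb : ∀ t, HasDerivAt b (deriv b t) t := fun t =>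
    ((hb.differentiable (by simp)) t).hasDerivAt
  have hfd : ∀ z : ℝ × ℝ, HasFDerivAt φ (a z.1 • (deriv b (z.2 - x₀ - s * (z.1 - t₀)) •
      (ContinuousLinearMap.snd ℝ ℝ ℝ - s • ContinuousLinearMap.fst ℝ ℝ ℝ)) +
      b (z.2 - x₀ - s * (z.1 - t₀)) • (deriv a z.1 • ContinuousLinearMap.fst ℝ ℝ ℝ)) z := by
    intro z
    refine HasFDerivAt.mul ((hda z.1).comp_hasFDerivAt z hasFDerivAt_fst) ?_
    refine (hdb _).comp_hasFDerivAt z ?_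
    exact (hasFDerivAt_snd.sub_const x₀).sub ((hasFDerivAt_fst.sub_const t₀).const_mul s)
  have hft : ∀ z : ℝ × ℝ, fderiv ℝ φ z (1, 0) =
      deriv a z.1 * b (z.2 - x₀ - s * (z.1 - t₀)) -
        s * (a z.1 * deriv b (z.2 - x₀ - s * (z.1 - t₀))) := by
    intro z
    rw [(hfd z).fderiv]
    simp
    ring
  have hfx : ∀ z : ℝ × ℝ, fderiv ℝ φ z (0, 1) =
      a z.1 * deriv b (z.2 - x₀ - s * (z.1 - t₀)) := by
    intro z
    rw [(hfd z).fderiv]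
    simp
  -- the fields may be replaced by step functions of the distance to the line
  let Ψ : ℝ → Vec N := fun y => if y < 0 then ψm else ψp
  let Q : ℝ → Vec N := fun y => if y < 0 then Am ψm else Ap ψp
  let G : ℝ → ℝ → Vec N := fun t y =>
    (deriv a t * b y) • Ψ y + (a t * deriv b y) • (Q y - s • Ψ y)
  have hline : ∀ᵐ z : ℝ × ℝ, z.2 - x₀ - s * (z.1 - t₀) ≠ 0 := by
    rw [Measure.volume_eq_prod]
    refine Measure.ae_prod_iff_ae_ae ?_ |>.2 ?_
    · exact (measurableSet_eq_fun (by fun_prop) (by fun_prop)).compl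
    · refine ae_of_all _ fun t => ?_
      have : {y : ℝ | ¬ (y - x₀ - s * (t - t₀) ≠ 0)} ⊆ {x₀ + s * (t - t₀)} := by
        intro y hy
        simp only [ne_eq, not_not, mem_ofPred_eq] at hy
        simp only [mem_singleton_iff]; linarith
      exact measure_mono_null this (by simp)
  have hcongr : ∀ᵐ z : ℝ × ℝ, fderiv ℝ φ z (1, 0) • ψ z.1 z.2 +
      fderiv ℝ φ z (0, 1) • A z.1 z.2 (ψ z.1 z.2) = G z.1 (z.2 - x₀ - s * (z.1 - t₀)) := by
    filter_upwards [hline] with z hz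
    rw [hft, hfx]
    set y := z.2 - x₀ - s * (z.1 - t₀) with hy
    have hzy : z.2 = x₀ + s * (z.1 - t₀) + y := by rw [hy]; ring
    by_cases hK : z ∈ Kc
    · have hb2 := hball _ (hsupp z.1 y hK.1 hK.2)
      rcases lt_or_gt_of_ne hz with hlt | hgt
      · obtain ⟨e1, e2⟩ := hb2.2.1 hlt
        simp only at e1 e2
        rw [hzy, e1, e2]
        simp only [G, Ψ, Q, if_pos hlt]
        module
      · obtain ⟨e1, e2⟩ := hb2.2.2 hgt
        simp only at e1 e2
        rw [hzy, e1, e2]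
        simp only [G, Ψ, Q, if_neg hgt.not_gt]
        module
    · have e0 : fderiv ℝ φ z = 0 := by
        by_contra hne
        exact hK (hts (support_fderiv_subset ℝ hne))
      have e1 := hft z
      have e2 := hfx z
      rw [e0] at e1 e2
      simp only [zero_apply] at e1 e2
      rw [← hy] at e1 e2
      have e3 : deriv a z.1 * b y = 0 := by rw [← e2] at e1; linarith
      simp only [G]
      rw [e3, ← e2]
      simp
  rw [integral_congr_ae hcongr] at hw
  have hcda : Continuous (deriv a) := ha.continuous_deriv (by simp)
  have hcdb : Continuous (deriv b) := hb.continuous_deriv (by simp)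
  have hbound : ∀ (f : ℝ → ℝ) (em ep : Vec N), Continuous f → HasCompactSupport f →
      Integrable fun y => f y • (if y < 0 then em else ep) := by
    intro f em ep hf hfc
    have h1 : Integrable f := hf.integrable_of_hasCompactSupport hfc
    refine h1.smul_of_top_left ?_
    refine memLp_top_of_bound ?_ (max ‖em‖ ‖ep‖) (ae_of_all _ fun y => ?_)
    · exact (Measurable.ite measurableSet_Iio measurable_const
        measurable_const).aestronglyMeasurable
    · split_ifs
      · exact le_max_left _ _
      · exact le_max_right _ _
  have i1 : Integrable (deriv a) := hcda.integrable_of_hasCompactSupport hac.deriv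
  have i2 : Integrable a := ha.continuous.integrable_of_hasCompactSupport hac
  have j1 := i1.smul_prod (hbound b ψm ψp hb.continuous hbc)
  have j2 := i2.smul_prod (hbound (deriv b) (Am ψm - s • ψm) (Ap ψp - s • ψp) hcdb hbc.deriv)
  have hGeq : (fun z : ℝ × ℝ => G z.1 z.2) = fun z : ℝ × ℝ =>
      deriv a z.1 • (b z.2 • (if z.2 < 0 then ψm else ψp)) +
      a z.1 • (deriv b z.2 • (if z.2 < 0 then Am ψm - s • ψm else Ap ψp - s • ψp)) := by
    funext z
    simp only [G, Ψ, Q]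
    split_ifs <;> module
  have hG : Integrable (fun z : ℝ × ℝ => G z.1 z.2) := by
    rw [hGeq]
    exact j1.add j2
  have hshear : MeasurePreserving (fun z : ℝ × ℝ => (z.1, z.2 - x₀ - s * (z.1 - t₀)))
      (volume : Measure (ℝ × ℝ)) volume := by
    rw [Measure.volume_eq_prod]
    refine (MeasurePreserving.id (volume : Measure ℝ)).skew_product
      (g := fun t x => x - x₀ - s * (t - t₀)) (by fun_prop) (ae_of_all _ fun t => ?_)
    have : (fun x : ℝ => x - x₀ - s * (t - t₀)) = fun x => x - (x₀ + s * (t - t₀)) := by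
      funext x; ring
    rw [this]
    exact (measurePreserving_sub_right volume _).map_eq
  have hint : ∫ z : ℝ × ℝ, G z.1 z.2 = 0 := by
    have hmap := integral_map (f := fun z : ℝ × ℝ => G z.1 z.2) hshear.measurable.aemeasurable
      (by rw [hshear.map_eq]; exact hG.aestronglyMeasurable)
    rw [hshear.map_eq] at hmap
    exact hmap.trans hw
  have ha0 : ∫ t, deriv a t = 0 := integral_eq_zero_of_hasDerivAt_of_integrable hda i1 i2
  rw [hGeq, Measure.volume_eq_prod, integral_add j1 j2,
    integral_prod_smul (deriv a) (fun y => b y • (if y < 0 then ψm else ψp)),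
    integral_prod_smul a (fun y => deriv b y • (if y < 0 then Am ψm - s • ψm else Ap ψp - s • ψp)),
    ha0, zero_smul, zero_add, integral_deriv_smul_step hb hbc] at hint
  have hb0 : b 0 ≠ 0 := by
    rw [b.one_of_mem_closedBall (by simpa using b.rIn_pos.le)]
    exact one_ne_zero
  have hapos : ∫ t, a t ≠ 0 := a.integral_pos.ne'
  have := (smul_eq_zero.1 ((smul_eq_zero.1 hint).resolve_left hapos)).resolve_left hb0
  rw [smul_sub]
  have e : s • ψm - s • ψp - (Am ψm - Ap ψp) = -(Am ψm - s • ψm - (Ap ψp - s • ψp)) := by abel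
  rw [← sub_eq_zero, e, this, neg_zero]

/-! ### Uniformly hyperbolic matrices -/

/-- The coordinates in the family `r` are controlled by the norm, with constant `m`. -/
def CoordBound {N : ℕ} (m : ℝ) (r : Fin N → Vec N) : Prop :=
  ∀ a : Fin N → ℝ, ∑ j, |a j| ≤ m * ‖∑ j, a j • r j‖

theorem exists_coordBound {N : ℕ} {r : Fin N → Vec N} (hr : LinearIndependent ℝ r) :
    ∃ m, 0 < m ∧ CoordBound m r := by
  have hinj : LinearMap.ker (Fintype.linearCombination ℝ r) = ⊥ :=
    LinearMap.ker_eq_bot.2 (linearIndependent_iff_injective_fintypeLinearCombination.1 hr)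
  obtain ⟨k, hk, hanti⟩ := (Fintype.linearCombination ℝ r).exists_antilipschitzWith hinj
  refine ⟨N * k + 1, by positivity, fun a => ?_⟩
  have h1 : ‖a‖ ≤ k * ‖∑ j, a j • r j‖ := by
    have := hanti.le_mul_dist a 0
    rw [dist_zero_right, map_zero, dist_zero_right, Fintype.linearCombination_apply] at this
    exact this
  calc ∑ j, |a j| ≤ ∑ _j : Fin N, ‖a‖ := Finset.sum_le_sum fun j _ => norm_le_pi_norm a j
    _ = N * ‖a‖ := by simp
    _ ≤ N * (k * ‖∑ j, a j • r j‖) := by gcongr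
    _ ≤ (N * k + 1) * ‖∑ j, a j • r j‖ := by nlinarith [norm_nonneg (∑ j, a j • r j)]

/-- A small perturbation of a basis is a basis, with control of the coordinates. -/
theorem CoordBound.perturb {N : ℕ} {m δ : ℝ} {r r' : Fin N → Vec N} (h : CoordBound m r)
    (hm : 0 ≤ m) (hδ : m * δ ≤ 1 / 2) (hr : ∀ j, ‖r' j - r j‖ ≤ δ) : CoordBound (2 * m) r' := by
  intro a
  have h1 : ‖∑ j, a j • r j‖ ≤ ‖∑ j, a j • r' j‖ + (∑ j, |a j|) * δ := by
    have e : ∑ j, a j • r j = ∑ j, a j • r' j - ∑ j, a j • (r' j - r j) := by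
      rw [← Finset.sum_sub_distrib]
      exact Finset.sum_congr rfl fun j _ => by module
    rw [e]
    refine (norm_sub_le _ _).trans ?_
    gcongr
    refine (norm_sum_le _ _).trans ?_
    rw [Finset.sum_mul]
    gcongr with j
    rw [norm_smul, Real.norm_eq_abs]
    gcongr
    exact hr j
  have h2 := h a
  have h3 : 0 ≤ ∑ j, |a j| := Finset.sum_nonneg fun j _ => abs_nonneg _
  nlinarith [mul_le_mul_of_nonneg_left h1 hm]

theorem CoordBound.linearIndependent {N : ℕ} {m : ℝ} {r : Fin N → Vec N} (h : CoordBound m r) :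
    LinearIndependent ℝ r := by
  rw [Fintype.linearIndependent_iff]
  intro a ha j
  have h1 := h a
  rw [ha, norm_zero, mul_zero] at h1
  have h2 : |a j| ≤ ∑ j, |a j| :=
    Finset.single_le_sum (f := fun j => |a j|) (fun j _ => abs_nonneg _) (Finset.mem_univ j)
  exact abs_eq_zero.1 (le_antisymm (h2.trans h1) (abs_nonneg _))

theorem exists_gap {N : ℕ} {lo hi : Fin N → ℝ} (hI : ∀ j k : Fin N, j < k → hi j < lo k) :
    ∃ g, 0 < g ∧ ∀ j k : Fin N, j < k → g ≤ lo k - hi j := by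
  have : ∀ᶠ g : ℝ in 𝓝[>] 0, ∀ j k : Fin N, j < k → g ≤ lo k - hi j := by
    refine eventually_all.2 fun j => eventually_all.2 fun k => ?_
    by_cases hjk : j < k
    · refine (Eventually.filter_mono nhdsWithin_le_nhds
        (ge_mem_nhds (sub_pos.2 (hI j k hjk)))).mono fun g hg _ => hg
    · exact Eventually.of_forall fun g h => absurd h hjk
  obtain ⟨g, h1, h2⟩ := (this.and self_mem_nhdsWithin).exists
  exact ⟨g, h2, h1⟩

/-- The matrix `M` has eigenvalues in the intervals `[lo j, hi j]`, and a basis of unit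
eigenvectors in which the coordinates are controlled with constant `m`. -/
structure IsRegularMat {N : ℕ} (lo hi : Fin N → ℝ) (rbar : Fin N → Vec N) (m δ : ℝ) (M : Mat N) :
    Prop where
  mem : ∀ j, eigval M j ∈ Icc (lo j) (hi j)
  apply_eigvec : ∀ j, M (eigvec rbar M j) = eigval M j • eigvec rbar M j
  norm_eigvec : ∀ j, ‖eigvec rbar M j‖ = 1
  close : ∀ j, ‖eigvec rbar M j - rbar j‖ ≤ δ
  coordBound : CoordBound m (eigvec rbar M)

section regular

variable {N : ℕ} {lo hi : Fin N → ℝ} {rbar : Fin N → Vec N} {m δ : ℝ} {M : Mat N}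

theorem IsUniformlyHyperbolicBV.isRegularMat {V : ℝ} {A : ℝ → ℝ → Mat N}
    (hA : IsUniformlyHyperbolicBV lo hi rbar δ V A) (hrbar : CoordBound m rbar) (hm : 0 ≤ m)
    (hδ : m * δ ≤ 1 / 2) {t x : ℝ} (ht : 0 ≤ t) (h : LocConstAt A t x) :
    IsRegularMat lo hi rbar (2 * m) δ (A t x) := by
  have hclose := hA.eigvec_close t x ht h
  have hex : ∀ j, ∃ v : Vec N, A t x v = eigval (A t x) j • v ∧ ‖v‖ = 1 ∧
      0 < inner ℝ (rbar j) v := by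
    intro j
    by_contra hcon
    have h1 := hclose j
    rw [eigvec, dif_neg hcon, zero_sub, norm_neg] at h1
    have h2 := hrbar (Pi.single j 1)
    have h3 : ∑ k, (Pi.single j (1 : ℝ) : Fin N → ℝ) k • rbar k = rbar j := by
      rw [Finset.sum_eq_single j]
      · simp
      · intro k _ hk; simp [hk]
      · simp
    have h4 : ∑ k, |(Pi.single j (1 : ℝ) : Fin N → ℝ) k| = 1 := by
      rw [Finset.sum_eq_single j]
      · simp
      · intro k _ hk; simp [hk]
      · simp
    rw [h3, h4] at h2
    nlinarith [mul_le_mul_of_nonneg_left h1 hm]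
  have hspec : ∀ j, A t x (eigvec rbar (A t x) j) = eigval (A t x) j • eigvec rbar (A t x) j ∧
      ‖eigvec rbar (A t x) j‖ = 1 := by
    intro j
    rw [eigvec, dif_pos (hex j)]
    exact ⟨(hex j).choose_spec.1, (hex j).choose_spec.2.1⟩
  exact ⟨hA.eigval_mem t x ht h, fun j => (hspec j).1, fun j => (hspec j).2, hclose,
    hrbar.perturb hm hδ hclose⟩

namespace IsRegularMat

theorem sum_charComp (h : IsRegularMat lo hi rbar m δ M) (v : Vec N) :
    ∑ j, charComp rbar M v j • eigvec rbar M j = v := by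
  have hex : ∃ a : Fin N → ℝ, v = ∑ j, a j • eigvec rbar M j := by
    have hspan := h.coordBound.linearIndependent.span_eq_top_of_card_eq_finrank' (by simp)
    have hv : v ∈ Submodule.span ℝ (range (eigvec rbar M)) := hspan ▸ Submodule.mem_top
    obtain ⟨a, ha⟩ := (Submodule.mem_span_range_iff_exists_fun ℝ).1 hv
    exact ⟨a, ha.symm⟩
  rw [charComp, dif_pos hex]
  exact hex.choose_spec.symm

theorem charComp_eq (h : IsRegularMat lo hi rbar m δ M) {v : Vec N} {a : Fin N → ℝ}
    (ha : ∑ j, a j • eigvec rbar M j = v) : charComp rbar M v = a := by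
  have h1 := h.sum_charComp v
  have h2 := Fintype.linearIndependent_iff.1 h.coordBound.linearIndependent
    (fun j => charComp rbar M v j - a j) (by
      simp only [sub_smul, Finset.sum_sub_distrib]
      rw [h1, ha, sub_self])
  funext j
  exact sub_eq_zero.1 (h2 j)

theorem charComp_zero (h : IsRegularMat lo hi rbar m δ M) (j : Fin N) :
    charComp rbar M 0 j = 0 := by
  rw [h.charComp_eq (a := 0) (by simp)]
  rfl

theorem sum_abs_charComp_le (h : IsRegularMat lo hi rbar m δ M) (v : Vec N) :
    ∑ j, |charComp rbar M v j| ≤ m * ‖v‖ := by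
  have := h.coordBound (charComp rbar M v)
  rwa [h.sum_charComp] at this

theorem norm_le_sum_abs_charComp (h : IsRegularMat lo hi rbar m δ M) (v : Vec N) :
    ‖v‖ ≤ ∑ j, |charComp rbar M v j| := by
  conv_lhs => rw [← h.sum_charComp v]
  refine (norm_sum_le _ _).trans (Finset.sum_le_sum fun j _ => ?_)
  rw [norm_smul, h.norm_eigvec, mul_one, Real.norm_eq_abs]

theorem apply_eq_sum (h : IsRegularMat lo hi rbar m δ M) (v : Vec N) :
    M v = ∑ j, (eigval M j * charComp rbar M v j) • eigvec rbar M j := by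
  conv_lhs => rw [← h.sum_charComp v]
  rw [map_sum]
  refine Finset.sum_congr rfl fun j _ => ?_
  rw [map_smul, h.apply_eigvec, smul_smul, mul_comm]

theorem smul_sub_apply_eq_sum (h : IsRegularMat lo hi rbar m δ M) (s : ℝ) (v : Vec N) :
    s • v - M v = ∑ j, ((s - eigval M j) * charComp rbar M v j) • eigvec rbar M j := by
  rw [h.apply_eq_sum v]
  nth_rw 1 [← h.sum_charComp v]
  rw [Finset.smul_sum, ← Finset.sum_sub_distrib]
  exact Finset.sum_congr rfl fun j _ => by module

variable {Am Ap : Mat N} {g : ℝ}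

/-- Lipschitz dependence of the eigenvalues and of the eigenvectors: expand `r_k⁻` in the basis
`r_j⁺`. The component along `r_k⁺` is close to `1`, the other ones are controlled because
`A⁺ r_k⁻ - λ_k⁻ r_k⁻ = (A⁺ - A⁻) r_k⁻`. -/
theorem lipschitz (hm : IsRegularMat lo hi rbar m δ Am) (hp : IsRegularMat lo hi rbar m δ Ap)
    (hm0 : 0 ≤ m) (hδ : m * δ ≤ 1 / 4) (hg : 0 < g)
    (hgap : ∀ j k : Fin N, j < k → g ≤ lo k - hi j) (k : Fin N) :
    |eigval Ap k - eigval Am k| ≤ 2 * m * ‖Ap - Am‖ ∧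
    ‖eigvec rbar Ap k - eigvec rbar Am k‖ ≤ 2 * m / g * ‖Ap - Am‖ := by
  set r := eigvec rbar Am k with hr
  set μ := charComp rbar Ap r with hμ
  have hsum : ∑ j, |(eigval Am k - eigval Ap j) * μ j| ≤ m * ‖Ap - Am‖ := by
    have h1 := hp.coordBound fun j => (eigval Am k - eigval Ap j) * μ j
    rw [← hp.smul_sub_apply_eq_sum (eigval Am k) r, ← hm.apply_eigvec k, ← hr] at h1
    refine h1.trans ?_
    gcongr
    rw [norm_sub_rev, ← sub_apply]
    refine ((Ap - Am).le_opNorm r).trans ?_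
    rw [hr, hm.norm_eigvec, mul_one]
  have hterm : ∀ j, 0 ≤ |(eigval Am k - eigval Ap j) * μ j| := fun j => abs_nonneg _
  have hk1 : |(eigval Am k - eigval Ap k) * μ k| ≤ m * ‖Ap - Am‖ :=
    (Finset.single_le_sum (fun j _ => hterm j) (Finset.mem_univ k)).trans hsum
  have hoff : g * ∑ j ∈ Finset.univ.erase k, |μ j| ≤ m * ‖Ap - Am‖ := by
    refine le_trans ?_ hsum
    rw [Finset.mul_sum]
    refine le_trans (Finset.sum_le_sum fun j hj => ?_)
      (Finset.sum_le_sum_of_subset_of_nonneg (Finset.erase_subset k _) fun j _ _ => hterm j)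
    rw [abs_mul]
    gcongr
    have h1 := hm.mem k
    have h2 := hp.mem j
    rcases lt_or_gt_of_ne (Finset.ne_of_mem_erase hj) with h | h
    · have := hgap j k h
      exact le_trans (by linarith [h1.1, h2.2]) (le_abs_self _)
    · have := hgap k j h
      exact le_trans (by linarith [h1.2, h2.1]) (neg_le_abs _)
  -- the coordinates of `r_k⁻ - r_k⁺`
  have hclose : ‖r - eigvec rbar Ap k‖ ≤ 2 * δ := by
    have e : r - eigvec rbar Ap k = (r - rbar k) - (eigvec rbar Ap k - rbar k) := by abel
    rw [e]
    refine (norm_sub_le _ _).trans ?_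
    linarith [hm.close k, hp.close k]
  have hexp : r - μ k • eigvec rbar Ap k =
      ∑ j ∈ Finset.univ.erase k, μ j • eigvec rbar Ap j := by
    have h1 := hp.sum_charComp r
    rw [← hμ, ← Finset.add_sum_erase _ _ (Finset.mem_univ k)] at h1
    rw [← h1]; abel
  have hμk : 1 / 2 ≤ μ k := by
    have h1 := hp.coordBound fun j => μ j - (Pi.single k (1 : ℝ) : Fin N → ℝ) j
    have h2 : ∑ j, (μ j - (Pi.single k (1 : ℝ) : Fin N → ℝ) j) • eigvec rbar Ap j =
        r - eigvec rbar Ap k := by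
      simp only [sub_smul, Finset.sum_sub_distrib]
      rw [hμ, hp.sum_charComp r]
      congr 1
      rw [Finset.sum_eq_single k]
      · simp
      · intro j _ hj; simp [hj]
      · simp
    rw [h2] at h1
    have h3 := (Finset.single_le_sum
      (f := fun j => |μ j - (Pi.single k (1 : ℝ) : Fin N → ℝ) j|)
      (fun j _ => abs_nonneg _) (Finset.mem_univ k)).trans h1
    simp only [Pi.single_eq_same] at h3
    have h4 := mul_le_mul_of_nonneg_left hclose hm0
    have h5 := neg_le_abs (μ k - 1)
    linarith
  have hnorm : ‖r - μ k • eigvec rbar Ap k‖ ≤ ∑ j ∈ Finset.univ.erase k, |μ j| := by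
    rw [hexp]
    refine (norm_sum_le _ _).trans (Finset.sum_le_sum fun j _ => ?_)
    rw [norm_smul, hp.norm_eigvec, mul_one, Real.norm_eq_abs]
  refine ⟨?_, ?_⟩
  · rw [abs_mul, abs_of_nonneg (by linarith : (0 : ℝ) ≤ μ k), abs_sub_comm] at hk1
    nlinarith [abs_nonneg (eigval Ap k - eigval Am k)]
  · -- both vectors are unit vectors, so that `|μ k - 1|` is controlled too
    have h1 : |1 - μ k| ≤ ‖r - μ k • eigvec rbar Ap k‖ := by
      have := abs_norm_sub_norm_le r (μ k • eigvec rbar Ap k)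
      rwa [norm_smul, hp.norm_eigvec, hr, hm.norm_eigvec, mul_one, Real.norm_eq_abs,
        abs_of_nonneg (by linarith : (0 : ℝ) ≤ μ k)] at this
    have h2 : ‖eigvec rbar Ap k - r‖ ≤ ‖r - μ k • eigvec rbar Ap k‖ + |1 - μ k| := by
      have e : eigvec rbar Ap k - r =
          (1 - μ k) • eigvec rbar Ap k - (r - μ k • eigvec rbar Ap k) := by module
      rw [e]
      refine (norm_sub_le _ _).trans ?_
      rw [norm_smul, hp.norm_eigvec, mul_one, Real.norm_eq_abs, add_comm]
    have h3 : g * ‖eigvec rbar Ap k - r‖ ≤ 2 * m * ‖Ap - Am‖ := by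
      have h4 : ‖eigvec rbar Ap k - r‖ ≤ 2 * ∑ j ∈ Finset.univ.erase k, |μ j| := by linarith
      nlinarith [mul_le_mul_of_nonneg_left h4 hg.le]
    rw [div_mul_eq_mul_div, le_div_iff₀ hg]
    linarith

/-- Comparison of the coordinates of two vectors, each one in the eigenbasis of its own side. -/
theorem sum_abs_sub_le (hp : IsRegularMat lo hi rbar m δ Ap) (hm0 : 0 ≤ m) {l a : ℝ}
    (hl : ∀ k, ‖eigvec rbar Ap k - eigvec rbar Am k‖ ≤ l * a)
    (i : Fin N) (am ap : Fin N → ℝ) :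
    ∑ j, |ap j - am j| ≤ m * (‖∑ j, ap j • eigvec rbar Ap j - ∑ j, am j • eigvec rbar Am j‖ +
      ‖eigvec rbar Ap i - eigvec rbar Am i‖ * |am i| +
      l * (a * ∑ k ∈ Finset.univ.erase i, |am k|)) := by
  refine (hp.coordBound fun j => ap j - am j).trans ?_
  gcongr
  have e : ∑ j, (ap j - am j) • eigvec rbar Ap j =
      (∑ j, ap j • eigvec rbar Ap j - ∑ j, am j • eigvec rbar Am j) -
      (am i • (eigvec rbar Ap i - eigvec rbar Am i) +
        ∑ j ∈ Finset.univ.erase i, am j • (eigvec rbar Ap j - eigvec rbar Am j)) := by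
    rw [Finset.add_sum_erase _ (fun j => am j • (eigvec rbar Ap j - eigvec rbar Am j))
      (Finset.mem_univ i)]
    simp only [sub_smul, smul_sub, Finset.sum_sub_distrib]
    abel
  rw [e]
  refine (norm_sub_le _ _).trans ?_
  rw [add_assoc]
  gcongr
  refine (norm_add_le _ _).trans ?_
  rw [norm_smul, Real.norm_eq_abs, mul_comm |am i|, ← mul_assoc, Finset.mul_sum]
  gcongr
  refine (norm_sum_le _ _).trans (Finset.sum_le_sum fun j _ => ?_)
  rw [norm_smul, Real.norm_eq_abs, mul_comm]
  gcongr
  exact hl j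

end IsRegularMat

end regular

/-! ### Balance of the weighted fluxes at one shock -/

section numeric

-- At an `i`-shock, `O` and `E` stand for the contributions of the other families and of one
-- family, `p` and `q` for the absolute values of a flux on the left and on the right, `J` for the
-- jump of the weight counted with the sign of the flux, `D` for the interaction term and `Z` for
-- its part `|A⁺ - A⁻| ∑_{k ≠ i} |β_k⁻|`; `ρ`, `l`, `a`, `d` are the sizes of the jumps of `r_i`,
-- of `λ_i`, of `A` and of `ψ`.
variable {O E p q J D Z ρ l a d W κ K B δ c wmin C : ℝ}

theorem pos_flux_le {bm bp wm wp : ℝ} (hm : 0 ≤ bm) (hp : 0 ≤ bp) (hw0 : 0 ≤ wp) (hw : wp ≤ W)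
    (h : |(|bp| - |bm|)| ≤ C) : bm * wm - bp * wp ≤ |bm| * -(wp - wm) + C * W := by
  rw [abs_of_nonneg hm, abs_of_nonneg hp] at h
  rw [abs_of_nonneg hm]
  have h1 := (abs_le.1 h).1
  have hC : 0 ≤ C := (abs_nonneg _).trans h
  nlinarith [mul_le_mul_of_nonneg_right h1 hw0, mul_le_mul_of_nonneg_left hw hC]

theorem neg_flux_le {bm bp wm wp : ℝ} (hm : bm ≤ 0) (hp : bp ≤ 0) (hw0 : 0 ≤ wp) (hw : wp ≤ W)
    (h : |(|bp| - |bm|)| ≤ C) : bm * wm - bp * wp ≤ |bm| * (wp - wm) + C * W := by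
  rw [abs_of_nonpos hm, abs_of_nonpos hp] at h
  rw [abs_of_nonpos hm]
  have h1 := (abs_le.1 h).2
  have hC : 0 ≤ C := (abs_nonneg _).trans h
  nlinarith [mul_le_mul_of_nonneg_right h1 hw0, mul_le_mul_of_nonneg_left hw hC]

/-- The contribution of a family other than that of the shock: when its flux `p` is dominant the
jump `J` of the weight helps, otherwise `p` is small. -/
theorem off_family_le (hκ : 0 < κ) (hW : 0 ≤ W) (hD : 0 ≤ D) (hp : 0 ≤ p) (ha : 0 ≤ a)
    (haδ : a ≤ δ) (hJ : J ≤ W) (hdom : D ≤ κ * p → J ≤ -(K * a)) {K' : ℝ} (hK' : 0 ≤ K')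
    (hK'K : K' ≤ K) (hE : E ≤ p * J + C * D * W) :
    E ≤ W * (C + 1 / κ) * D - K' * (a * p - δ / κ * D) := by
  have hδ : 0 ≤ δ := ha.trans haδ
  have h1 : 0 ≤ W * (1 / κ) * D := by positivity
  have h2 : 0 ≤ K' * (δ / κ * D) := by positivity
  by_cases h : D ≤ κ * p
  · have h3 : p * J ≤ p * -(K * a) := mul_le_mul_of_nonneg_left (hdom h) hp
    have h4 : K' * (a * p) ≤ K * (a * p) := by gcongr
    linarith
  · have h3 : p ≤ 1 / κ * D := by
      rw [one_div_mul_eq_div, le_div_iff₀ hκ]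
      linarith
    have h4 : p * J ≤ 1 / κ * D * W :=
      (mul_le_mul_of_nonneg_left hJ hp).trans (mul_le_mul_of_nonneg_right h3 hW)
    have h5 : a * p ≤ δ / κ * D := by
      calc a * p ≤ δ * (1 / κ * D) := by gcongr
        _ = δ / κ * D := by ring
    have h6 := mul_le_mul_of_nonneg_left h5 hK'
    linarith

theorem sq_mul_le (hB : 1 ≤ B) (hδ0 : 0 ≤ δ) (hδ : 16 * B ^ 3 * δ ≤ 1) :
    16 * (B ^ 2 * δ) ≤ 1 := by
  have : B ^ 2 * δ ≤ B ^ 3 * δ :=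
    mul_le_mul_of_nonneg_right (pow_le_pow_right₀ hB (by norm_num)) hδ0
  linarith

/-- Slow and fast shocks. -/
theorem undercompressive_le (hB : 1 ≤ B) (hδ0 : 0 ≤ δ) (hδ : 16 * B ^ 3 * δ ≤ 1)
    (hK : 4 * B ^ 2 ≤ K) (hZ : 0 ≤ Z) (hl : 0 ≤ l) (hlδ : l ≤ 2 * δ) (hp : 0 ≤ p) (hρ0 : 0 ≤ ρ)
    (hρ : ρ ≤ c * l) (hc : 0 ≤ c) (hcB : c + 1 ≤ B) (hD : D = ρ * p + Z) (hκ : 0 < κ)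
    (hW : 0 ≤ W) (hWκ : W / κ ≤ B) (hκB : 1 / κ ≤ B)
    (hO1 : O ≤ B * D - 4 * B ^ 2 * Z) (hO2 : O ≤ B * D - K * (Z - B * δ * D))
    (hE : E ≤ p * J + B * D) (hJ : J ≤ W) {strong : Prop} (hstrong : strong → J ≤ -(K * l))
    (hweak : D ≤ κ * p → ¬ strong → J ≤ K * l) (hY : ¬ strong → l * p ≤ 3 * B * δ * D) :
    O + E ≤ 0 := by
  have hD0 : 0 ≤ D := by rw [hD]; positivity
  have hlp : 0 ≤ l * p := by positivity
  have hDl : D ≤ c * (l * p) + Z := by rw [hD]; linarith [mul_le_mul_of_nonneg_right hρ hp]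
  have hB2δ : 16 * (B ^ 2 * δ) ≤ 1 := sq_mul_le hB hδ0 hδ
  by_cases hs : strong
  · have h1 : p * J ≤ p * -(4 * B ^ 2 * l) := by
      refine mul_le_mul_of_nonneg_left ((hstrong hs).trans ?_) hp
      linarith [mul_le_mul_of_nonneg_right hK hl]
    have h2 : D ≤ B * (l * p + Z) := by
      have h := mul_le_mul_of_nonneg_right hcB (add_nonneg hlp hZ)
      have h' := mul_nonneg hc hZ
      linarith
    have h3 : 2 * B * D ≤ 2 * B * (B * (l * p + Z)) := by gcongr
    linarith [mul_nonneg (sq_nonneg B) hlp, mul_nonneg (sq_nonneg B) hZ]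
  · by_cases hd : D ≤ κ * p
    · have h1 : p * J ≤ K * (3 * B * δ * D) := by
        calc p * J ≤ p * (K * l) := mul_le_mul_of_nonneg_left (hweak hd hs) hp
          _ = K * (l * p) := by ring
          _ ≤ K * (3 * B * δ * D) := by
            refine mul_le_mul_of_nonneg_left (hY hs) (by nlinarith [sq_nonneg B])
      have h2 : c * (l * p) ≤ B * (3 * B * δ * D) := by
        have := hY hs
        have hcB' : c ≤ B := by linarith
        gcongr
      have h3 : 16 * (B * (3 * B * δ * D)) ≤ 3 * D := by
        linarith [mul_le_mul_of_nonneg_right hB2δ hD0]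
      have h4 : B * δ * D * 16 ≤ D := by
        have : B * δ ≤ B ^ 2 * δ := by gcongr; exact le_self_pow₀ hB two_ne_zero
        linarith [mul_le_mul_of_nonneg_right (this.trans (by linarith : B ^ 2 * δ ≤ 1 / 16)) hD0]
      have h5 : D / 2 ≤ Z - 4 * (B * δ * D) := by linarith
      have h6 : 4 * B ^ 2 * (D / 2) ≤ K * (Z - 4 * (B * δ * D)) := by
        refine mul_le_mul hK h5 (by positivity) (by nlinarith [sq_nonneg B])
      linarith [mul_nonneg (mul_nonneg (by linarith : (0:ℝ) ≤ B) (by linarith : (0:ℝ) ≤ B - 1)) hD0]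
    · have h0 : p ≤ 1 / κ * D := by
        rw [one_div_mul_eq_div, le_div_iff₀ hκ]
        linarith
      have h1 : p * J ≤ B * D := by
        calc p * J ≤ p * W := mul_le_mul_of_nonneg_left hJ hp
          _ ≤ 1 / κ * D * W := mul_le_mul_of_nonneg_right h0 hW
          _ = W / κ * D := by ring
          _ ≤ B * D := by gcongr
      have h2 : ρ * p ≤ (B * (2 * δ)) * (B * D) := by
        have hcB' : c ≤ B := by linarith
        refine mul_le_mul (hρ.trans (by gcongr)) (h0.trans (by gcongr)) hp (by positivity)
      have h3 : 8 * (ρ * p) ≤ D := by linarith [mul_le_mul_of_nonneg_right hB2δ hD0]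
      have h4 : D ≤ 8 / 7 * Z := by linarith
      have h5 : 3 * B * D ≤ 3 * B * (8 / 7 * Z) := by gcongr
      have h6 : B * Z ≤ B ^ 2 * Z := mul_le_mul_of_nonneg_right (le_self_pow₀ hB two_ne_zero) hZ
      have h7 : 0 ≤ B ^ 2 * Z := by positivity
      linarith

/-- Compressive shocks: both fluxes of the family of the shock point to the shock. -/
theorem compressive_le (hB : 1 ≤ B) (hZ : 0 ≤ Z)
    (hp : 0 ≤ p) (hρ : ρ ≤ B * (2 * δ)) (hD : D = ρ * p + Z) (hw : 2 * B ^ 2 * δ ≤ wmin)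
    (hO1 : O ≤ B * D - 4 * B ^ 2 * Z)
    (hE : E ≤ -(wmin * p)) : O + E ≤ 0 := by
  have h2 : B * (ρ * p) ≤ B * (B * (2 * δ) * p) := by gcongr
  have h3 : 2 * B ^ 2 * δ * p ≤ wmin * p := by gcongr
  have h4 : B * Z ≤ 4 * B ^ 2 * Z := by
    refine mul_le_mul_of_nonneg_right ?_ hZ
    nlinarith
  rw [hD] at hO1
  nlinarith

/-- Rarefaction shocks, when both fluxes of the family of the shock are controlled by the
interaction term `D`. -/
theorem rarefaction_le (hB : 1 ≤ B) (hδ0 : 0 ≤ δ) (hδ : 16 * B ^ 3 * δ ≤ 1)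
    (hZ : 0 ≤ Z) (hp : 0 ≤ p) (hq : 0 ≤ q) (hρ0 : 0 ≤ ρ)
    (hρ : ρ ≤ B * (2 * δ)) (hD : D = ρ * p + Z)
    (hO1 : O ≤ B * D - 4 * B ^ 2 * Z) (hW : 0 ≤ W) (hE : E ≤ W * (p + q))
    (hpq : p + q ≤ C * D) (hCB : C ≤ B) (hWC : W * C ≤ B) : O + E ≤ 0 := by
  have hD0 : 0 ≤ D := by rw [hD]; positivity
  have hB2δ : 16 * (B ^ 2 * δ) ≤ 1 := sq_mul_le hB hδ0 hδ
  have h1 : W * (p + q) ≤ B * D := by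
    calc W * (p + q) ≤ W * (C * D) := by gcongr
      _ = W * C * D := by ring
      _ ≤ B * D := by gcongr
  have h2 : ρ * p ≤ (B * (2 * δ)) * (B * D) := by
    refine mul_le_mul (hρ) ?_ hp (by positivity)
    calc p ≤ C * D := by linarith
      _ ≤ B * D := by gcongr
  have h3 : 8 * (ρ * p) ≤ D := by linarith [mul_le_mul_of_nonneg_right hB2δ hD0]
  have h4 : D ≤ 8 / 7 * Z := by linarith
  have h5 : 2 * B * D ≤ 2 * B * (8 / 7 * Z) := by gcongr
  have h6 : B * Z ≤ B ^ 2 * Z := mul_le_mul_of_nonneg_right (le_self_pow₀ hB two_ne_zero) hZ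
  have h7 : 0 ≤ B ^ 2 * Z := by positivity
  linarith

/-- Rarefaction shocks, when the two fluxes of the family of the shock are controlled by the jump
`d` of the solution. -/
theorem rarefaction_le_jump (hB : 1 ≤ B) (hδ0 : 0 ≤ δ) (hδ : 16 * B ^ 3 * δ ≤ 1)
    (hZ : 0 ≤ Z) (hp : 0 ≤ p) (hq : 0 ≤ q) (ha : 0 ≤ a) (hd : 0 ≤ d)
    (hρ : ρ ≤ B * (2 * δ)) (hD : D = ρ * p + Z)
    (hO1 : O ≤ B * D - 4 * B ^ 2 * Z) (hWB : W ≤ B) (hE : E ≤ W * (p + q))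
    (hpq : p + q ≤ B * (a * d) + B * Z) : O + E ≤ 2 * B ^ 2 * (a * d) := by
  have had : 0 ≤ a * d := by positivity
  have hB2δ : 16 * (B ^ 2 * δ) ≤ 1 := sq_mul_le hB hδ0 hδ
  have h1 : W * (p + q) ≤ B * (B * (a * d) + B * Z) := by
    refine (mul_le_mul_of_nonneg_right hWB (by positivity)).trans ?_
    gcongr
  have h2 : ρ * p ≤ (B * (2 * δ)) * (B * (a * d) + B * Z) := by
    exact mul_le_mul (hρ) (by linarith) hp (by positivity)
  have h3 : ρ * p ≤ a * d + Z := by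
    have := mul_le_mul_of_nonneg_right hB2δ (add_nonneg had hZ)
    linarith
  have h4 : B * D ≤ B * (a * d + 2 * Z) := by
    rw [hD]; exact mul_le_mul_of_nonneg_left (by linarith) (by linarith)
  have h5 : 0 ≤ (B ^ 2 - B) * (a * d) := mul_nonneg (by nlinarith) had
  have h6 : 0 ≤ (B ^ 2 - B) * Z := mul_nonneg (by nlinarith) hZ
  have h7 : 0 ≤ B ^ 2 * Z := by positivity
  linarith

end numeric

/-- The constant `B` dominates all the constants that enter the balance of the fluxes at a shock:
`m` controls the coordinates in the eigenbases, `g` is the gap between the families, `W` bounds the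
weights. The quotient `2 * m / g` is the Lipschitz constant of the eigenvectors, and
`m * (1 + 2 * m / g)` the constant in the estimate of the jumps of the fluxes. -/
structure IsBigConstant (N : ℕ) (m g W c κ₁ κ₂ B : ℝ) : Prop where
  one_le : 1 ≤ B
  off_family : N * (W * (m * (1 + 2 * m / g) + 1 / κ₁)) + 1 ≤ B
  card_div : N / κ₁ ≤ B
  flux : m * (1 + 2 * m / g) ≤ B
  flux_mul : m * (1 + 2 * m / g) * W ≤ B
  weight : W ≤ B
  weight_div : W / κ₁ ≤ B
  inv_le : 1 / κ₁ ≤ B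
  vec : c + 1 ≤ B
  vec_mul : m * c ≤ B
  inv_gap : 1 / (g * κ₂) ≤ B
  weak : 2 / (g * κ₂) + m * (1 + 2 * m / g) ≤ B
  weak_mul : W * (2 / (g * κ₂) + m * (1 + 2 * m / g)) ≤ B
  jump : 4 * m ^ 2 ≤ B
  coord : 2 * m * (2 * m / g) / g ≤ B

theorem exists_isBigConstant (N : ℕ) (m g W c κ₁ κ₂ : ℝ) :
    ∃ B, IsBigConstant N m g W c κ₁ κ₂ B := by
  have h : ∀ a : ℝ, ∀ᶠ B : ℝ in atTop, a ≤ B := eventually_ge_atTop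
  have : ∀ᶠ B : ℝ in atTop, IsBigConstant N m g W c κ₁ κ₂ B := by
    filter_upwards [h 1, h (N * (W * (m * (1 + 2 * m / g) + 1 / κ₁)) + 1), h (N / κ₁),
      h (m * (1 + 2 * m / g)), h (m * (1 + 2 * m / g) * W), h W, h (W / κ₁), h (1 / κ₁), h (c + 1),
      h (m * c), h (1 / (g * κ₂)), h (2 / (g * κ₂) + m * (1 + 2 * m / g)),
      h (W * (2 / (g * κ₂) + m * (1 + 2 * m / g))), h (4 * m ^ 2), h (2 * m * (2 * m / g) / g)]
      with B h1 h2 h3 h4 h5 h6 h7 h8 h9 h10 h11 h12 h13 h14 h15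
    exact ⟨h1, h2, h3, h4, h5, h6, h7, h8, h9, h10, h11, h12, h13, h14, h15⟩
  exact this.exists

theorem abs_add_abs_le_abs_sub {x y : ℝ} (h : x * y ≤ 0) : |x| + |y| ≤ |x - y| := by
  rw [← sq_le_sq₀ (by positivity) (abs_nonneg _), sq_abs, add_sq, sq_abs, sq_abs, mul_assoc,
    ← abs_mul, abs_of_nonpos h]
  linarith

namespace Shock

variable {N : ℕ}

/-- The right characteristic flux `β_j⁺ = (speed - λ_j⁺) |α_j⁺|`. -/
noncomputable def βp (S : Shock N) (rbar : Fin N → Vec N) (j : Fin N) : ℝ :=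
  (S.speed - eigval S.Ap j) * |S.αp rbar j|

/-- The interaction term at an `i`-shock, which controls the jumps of all the fluxes. -/
noncomputable def interaction (S : Shock N) (rbar : Fin N → Vec N) (i : Fin N) : ℝ :=
  S.eigvecJump rbar i * |S.βm rbar i| + S.strength * ∑ k ∈ Finset.univ.erase i, |S.βm rbar k|

open Classical in
/-- The weighted fluxes lost at an `i`-shock of small amplitude are nonnegative, except at
rarefaction shocks whose `i`-component is strongly dominant, where they are controlled by the jump
of the solution. -/
theorem sum_flux_le {S : Shock N} {lo hi : Fin N → ℝ} {rbar : Fin N → Vec N}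
    {m g W wmin c κ₁ κ₂ K B δ : ℝ} {i : Fin N}
    (hB : IsBigConstant N m g W c κ₁ κ₂ B) (hm : 0 ≤ m) (hg : 0 < g) (hc : 0 ≤ c)
    (hκ₁ : 0 < κ₁) (hκ₂ : 0 < κ₂) (hwmin : 0 < wmin) (hK : 4 * B ^ 2 ≤ K)
    (hδ : 16 * B ^ 3 * δ ≤ 1) (hδw : 2 * B ^ 2 * δ ≤ wmin) (hδm : m * δ ≤ 1 / 4)
    (hgap : ∀ j k : Fin N, j < k → g ≤ lo k - hi j)
    (hAm : IsRegularMat lo hi rbar m δ S.Am) (hAp : IsRegularMat lo hi rbar m δ S.Ap)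
    (hRH : S.speed • (S.ψm - S.ψp) = S.Am S.ψm - S.Ap S.ψp)
    (hfam : S.InFamily lo hi i) (hstr : S.strength ≤ δ)
    (hsm : |S.speed - eigval S.Am i| ≤ δ) (hsp : |S.speed - eigval S.Ap i| ≤ δ)
    (hvec : S.eigvecJump rbar i ≤ c * S.lamJump i)
    {wm wp : Fin N → ℝ} (hwm : ∀ j, wm j ∈ Icc wmin W) (hwp : ∀ j, wp j ∈ Icc wmin W)
    (hlower : ∀ j, S.IsDominant rbar κ₁ i j → j < i → K * S.strength ≤ wp j - wm j)
    (hupper : ∀ j, S.IsDominant rbar κ₁ i j → i < j → wp j - wm j ≤ -(K * S.strength))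
    (hslow_strong : S.IsSlow i → S.IsStronglyDominant rbar κ₂ i →
      wp i - wm i ≤ -(K * S.lamJump i))
    (hfast_strong : S.IsFast i → S.IsStronglyDominant rbar κ₂ i →
      K * S.lamJump i ≤ wp i - wm i)
    (hslow_weak : S.IsSlow i → S.IsDominant rbar κ₁ i i → ¬ S.IsStronglyDominant rbar κ₂ i →
      wp i - wm i ≤ K * S.lamJump i)
    (hfast_weak : S.IsFast i → S.IsDominant rbar κ₁ i i → ¬ S.IsStronglyDominant rbar κ₂ i →
      -(K * S.lamJump i) ≤ wp i - wm i) :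
    ∑ j, (S.βm rbar j * wm j - S.βp rbar j * wp j) ≤
      if S.IsRarefaction i ∧ S.IsStronglyDominant rbar κ₂ i then
        2 * B ^ 2 * (S.strength * ‖S.ψp - S.ψm‖) else 0 := by
  set l := S.lamJump i with hl
  set a := S.strength with ha
  set ρ := S.eigvecJump rbar i with hρ
  set D := S.interaction rbar i with hD
  set Z := a * ∑ k ∈ Finset.univ.erase i, |S.βm rbar k| with hZ
  set Y := a * ∑ k ∈ Finset.univ.erase i, |S.αm rbar k| with hY
  set p := |S.βm rbar i| with hp
  set q := |S.βp rbar i| with hq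
  set C := m * (1 + 2 * m / g) with hC
  have hB1 := hB.one_le
  have ha0 : 0 ≤ a := norm_nonneg _
  have hl0 : 0 ≤ l := abs_nonneg _
  have hρ0 : 0 ≤ ρ := norm_nonneg _
  have hp0 : 0 ≤ p := abs_nonneg _
  have hq0 : 0 ≤ q := abs_nonneg _
  have hZ0 : 0 ≤ Z := mul_nonneg ha0 (Finset.sum_nonneg fun _ _ => abs_nonneg _)
  have hDeq : D = ρ * p + Z := rfl
  have hD0 : 0 ≤ D := by rw [hDeq]; positivity
  have hδ0 : 0 ≤ δ := ha0.trans hstr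
  have hC0 : 0 ≤ C := by positivity
  have hW0 : 0 ≤ W := hwmin.le.trans ((hwm i).1.trans (hwm i).2)
  have hlδ : l ≤ 2 * δ := by
    have e : eigval S.Ap i - eigval S.Am i =
        (S.speed - eigval S.Am i) - (S.speed - eigval S.Ap i) := by ring
    rw [hl, lamJump, e]
    exact (abs_sub _ _).trans (by linarith)
  have hcB : c + 1 ≤ B := hB.vec
  have hρB : ρ ≤ B * (2 * δ) := by
    have hcB' : c ≤ B := by linarith
    exact hvec.trans (mul_le_mul hcB' hlδ hl0 (by linarith))
  have hlip := fun k => (hAm.lipschitz hAp hm hδm hg hgap k)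
  -- the speed of the shock is separated from the eigenvalues of the other families
  have hsepl : ∀ j, j < i → g ≤ S.speed - eigval S.Am j ∧ g ≤ S.speed - eigval S.Ap j := by
    intro j hj
    have h1 := hgap j i hj
    have h2 := hfam.1
    exact ⟨by linarith [(hAm.mem j).2], by linarith [(hAp.mem j).2]⟩
  have hsepr : ∀ j, i < j → g ≤ eigval S.Am j - S.speed ∧ g ≤ eigval S.Ap j - S.speed := by
    intro j hj
    have h1 := hgap i j hj
    have h2 := hfam.2
    exact ⟨by linarith [(hAm.mem j).1], by linarith [(hAp.mem j).1]⟩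
  have habsm : ∀ j, |S.βm rbar j| = |S.speed - eigval S.Am j| * |S.αm rbar j| := fun j => by
    rw [βm, abs_mul, abs_abs]
  have habsp : ∀ j, |S.βp rbar j| = |S.speed - eigval S.Ap j| * |S.αp rbar j| := fun j => by
    rw [βp, abs_mul, abs_abs]
  have hYZ : g * Y ≤ Z := by
    rw [hY, hZ, mul_left_comm, Finset.mul_sum]
    gcongr with k hk
    rw [habsm]
    gcongr
    rcases lt_or_gt_of_ne (Finset.ne_of_mem_erase hk) with h | h
    · exact (hsepl k h).1.trans (le_abs_self _)
    · exact ((hsepr k h).1.trans (by linarith)).trans (neg_le_abs _)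
  -- the Rankine–Hugoniot relation controls the jumps of the fluxes
  have hflux : ∀ j, |(S.speed - eigval S.Ap j) * S.αp rbar j -
      (S.speed - eigval S.Am j) * S.αm rbar j| ≤ C * D := by
    intro j
    have h1 := hAp.sum_abs_sub_le hm (fun k => (hlip k).2) i
      (fun j => (S.speed - eigval S.Am j) * S.αm rbar j)
      (fun j => (S.speed - eigval S.Ap j) * S.αp rbar j)
    have h2 : ∑ j, ((S.speed - eigval S.Ap j) * S.αp rbar j) • eigvec rbar S.Ap j -
        ∑ j, ((S.speed - eigval S.Am j) * S.αm rbar j) • eigvec rbar S.Am j = 0 := by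
      have e1 := hAp.smul_sub_apply_eq_sum S.speed S.ψp
      have e2 := hAm.smul_sub_apply_eq_sum S.speed S.ψm
      unfold αp αm
      rw [← e1, ← e2]
      rw [smul_sub, sub_eq_sub_iff_add_eq_add] at hRH
      rw [sub_eq_zero, sub_eq_sub_iff_add_eq_add, add_comm, ← hRH, add_comm]
    rw [h2, norm_zero, zero_add] at h1
    have h3 : ∀ j, |(S.speed - eigval S.Am j) * S.αm rbar j| = |S.βm rbar j| := fun j => by
      rw [habsm, abs_mul]
    simp only [h3] at h1
    refine (Finset.single_le_sum (f := fun j => |(S.speed - eigval S.Ap j) * S.αp rbar j -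
      (S.speed - eigval S.Am j) * S.αm rbar j|) (fun j _ => abs_nonneg _)
      (Finset.mem_univ j)).trans (h1.trans ?_)
    have h4 : 0 ≤ 2 * m / g := by positivity
    have h5 : 0 ≤ ρ * p := by positivity
    change m * (ρ * p + 2 * m / g * Z) ≤ _
    rw [hC, hDeq, mul_assoc]
    refine mul_le_mul_of_nonneg_left ?_ hm
    have h6 := mul_nonneg h4 h5
    linarith
  have hfluxabs : ∀ j, |(|S.βp rbar j| - |S.βm rbar j|)| ≤ C * D := by
    intro j
    refine le_trans ?_ (hflux j)
    rw [habsm, habsp, ← abs_mul, ← abs_mul]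
    exact abs_abs_sub_abs_le_abs_sub _ _
  have hJ : ∀ j, wp j - wm j ≤ W ∧ -(wp j - wm j) ≤ W := fun j =>
    ⟨by linarith [(hwm j).1, (hwp j).2], by linarith [(hwm j).2, (hwp j).1]⟩
  have hwp0 : ∀ j, 0 ≤ wp j := fun j => hwmin.le.trans (hwp j).1
  set O := ∑ j ∈ Finset.univ.erase i, (S.βm rbar j * wm j - S.βp rbar j * wp j) with hO
  set E := S.βm rbar i * wm i - S.βp rbar i * wp i with hE
  have hsplit : ∑ j, (S.βm rbar j * wm j - S.βp rbar j * wp j) = O + E := by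
    rw [hO, hE, add_comm, Finset.add_sum_erase _ (fun j => S.βm rbar j * wm j - S.βp rbar j * wp j)
      (Finset.mem_univ i)]
  -- the other families; the bound serves for `K' = K`, against a term in `K`, and for `K' = 4 B²`,
  -- which does not depend on `K` and so remains harmless when multiplied by the small `δ`
  have hOff : ∀ K', 0 ≤ K' → K' ≤ K → O ≤ (B - 1) * D - K' * (Z - B * δ * D) := by
    intro K' hK'0 hK'K
    have h1 : ∀ j ∈ Finset.univ.erase i, S.βm rbar j * wm j - S.βp rbar j * wp j ≤
        W * (C + 1 / κ₁) * D - K' * (a * |S.βm rbar j| - δ / κ₁ * D) := by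
      intro j hj
      rcases lt_or_gt_of_ne (Finset.ne_of_mem_erase hj) with h | h
      · refine off_family_le hκ₁ hW0 hD0 (abs_nonneg _) ha0 hstr (hJ j).2 (fun hd => ?_) hK'0 hK'K
          (pos_flux_le (mul_nonneg (hg.le.trans (hsepl j h).1) (abs_nonneg _))
            (mul_nonneg (hg.le.trans (hsepl j h).2) (abs_nonneg _)) (hwp0 j) (hwp j).2 (hfluxabs j))
        linarith [hlower j hd h]
      · exact off_family_le hκ₁ hW0 hD0 (abs_nonneg _) ha0 hstr (hJ j).1 (fun hd => hupper j hd h)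
          hK'0 hK'K (neg_flux_le
            (mul_nonpos_of_nonpos_of_nonneg (by linarith [(hsepr j h).1]) (abs_nonneg _))
            (mul_nonpos_of_nonpos_of_nonneg (by linarith [(hsepr j h).2]) (abs_nonneg _))
            (hwp0 j) (hwp j).2 (hfluxabs j))
    have h2 : O ≤ _ := Finset.sum_le_sum h1
    rw [Finset.sum_sub_distrib, Finset.sum_const, ← Finset.mul_sum, Finset.sum_sub_distrib,
      ← Finset.mul_sum, Finset.sum_const, nsmul_eq_mul, nsmul_eq_mul] at h2
    have h3 : ((Finset.univ.erase i).card : ℝ) ≤ N := by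
      have := Finset.card_le_card (Finset.erase_subset i Finset.univ)
      rw [Finset.card_univ, Fintype.card_fin] at this
      exact_mod_cast this
    have h4 : ((Finset.univ.erase i).card : ℝ) * (W * (C + 1 / κ₁) * D) ≤ (B - 1) * D := by
      have e : (N : ℝ) * (W * (C + 1 / κ₁) * D) = N * (W * (C + 1 / κ₁)) * D := by ring
      refine (mul_le_mul_of_nonneg_right h3 (by positivity)).trans ?_
      rw [e]
      exact mul_le_mul_of_nonneg_right (by linarith [hB.off_family]) hD0
    have h5 : ((Finset.univ.erase i).card : ℝ) * (δ / κ₁ * D) ≤ B * δ * D := by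
      have e : (N : ℝ) * (δ / κ₁ * D) = N / κ₁ * (δ * D) := by ring
      refine (mul_le_mul_of_nonneg_right h3 (by positivity)).trans ?_
      rw [e, mul_assoc]
      exact mul_le_mul_of_nonneg_right hB.card_div (by positivity)
    have h6 := mul_le_mul_of_nonneg_left h5 hK'0
    change O ≤ _ - K' * (Z - _) at h2
    linarith
  have hO1 : O ≤ B * D - 4 * B ^ 2 * Z := by
    have h1 := hOff (4 * B ^ 2) (by positivity) hK
    have h2 : 4 * (B ^ 3 * δ) * D ≤ 1 * D := by
      refine mul_le_mul_of_nonneg_right ?_ hD0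
      have : 0 ≤ B ^ 3 * δ := by positivity
      linarith
    linarith
  have hO2 : O ≤ B * D - K * (Z - B * δ * D) := by
    have h1 := hOff K (le_trans (by positivity) hK) le_rfl
    linarith
  rw [hsplit]
  have hCDW : C * D * W ≤ B * D := by
    calc C * D * W = C * W * D := by ring
      _ ≤ B * D := mul_le_mul_of_nonneg_right hB.flux_mul hD0
  have hpq := abs_le.1 (hfluxabs i)
  have hgκ : 0 < g * κ₂ := by positivity
  -- without strong dominance, one of the components of the family of the shock is small
  have hweak : ¬ S.IsStronglyDominant rbar κ₂ i →
      l * |S.αm rbar i| ≤ 1 / (g * κ₂) * Z ∨ l * |S.αp rbar i| ≤ 1 / (g * κ₂) * Z := by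
    intro h
    rw [IsStronglyDominant, not_and_or, not_le, not_le] at h
    refine h.imp (fun h => ?_) fun h => ?_ <;>
    · have h' := mul_le_mul_of_nonneg_left h.le hg.le
      rw [one_div_mul_eq_div, le_div_iff₀ hgκ]
      refine le_trans (le_of_eq ?_) (h'.trans hYZ)
      ring
  have hpδ : p ≤ δ * |S.αm rbar i| := by
    rw [hp, habsm]
    exact mul_le_mul_of_nonneg_right hsm (abs_nonneg _)
  have hqδ : q ≤ δ * |S.αp rbar i| := by
    rw [hq, habsp]
    exact mul_le_mul_of_nonneg_right hsp (abs_nonneg _)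
  have hZD : Z ≤ D := by
    have := mul_nonneg hρ0 hp0
    linarith
  have hsmall : ∀ α, l * α ≤ 1 / (g * κ₂) * Z → l * (δ * α) ≤ B * δ * D := by
    intro α h
    calc l * (δ * α) = δ * (l * α) := by ring
      _ ≤ δ * (1 / (g * κ₂) * Z) := mul_le_mul_of_nonneg_left h hδ0
      _ ≤ δ * (B * D) := mul_le_mul_of_nonneg_left
        (mul_le_mul hB.inv_gap hZD hZ0 (by linarith)) hδ0
      _ = B * δ * D := by ring
  have hlp : ¬ S.IsStronglyDominant rbar κ₂ i → l * p ≤ 3 * B * δ * D := by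
    intro h
    have hBδD : 0 ≤ B * δ * D := by positivity
    rcases hweak h with h | h
    · have := (mul_le_mul_of_nonneg_left hpδ hl0).trans (hsmall _ h)
      linarith
    · have h1 := (mul_le_mul_of_nonneg_left hqδ hl0).trans (hsmall _ h)
      have h2 : l * p ≤ l * (q + C * D) := mul_le_mul_of_nonneg_left (by linarith [hpq.1]) hl0
      have h3 : l * (C * D) ≤ 2 * δ * (B * D) :=
        mul_le_mul hlδ (mul_le_mul_of_nonneg_right hB.flux hD0) (by positivity) (by positivity)
      linarith
  by_cases hslow : S.IsSlow i
  · have h1 : S.speed ≤ eigval S.Am i := hslow.trans (min_le_left _ _)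
    have h2 : S.speed ≤ eigval S.Ap i := hslow.trans (min_le_right _ _)
    rw [if_neg fun h => absurd h.1.1 h1.not_gt]
    have h3 := neg_flux_le (wm := wm i)
      (mul_nonpos_of_nonpos_of_nonneg (sub_nonpos.2 h1) (abs_nonneg (S.αm rbar i)))
      (mul_nonpos_of_nonpos_of_nonneg (sub_nonpos.2 h2) (abs_nonneg (S.αp rbar i)))
      (hwp0 i) (hwp i).2 (hfluxabs i)
    exact undercompressive_le hB1 hδ0 hδ hK hZ0 hl0 hlδ hp0 hρ0 hvec hc hcB hDeq hκ₁ hW0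
      hB.weight_div hB.inv_le hO1 hO2 (h3.trans (add_le_add_right hCDW _)) (hJ i).1
      (hslow_strong hslow) (hslow_weak hslow) hlp
  by_cases hfast : S.IsFast i
  · have h1 : eigval S.Am i ≤ S.speed := (le_max_left _ _).trans hfast
    have h2 : eigval S.Ap i ≤ S.speed := (le_max_right _ _).trans hfast
    rw [if_neg fun h => absurd h.1.2 h2.not_gt]
    have h3 := pos_flux_le (wm := wm i)
      (mul_nonneg (sub_nonneg.2 h1) (abs_nonneg (S.αm rbar i)))
      (mul_nonneg (sub_nonneg.2 h2) (abs_nonneg (S.αp rbar i)))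
      (hwp0 i) (hwp i).2 (hfluxabs i)
    exact undercompressive_le hB1 hδ0 hδ hK hZ0 hl0 hlδ hp0 hρ0 hvec hc hcB hDeq hκ₁ hW0
      hB.weight_div hB.inv_le hO1 hO2 (h3.trans (add_le_add_right hCDW _)) (hJ i).2
      (fun h => neg_le_neg (hfast_strong hfast h))
      (fun h h' => neg_le.1 (hfast_weak hfast h h')) hlp
  by_cases hrar : S.IsRarefaction i
  · have hEW : E ≤ W * (p + q) := by
      have h1 : S.βm rbar i * wm i ≤ p * W :=
        mul_le_mul (le_abs_self _) (hwm i).2 (hwmin.le.trans (hwm i).1) hp0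
      have h2 : -(S.βp rbar i) * wp i ≤ q * W :=
        mul_le_mul (neg_le_abs _) (hwp i).2 (hwp0 i) hq0
      linarith
    have hleq : l = eigval S.Ap i - eigval S.Am i :=
      abs_of_pos (sub_pos.2 (hrar.1.trans hrar.2))
    have hpl : p ≤ l * |S.αm rbar i| := by
      rw [hp, habsm]
      refine mul_le_mul_of_nonneg_right ?_ (abs_nonneg _)
      rw [abs_of_pos (sub_pos.2 hrar.1)]
      linarith [hrar.2]
    have hql : q ≤ l * |S.αp rbar i| := by
      rw [hq, habsp]
      refine mul_le_mul_of_nonneg_right ?_ (abs_nonneg _)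
      rw [abs_of_neg (sub_neg.2 hrar.2)]
      linarith [hrar.1]
    have hCpos : 0 ≤ 2 / (g * κ₂) := by positivity
    have hbalance : p + q ≤ (2 / (g * κ₂) + C) * D → O + E ≤ 0 := fun h =>
      rarefaction_le hB1 hδ0 hδ hZ0 hp0 hq0 hρ0 hρB hDeq hO1 hW0 hEW h hB.weak hB.weak_mul
    by_cases hSD : S.IsStronglyDominant rbar κ₂ i
    · rw [if_pos ⟨hrar, hSD⟩]
      by_cases hsign : 0 ≤ S.αm rbar i * S.αp rbar i
      · -- the two fluxes have opposite signs, and their difference is controlled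
        refine (hbalance ?_).trans (by positivity)
        have h1 : (S.speed - eigval S.Ap i) * S.αp rbar i *
            ((S.speed - eigval S.Am i) * S.αm rbar i) ≤ 0 := by
          have h2 : (S.speed - eigval S.Ap i) * (S.speed - eigval S.Am i) ≤ 0 :=
            mul_nonpos_of_nonpos_of_nonneg (sub_neg.2 hrar.2).le (sub_pos.2 hrar.1).le
          have h3 := mul_nonpos_of_nonpos_of_nonneg h2 hsign
          linarith
        have h2 := (abs_add_abs_le_abs_sub h1).trans (hflux i)
        rw [abs_mul, abs_mul, ← habsp, ← habsm] at h2
        have h3 := mul_nonneg hCpos hD0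
        linarith
      · -- the two components have opposite signs, and their difference is controlled
        have h1 := (abs_add_abs_le_abs_sub (x := S.αp rbar i) (y := S.αm rbar i)
          (by linarith [not_le.1 hsign]))
        have h2 := hAp.sum_abs_sub_le hm (fun k => (hlip k).2) i (S.αm rbar) (S.αp rbar)
        have e1 : ∑ j, S.αp rbar j • eigvec rbar S.Ap j = S.ψp := hAp.sum_charComp S.ψp
        have e2 : ∑ j, S.αm rbar j • eigvec rbar S.Am j = S.ψm := hAm.sum_charComp S.ψm
        rw [e1, e2] at h2
        have h3 := (Finset.single_le_sum (f := fun j => |S.αp rbar j - S.αm rbar j|)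
          (fun j _ => abs_nonneg _) (Finset.mem_univ i)).trans h2
        change |S.αp rbar i - S.αm rbar i| ≤
          m * (‖S.ψp - S.ψm‖ + ρ * |S.αm rbar i| + 2 * m / g * Y) at h3
        set d := ‖S.ψp - S.ψm‖ with hd
        have hd0 : 0 ≤ d := norm_nonneg _
        have hδB : 16 * (B * δ) ≤ 1 := by
          have h4 := sq_mul_le hB1 hδ0 hδ
          have h5 : B * δ ≤ B ^ 2 * δ :=
            mul_le_mul_of_nonneg_right (le_self_pow₀ hB1 two_ne_zero) hδ0
          linarith
        have h4 : m * ρ ≤ 1 / 2 := by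
          calc m * ρ ≤ m * (c * l) := mul_le_mul_of_nonneg_left hvec hm
            _ = m * c * l := by ring
            _ ≤ B * (2 * δ) := mul_le_mul hB.vec_mul hlδ hl0 (by linarith)
            _ ≤ 1 / 2 := by linarith
        have h5 := mul_le_mul_of_nonneg_right h4 (abs_nonneg (S.αm rbar i))
        have h6 : |S.αm rbar i| + |S.αp rbar i| ≤ 2 * m * d + 2 * m * (2 * m / g) * Y := by
          have := abs_nonneg (S.αp rbar i)
          linarith
        have h7 : l ≤ 2 * m * a := (hlip i).1
        have h8 : l ≤ 1 := by
          have : δ ≤ B * δ := le_mul_of_one_le_left hδ0 hB1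
          linarith
        have hY0 : 0 ≤ Y := mul_nonneg ha0 (Finset.sum_nonneg fun _ _ => abs_nonneg _)
        have h9 : l * (2 * m * d) ≤ B * (a * d) := by
          calc l * (2 * m * d) ≤ 2 * m * a * (2 * m * d) :=
                mul_le_mul_of_nonneg_right h7 (by positivity)
            _ = 4 * m ^ 2 * (a * d) := by ring
            _ ≤ B * (a * d) := mul_le_mul_of_nonneg_right hB.jump (by positivity)
        have h10 : l * (2 * m * (2 * m / g) * Y) ≤ B * Z := by
          calc l * (2 * m * (2 * m / g) * Y) ≤ 1 * (2 * m * (2 * m / g) * Y) :=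
                mul_le_mul_of_nonneg_right h8 (by positivity)
            _ = 2 * m * (2 * m / g) / g * (g * Y) := by field_simp
            _ ≤ B * Z := mul_le_mul hB.coord hYZ (by positivity) (by linarith)
        have h11 := mul_le_mul_of_nonneg_left h6 hl0
        exact rarefaction_le_jump hB1 hδ0 hδ hZ0 hp0 hq0 ha0 hd0 hρB hDeq hO1 hB.weight hEW
          (by linarith)
    · rw [if_neg fun h => hSD h.2]
      apply hbalance
      have h1 : 1 / (g * κ₂) * Z ≤ 1 / (g * κ₂) * D :=
        mul_le_mul_of_nonneg_left hZD (by positivity)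
      have e : 2 / (g * κ₂) * D = 1 / (g * κ₂) * D + 1 / (g * κ₂) * D := by ring
      rcases hweak hSD with h | h
      · linarith [hpq.2]
      · linarith [hpq.1]
  · rw [if_neg fun h => hrar h.1]
    rw [IsSlow, not_le, min_lt_iff] at hslow
    rw [IsFast, not_le, lt_max_iff] at hfast
    rw [IsRarefaction, not_and_or, not_lt, not_lt] at hrar
    have h1 : S.speed ≤ eigval S.Am i ∧ eigval S.Ap i ≤ S.speed := by
      rcases hrar with h | h
      · exact ⟨h, (hslow.resolve_left h.not_gt).le⟩
      · exact ⟨(hfast.resolve_right h.not_gt).le, h⟩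
    have h2 : p = -S.βm rbar i := abs_of_nonpos
      (mul_nonpos_of_nonpos_of_nonneg (sub_nonpos.2 h1.1) (abs_nonneg _))
    have h3 : 0 ≤ S.βp rbar i := mul_nonneg (sub_nonneg.2 h1.2) (abs_nonneg _)
    refine compressive_le hB1 hZ0 hp0 hρB hDeq hδw hO1 ?_
    have h4 := mul_nonneg h3 (hwp0 i)
    have h5 := mul_le_mul_of_nonneg_left (hwm i).1 hp0
    rw [hE, show S.βm rbar i = -p by linarith]
    linarith

end Shock

/-! ### The weighted norm at times when no two lines meet -/

/-- The fields `A` and `ψ` are functions `uA` and `uψ` of the set of lines of `L` to the left of the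
point, and `w` is locally constant off the lines of `L` and the times of `Θ`. -/
structure IsCarriedBy {N : ℕ} (L : Finset (ℝ × ℝ)) (Θ : Set ℝ) (uA : Finset (ℝ × ℝ) → Mat N)
    (uψ : Finset (ℝ × ℝ) → Vec N) (A : ℝ → ℝ → Mat N) (ψ : ℝ → ℝ → Vec N)
    (w : ℝ → ℝ → Fin N → ℝ) : Prop where
  finite : Θ.Finite
  locConst : ∀ t x, 0 ≤ t → OffLines L t x → LocConstAt A t x
  matrix_eq : ∀ t ∈ Ici (0 : ℝ), ∀ x, OffLines L t x → A t x = uA (below L t x)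
  solution_eq : ∀ t ∈ Ici (0 : ℝ), ∀ x, OffLines L t x → ψ t x = uψ (below L t x)
  locConst_weight : ∀ t x, 0 ≤ t → t ∉ Θ → OffLines L t x → LocConstAt w t x

theorem exists_isCarriedBy {N : ℕ} {A : ℝ → ℝ → Mat N} {ψ : ℝ → ℝ → Vec N}
    {w : ℝ → ℝ → Fin N → ℝ} (hA : IsPiecewiseConstant A) (hψ : IsPiecewiseConstant ψ)
    (hw : IsPiecewiseConstantWithTimeJumps w) :
    ∃ L Θ uA uψ, IsCarriedBy L Θ uA uψ A ψ w := by
  obtain ⟨L₁, h₁⟩ := hA.exists_lines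
  obtain ⟨L₂, h₂⟩ := hψ.exists_lines
  obtain ⟨L₃, Θ, hΘ, h₃⟩ := hw.exists_lines
  have s₁ : L₁ ⊆ L₁ ∪ L₂ ∪ L₃ := Finset.subset_union_left.trans Finset.subset_union_left
  have s₂ : L₂ ⊆ L₁ ∪ L₂ ∪ L₃ := Finset.subset_union_right.trans Finset.subset_union_left
  have s₃ : L₃ ⊆ L₁ ∪ L₂ ∪ L₃ := Finset.subset_union_right
  obtain ⟨uA, huA⟩ := exists_eq_comp_below (ordConnected_Ici (a := (0 : ℝ))) (fun t ht => ht)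
    fun t ht x hx => h₁ t x ht (hx.mono s₁)
  obtain ⟨uψ, huψ⟩ := exists_eq_comp_below (ordConnected_Ici (a := (0 : ℝ))) (fun t ht => ht)
    fun t ht x hx => h₂ t x ht (hx.mono s₂)
  exact ⟨L₁ ∪ L₂ ∪ L₃, Θ, uA, uψ, hΘ, fun t x ht hx => h₁ t x ht (hx.mono s₁), huA, huψ,
    fun t x ht ht' hx => h₃ t x ht ht' (hx.mono s₃)⟩

/-- The shock carried by the line `p` at time `t`. -/
noncomputable def lineShock {N : ℕ} (L : Finset (ℝ × ℝ)) (uA : Finset (ℝ × ℝ) → Mat N)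
    (uψ : Finset (ℝ × ℝ) → Vec N) (t : ℝ) (p : ℝ × ℝ) : Shock N where
  speed := p.2
  Am := uA (below L t (linePos p t))
  Ap := uA (insert p (below L t (linePos p t)))
  ψm := uψ (below L t (linePos p t))
  ψp := uψ (insert p (below L t (linePos p t)))

/-- The density of the weighted norm, as a function of the set of lines to the left. -/
noncomputable def densityOf {N : ℕ} (rbar : Fin N → Vec N) (uA : Finset (ℝ × ℝ) → Mat N)
    (uψ : Finset (ℝ × ℝ) → Vec N) (uw : Finset (ℝ × ℝ) → Fin N → ℝ) (s : Finset (ℝ × ℝ)) : ℝ :=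
  ∑ j, |charComp rbar (uA s) (uψ s) j| * uw s j

/-- The flux of the weighted norm, as a function of the set of lines to the left. -/
noncomputable def fluxOf {N : ℕ} (rbar : Fin N → Vec N) (uA : Finset (ℝ × ℝ) → Mat N)
    (uψ : Finset (ℝ × ℝ) → Vec N) (uw : Finset (ℝ × ℝ) → Fin N → ℝ) (s : Finset (ℝ × ℝ)) : ℝ :=
  ∑ j, eigval (uA s) j * (|charComp rbar (uA s) (uψ s) j| * uw s j)

theorem exists_below_eq_empty (L : Finset (ℝ × ℝ)) (t : ℝ) :
    ∃ x₀, ∀ x < x₀, OffLines L t x ∧ below L t x = ∅ := by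
  obtain ⟨R, -, hR⟩ := exists_linePos_bound L |t|
  have h : ∀ x < -R, ∀ p ∈ L, x < linePos p t := fun x hx p hp =>
    hx.trans (abs_lt.1 (hR t le_rfl p hp)).1
  exact ⟨-R, fun x hx => ⟨fun p hp => (h x hx p hp).ne, below_eq_empty (h x hx)⟩⟩

theorem exists_below_eq_self (L : Finset (ℝ × ℝ)) (t : ℝ) :
    ∃ x₀, ∀ x, x₀ < x → OffLines L t x ∧ below L t x = L := by
  obtain ⟨R, -, hR⟩ := exists_linePos_bound L |t|
  have h : ∀ x, R < x → ∀ p ∈ L, linePos p t < x := fun x hx p hp =>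
    (abs_lt.1 (hR t le_rfl p hp)).2.trans hx
  exact ⟨R, fun x hx => ⟨fun p hp => (h x hx p hp).ne', below_eq_self (h x hx)⟩⟩

theorem eventually_offLines_nhdsNE (L : Finset (ℝ × ℝ)) (t x : ℝ) :
    ∀ᶠ y in 𝓝[≠] x, OffLines L t y := by
  have : ∀ᶠ y in cofinite, OffLines L t y := by
    rw [eventually_cofinite]; exact finite_not_offLines L t
  exact this.filter_mono (nhdsNE_le_cofinite x)

theorem exists_mem_Ioo_of_ae {P : ℝ → Prop} (hP : ∀ᵐ x, P x) {a b : ℝ} (hab : a < b) :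
    ∃ x ∈ Ioo a b, P x := by
  by_contra hcon
  push Not at hcon
  have h1 : volume (Ioo a b) = 0 := measure_mono_null (fun x hx => hcon x hx) (ae_iff.1 hP)
  rw [Real.volume_Ioo, ENNReal.ofReal_eq_zero] at h1
  linarith

theorem rarefactionSup_nonneg {N : ℕ} (lo hi : Fin N → ℝ) (rbar : Fin N → Vec N) (κ₂ : ℝ)
    (A : ℝ → ℝ → Mat N) (ψ : ℝ → ℝ → Vec N) (t : ℝ) :
    0 ≤ rarefactionSup lo hi rbar κ₂ A ψ t := by
  refine Real.sSup_nonneg ?_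
  rintro d ⟨x, S, i, -, -, -, -, rfl⟩
  exact norm_nonneg _

namespace IsCarriedBy

variable {N : ℕ} {L : Finset (ℝ × ℝ)} {Θ : Set ℝ} {uA : Finset (ℝ × ℝ) → Mat N}
  {uψ : Finset (ℝ × ℝ) → Vec N} {A : ℝ → ℝ → Mat N} {ψ : ℝ → ℝ → Vec N} {w : ℝ → ℝ → Fin N → ℝ}

theorem solution_ae_eq (h : IsCarriedBy L Θ uA uψ A ψ w) {t : ℝ} (ht : 0 ≤ t) :
    ψ t =ᵐ[volume] fun x => uψ (below L t x) :=
  (ae_offLines L t).mono fun x hx => h.solution_eq t ht x hx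

theorem solution_empty (h : IsCarriedBy L Θ uA uψ A ψ w) (hψ : Integrable (ψ 0)) : uψ ∅ = 0 := by
  obtain ⟨x₀, hx₀⟩ := exists_below_eq_empty L 0
  have h1 : IntegrableOn (fun _ : ℝ => uψ ∅) (Iio x₀) := by
    refine (hψ.integrableOn (s := Iio x₀)).congr_fun (fun x hx => ?_) measurableSet_Iio
    rw [h.solution_eq 0 self_mem_Ici x (hx₀ x hx).1, (hx₀ x hx).2]
  rw [integrableOn_const_iff] at h1
  simpa using h1

theorem solution_self (h : IsCarriedBy L Θ uA uψ A ψ w) (hψ : Integrable (ψ 0)) : uψ L = 0 := by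
  obtain ⟨x₀, hx₀⟩ := exists_below_eq_self L 0
  have h1 : IntegrableOn (fun _ : ℝ => uψ L) (Ioi x₀) := by
    refine (hψ.integrableOn (s := Ioi x₀)).congr_fun (fun x hx => ?_) measurableSet_Ioi
    rw [h.solution_eq 0 self_mem_Ici x (hx₀ x hx).1, (hx₀ x hx).2]
  rw [integrableOn_const_iff] at h1
  simpa using h1

theorem hasTraces_matrix (h : IsCarriedBy L Θ uA uψ A ψ w) {t : ℝ} (ht : 0 < t)
    (hg : IsGeneric L t) {p : ℝ × ℝ} (hp : p ∈ L) :
    HasTraces A t (linePos p t) p.2 (lineShock L uA uψ t p).Am (lineShock L uA uψ t p).Ap :=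
  hasTraces_of_comp_below h.matrix_eq (Ici_mem_nhds ht) hg hp

theorem hasTraces_solution (h : IsCarriedBy L Θ uA uψ A ψ w) {t : ℝ} (ht : 0 < t)
    (hg : IsGeneric L t) {p : ℝ × ℝ} (hp : p ∈ L) :
    HasTraces ψ t (linePos p t) p.2 (lineShock L uA uψ t p).ψm (lineShock L uA uψ t p).ψp :=
  hasTraces_of_comp_below h.solution_eq (Ici_mem_nhds ht) hg hp

theorem isShockAt_iff (h : IsCarriedBy L Θ uA uψ A ψ w) {t : ℝ} (ht : 0 < t)
    (hg : IsGeneric L t) {x : ℝ} {S : Shock N} :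
    IsShockAt A ψ t x S ↔ ∃ p ∈ L, x = linePos p t ∧ S = lineShock L uA uψ t p ∧ S.Am ≠ S.Ap := by
  constructor
  · rintro ⟨⟨-, hne, hA⟩, hψ⟩
    have hx : ¬ OffLines L t x := fun hx =>
      (h.locConst t x ht.le hx).not_isJump ⟨ht, hne, hA⟩
    simp only [OffLines, not_forall, not_not] at hx
    obtain ⟨p, hp, rfl⟩ := hx
    refine ⟨p, hp, rfl, ?_, hne⟩
    have h1 := h.hasTraces_matrix ht hg hp
    have h2 := h.hasTraces_solution ht hg hp
    have e1 : p.2 = S.speed := hA.speed_unique h1 hne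
    have e2 := hA.left_unique h1
    have e3 := hA.right_unique h1
    have e4 := hψ.left_unique h2
    have e5 := hψ.right_unique h2
    cases S
    simp only at e1 e2 e3 e4 e5
    subst e1 e2 e3 e4 e5
    rfl
  · rintro ⟨p, hp, rfl, rfl, hne⟩
    exact ⟨⟨ht, hne, h.hasTraces_matrix ht hg hp⟩, h.hasTraces_solution ht hg hp⟩

theorem exists_isolated_time (h : IsCarriedBy L Θ uA uψ A ψ w) {t : ℝ} (ht : 0 < t) :
    ∃ a b, 0 ≤ a ∧ a < t ∧ t < b ∧ ∀ τ ∈ Ioo a b, τ ≠ t → τ ∉ Θ := by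
  have h1 : (Θ \ {t})ᶜ ∩ Ioi 0 ∈ 𝓝 t := inter_mem
    ((h.finite.subset sdiff_subset).isClosed.isOpen_compl.mem_nhds (by simp)) (Ioi_mem_nhds ht)
  obtain ⟨a, b, ⟨hat, htb⟩, hab⟩ := mem_nhds_iff_exists_Ioo_subset.1 h1
  refine ⟨max a 0, b, le_max_right _ _, max_lt hat ht, htb, fun τ hτ hne hΘ => ?_⟩
  have := hab ⟨(le_max_left _ _).trans_lt hτ.1, hτ.2⟩
  exact this.1 ⟨hΘ, hne⟩

theorem exists_weight (h : IsCarriedBy L Θ uA uψ A ψ w) {a b : ℝ} (ha : 0 ≤ a)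
    (hab : ∀ τ ∈ Ioo a b, τ ∉ Θ) : ∃ uw : Finset (ℝ × ℝ) → Fin N → ℝ,
      ∀ t ∈ Ioo a b, ∀ x, OffLines L t x → w t x = uw (below L t x) :=
  exists_eq_comp_below ordConnected_Ioo (fun _ ht => ha.trans ht.1.le)
    fun t ht x hx => h.locConst_weight t x (ha.trans ht.1.le) (hab t ht) hx

theorem exists_weight_of_notMem (h : IsCarriedBy L Θ uA uψ A ψ w) {t : ℝ} (ht : 0 < t)
    (htΘ : t ∉ Θ) : ∃ a b, 0 ≤ a ∧ a < t ∧ t < b ∧ ∃ uw : Finset (ℝ × ℝ) → Fin N → ℝ,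
      ∀ t ∈ Ioo a b, ∀ x, OffLines L t x → w t x = uw (below L t x) := by
  obtain ⟨a, b, ha, hat, htb, hab⟩ := h.exists_isolated_time ht
  refine ⟨a, b, ha, hat, htb, h.exists_weight ha fun τ hτ => ?_⟩
  by_cases hτt : τ = t
  · rwa [hτt]
  · exact hab τ hτ hτt

theorem weightedDensity_eq (h : IsCarriedBy L Θ uA uψ A ψ w) (rbar : Fin N → Vec N)
    {J : Set ℝ} (hJ : J ⊆ Ici 0) {uw : Finset (ℝ × ℝ) → Fin N → ℝ}
    (huw : ∀ t ∈ J, ∀ x, OffLines L t x → w t x = uw (below L t x)) {t : ℝ} (ht : t ∈ J) :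
    weightedDensity rbar A ψ w t =ᵐ[volume] fun x => densityOf rbar uA uψ uw (below L t x) := by
  filter_upwards [ae_offLines L t] with x hx
  rw [weightedDensity, densityOf, h.matrix_eq t (hJ ht) x hx, h.solution_eq t (hJ ht) x hx,
    huw t ht x hx]

/-- At a generic time, the jumps of the matrix field are controlled by its total variation. -/
theorem sum_strength_le (h : IsCarriedBy L Θ uA uψ A ψ w) {t V : ℝ} (ht : 0 < t)
    (hg : IsGeneric L t) (hV : EssVariationLE (A t) V) :
    ∑ p ∈ L, (lineShock L uA uψ t p).strength ≤ max V 0 := by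
  obtain ⟨f, hfA, hfV⟩ := hV
  have hae : ∀ᵐ x, f x = A t x := hfA
  have key : ∀ P : Finset (ℝ × ℝ), P ⊆ L → ∀ b, (∀ p ∈ P, linePos p t < b) →
      ∑ p ∈ P, edist (lineShock L uA uψ t p).Am (lineShock L uA uψ t p).Ap ≤
        eVariationOn f (Iic b) := by
    intro P
    induction P using Finset.induction_on_max_value (fun p : ℝ × ℝ => linePos p t) with
    | empty => simp
    | insert p P hpP hmax ih =>
      intro hPL b hb
      have hpL : p ∈ L := hPL (Finset.mem_insert_self _ _)
      have hlt : ∀ q ∈ P, linePos q t < linePos p t := fun q hq => lt_of_le_of_ne (hmax q hq)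
        fun e => hpP (hg q (hPL (Finset.mem_insert_of_mem hq)) p hpL e ▸ hq)
      have hT := h.hasTraces_matrix ht hg hpL
      -- points on both sides of the line, between which the field has this jump only
      have hl : ∀ᶠ y in 𝓝[<] linePos p t, ∀ q ∈ P, linePos q t < y := by
        rw [Filter.eventually_all_finset]
        exact fun q hq => (lt_mem_nhds (hlt q hq)).filter_mono nhdsWithin_le_nhds
      obtain ⟨y₀, hy₀, hy⟩ := mem_nhdsLT_iff_exists_Ioo_subset.1 (hT.eventually_left.and hl)
      obtain ⟨z₀, hz₀, hz⟩ := mem_nhdsGT_iff_exists_Ioo_subset.1 hT.eventually_right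
      obtain ⟨y, hyI, hfy⟩ := exists_mem_Ioo_of_ae hae hy₀
      have hzb : linePos p t < min z₀ b := lt_min hz₀ (hb p (Finset.mem_insert_self _ _))
      obtain ⟨z, hzI, hfz⟩ := exists_mem_Ioo_of_ae hae hzb
      have e1 : f y = (lineShock L uA uψ t p).Am := hfy.trans (hy hyI).1
      have e2 : f z = (lineShock L uA uψ t p).Ap :=
        hfz.trans (hz ⟨hzI.1, hzI.2.trans_le (min_le_left _ _)⟩)
      have hyz : y < z := hyI.2.trans hzI.1
      have hzb' : z ≤ b := (hzI.2.trans_le (min_le_right _ _)).le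
      rw [Finset.sum_insert hpP, add_comm]
      have h1 := ih (fun q hq => hPL (Finset.mem_insert_of_mem hq)) y (hy hyI).2
      have h2 : edist (lineShock L uA uψ t p).Am (lineShock L uA uψ t p).Ap ≤
          eVariationOn f (Icc y z) := by
        rw [← e1, ← e2]
        exact eVariationOn.edist_le f ⟨le_rfl, hyz.le⟩ ⟨hyz.le, le_rfl⟩
      refine (add_le_add h1 h2).trans ((eVariationOn.add_le_union f fun a ha c hc =>
        (show a ≤ y from ha).trans hc.1).trans (eVariationOn.mono f ?_))
      exact union_subset (Iic_subset_Iic.2 (hyz.le.trans hzb'))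
        fun c hc => (show c ≤ b from hc.2.trans hzb')
  obtain ⟨R, -, hR⟩ := exists_linePos_bound L |t|
  have h1 := (key L Subset.rfl R fun p hp => (abs_lt.1 (hR t le_rfl p hp)).2).trans
    ((eVariationOn.mono f (subset_univ _)).trans hfV)
  have h2 : ∑ p ∈ L, edist (lineShock L uA uψ t p).Am (lineShock L uA uψ t p).Ap =
      ENNReal.ofReal (∑ p ∈ L, (lineShock L uA uψ t p).strength) := by
    rw [ENNReal.ofReal_sum_of_nonneg fun p _ => show 0 ≤ (lineShock L uA uψ t p).strength from
      norm_nonneg _]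
    refine Finset.sum_congr rfl fun p _ => ?_
    rw [edist_comm, edist_dist, dist_eq_norm, Shock.strength]
  rw [h2] at h1
  rcases le_total V 0 with hV0 | hV0
  · rw [ENNReal.ofReal_of_nonpos hV0, nonpos_iff_eq_zero, ENNReal.ofReal_eq_zero] at h1
    exact h1.trans (le_max_right _ _)
  · exact ((ENNReal.ofReal_le_ofReal_iff hV0).1 h1).trans (le_max_left _ _)

/-! ### The supremum over the rarefaction shocks -/

/-- The jumps of `ψ` over which `rarefactionSup` is the supremum are bounded, uniformly in time. -/
theorem exists_jump_bound (h : IsCarriedBy L Θ uA uψ A ψ w) :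
    ∃ B, 0 ≤ B ∧ ∀ t x S, IsShockAt A ψ t x S → ‖S.ψp - S.ψm‖ ≤ B := by
  obtain ⟨B, hB0, hB⟩ := exists_norm_comp_below_le L uψ
  refine ⟨B + B, by positivity, fun t x S hS => ?_⟩
  have ht : 0 < t := hS.1.1
  have hl : 𝓝[<] x ≤ 𝓝[≠] x := nhdsWithin_mono _ fun y hy => (show y < x from hy).ne
  have hr : 𝓝[>] x ≤ 𝓝[≠] x := nhdsWithin_mono _ fun y hy => (show x < y from hy).ne'
  obtain ⟨y, hy, hy'⟩ := (hS.2.eventually_left.and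
    ((eventually_offLines_nhdsNE L t x).filter_mono hl)).exists
  obtain ⟨z, hz, hz'⟩ := (hS.2.eventually_right.and
    ((eventually_offLines_nhdsNE L t x).filter_mono hr)).exists
  rw [← hy, ← hz, h.solution_eq t ht.le y hy', h.solution_eq t ht.le z hz']
  exact (norm_sub_le _ _).trans (add_le_add (hB _ _) (hB _ _))

theorem exists_rarefactionSup_le (h : IsCarriedBy L Θ uA uψ A ψ w) (lo hi : Fin N → ℝ)
    (rbar : Fin N → Vec N) (κ₂ : ℝ) :
    ∃ B, ∀ t, |rarefactionSup lo hi rbar κ₂ A ψ t| ≤ B := by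
  obtain ⟨B, hB0, hB⟩ := h.exists_jump_bound
  refine ⟨B, fun t => ?_⟩
  rw [abs_of_nonneg]
  · refine Real.sSup_le ?_ hB0
    rintro d ⟨x, S, i, hS, -, -, -, rfl⟩
    exact hB t x S hS
  · exact rarefactionSup_nonneg lo hi rbar κ₂ A ψ t

theorem le_rarefactionSup (h : IsCarriedBy L Θ uA uψ A ψ w) {lo hi : Fin N → ℝ}
    {rbar : Fin N → Vec N} {κ₂ t x : ℝ} {S : Shock N} {i : Fin N} (hS : IsShockAt A ψ t x S)
    (hf : S.InFamily lo hi i) (hr : S.IsRarefaction i) (hs : S.IsStronglyDominant rbar κ₂ i) :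
    ‖S.ψp - S.ψm‖ ≤ rarefactionSup lo hi rbar κ₂ A ψ t := by
  obtain ⟨B, -, hB⟩ := h.exists_jump_bound
  refine le_csSup ⟨B, ?_⟩ ⟨x, S, i, hS, hf, hr, hs, rfl⟩
  rintro d ⟨x, S, i, hS, -, -, -, rfl⟩
  exact hB t x S hS

theorem eventually_rarefactionSup_eq (h : IsCarriedBy L Θ uA uψ A ψ w) (lo hi : Fin N → ℝ)
    (rbar : Fin N → Vec N) (κ₂ : ℝ) {t : ℝ} (ht : 0 < t) (hg : IsGeneric L t) :
    ∀ᶠ τ in 𝓝 t,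
      rarefactionSup lo hi rbar κ₂ A ψ τ = rarefactionSup lo hi rbar κ₂ A ψ t := by
  have key : ∀ τ, 0 < τ → IsGeneric L τ →
      (∀ p ∈ L, below L τ (linePos p τ) = below L t (linePos p t)) →
      rarefactionSup lo hi rbar κ₂ A ψ τ = sSup {d | ∃ p ∈ L, ∃ S i,
        S = lineShock L uA uψ t p ∧ S.Am ≠ S.Ap ∧ S.InFamily lo hi i ∧
        S.IsRarefaction i ∧ S.IsStronglyDominant rbar κ₂ i ∧ d = ‖S.ψp - S.ψm‖} := by
    intro τ hτ hgτ hb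
    have hsh : ∀ p ∈ L, lineShock L uA uψ τ p = lineShock L uA uψ t p := fun p hp => by
      simp only [lineShock, hb p hp]
    unfold rarefactionSup
    congr 1
    ext d
    constructor
    · rintro ⟨x, S, i, hS, h1, h2, h3, h4⟩
      obtain ⟨p, hp, -, hSp, hne⟩ := (h.isShockAt_iff hτ hgτ).1 hS
      exact ⟨p, hp, S, i, hSp.trans (hsh p hp), hne, h1, h2, h3, h4⟩
    · rintro ⟨p, hp, S, i, hSp, hne, h1, h2, h3, h4⟩
      exact ⟨linePos p τ, S, i, (h.isShockAt_iff hτ hgτ).2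
        ⟨p, hp, rfl, hSp.trans (hsh p hp).symm, hne⟩, h1, h2, h3, h4⟩
  filter_upwards [eventually_isGeneric hg, lt_mem_nhds ht] with τ hτ hτ0
  rw [key τ hτ0 hτ.1 hτ.2, key t ht hg fun p _ => rfl]

theorem intervalIntegrable_rarefactionSup (h : IsCarriedBy L Θ uA uψ A ψ w) (lo hi : Fin N → ℝ)
    (rbar : Fin N → Vec N) (κ₂ : ℝ) :
    AEStronglyMeasurable (rarefactionSup lo hi rbar κ₂ A ψ) volume ∧
    ∀ a b, IntervalIntegrable (rarefactionSup lo hi rbar κ₂ A ψ) volume a b := by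
  have hneg : ∀ t ≤ 0, rarefactionSup lo hi rbar κ₂ A ψ t = 0 := by
    intro t ht
    have : {d | ∃ (x : ℝ) (S : Shock N) (i : Fin N), IsShockAt A ψ t x S ∧ S.InFamily lo hi i ∧
        S.IsRarefaction i ∧ S.IsStronglyDominant rbar κ₂ i ∧ d = ‖S.ψp - S.ψm‖} = ∅ := by
      rw [eq_empty_iff_forall_notMem]
      rintro d ⟨x, S, i, hS, -⟩
      exact absurd hS.1.1 ht.not_gt
    rw [rarefactionSup, this, Real.sSup_empty]
  have hT : ({t | ¬ IsGeneric L t} ∪ {0}).Finite :=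
    (finite_not_isGeneric L).union (finite_singleton 0)
  have hcont : ContinuousOn (rarefactionSup lo hi rbar κ₂ A ψ) ({t | ¬ IsGeneric L t} ∪ {0})ᶜ := by
    intro t ht
    refine ContinuousAt.continuousWithinAt ?_
    simp only [mem_compl_iff, mem_union, mem_ofPred_eq, mem_singleton_iff, not_or, not_not] at ht
    rcases lt_or_gt_of_ne ht.2 with h0 | h0
    · refine continuousAt_const.congr (f := fun _ => (0 : ℝ)) ?_
      filter_upwards [gt_mem_nhds h0] with τ hτ
      exact (hneg τ (le_of_lt hτ)).symm
    · refine continuousAt_const.congr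
        (f := fun _ => rarefactionSup lo hi rbar κ₂ A ψ t) ?_
      filter_upwards [h.eventually_rarefactionSup_eq lo hi rbar κ₂ h0 ht.1] with τ hτ
      exact hτ.symm
  have hmeas : AEStronglyMeasurable (rarefactionSup lo hi rbar κ₂ A ψ) volume := by
    have h1 := hcont.aestronglyMeasurable (μ := volume) hT.measurableSet.compl
    have h2 : ∀ᵐ t : ℝ, t ∈ ({t | ¬ IsGeneric L t} ∪ {0})ᶜ :=
      compl_mem_ae_iff.2 (hT.measure_zero volume)
    rwa [Measure.restrict_eq_self_of_ae_mem h2] at h1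
  refine ⟨hmeas, fun a b => ?_⟩
  obtain ⟨B, hB⟩ := h.exists_rarefactionSup_le lo hi rbar κ₂
  refine (intervalIntegrable_const (c := B)).mono_fun hmeas.restrict (ae_of_all _ fun t => ?_)
  exact (hB t).trans (le_abs_self B)

end IsCarriedBy

/-! ### The derivative of the weighted norm -/

/-- Where the matrix field has no jump, the weighted fluxes are balanced: the flux of a component
jumps neither along its own characteristic lines, nor across the other lines. -/
theorem sum_flux_eq_zero {N : ℕ} {lo hi : Fin N → ℝ} {rbar : Fin N → Vec N} {m δ : ℝ} {M : Mat N}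
    (hM : IsRegularMat lo hi rbar m δ M) {s : ℝ} {ψm ψp : Vec N}
    (hRH : s • (ψm - ψp) = M ψm - M ψp) {wm wp : Fin N → ℝ}
    (hw : wm = wp ∨ ∃ i, s = eigval M i ∧ ∀ j, j ≠ i → wp j = wm j) :
    ∑ j, ((s - eigval M j) * |charComp rbar M ψm j| * wm j -
      (s - eigval M j) * |charComp rbar M ψp j| * wp j) = 0 := by
  have h1 : ∀ j, (s - eigval M j) * charComp rbar M ψm j =
      (s - eigval M j) * charComp rbar M ψp j := by
    have e : s • ψm - M ψm = s • ψp - M ψp := by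
      rw [smul_sub, sub_eq_sub_iff_add_eq_add] at hRH
      rw [sub_eq_sub_iff_add_eq_add, add_comm, add_comm (s • ψp), ← sub_eq_zero]
      rw [← sub_eq_zero] at hRH
      rw [← hRH]; abel
    have h2 := hM.charComp_eq (hM.smul_sub_apply_eq_sum s ψm).symm
    have h3 := hM.charComp_eq (hM.smul_sub_apply_eq_sum s ψp).symm
    rw [e, h3] at h2
    exact fun j => (congr_fun h2 j).symm
  have h4 : ∀ j, (s - eigval M j) * |charComp rbar M ψm j| =
      (s - eigval M j) * |charComp rbar M ψp j| := by
    intro j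
    rcases mul_eq_mul_left_iff.1 (h1 j) with h | h
    · rw [h]
    · rw [h, zero_mul, zero_mul]
  refine Finset.sum_eq_zero fun j _ => ?_
  rw [h4 j, ← mul_sub]
  rcases hw with rfl | ⟨i, hi, hj⟩
  · rw [sub_self, mul_zero]
  · by_cases hji : j = i
    · rw [hji, hi, sub_self, zero_mul, zero_mul]
    · rw [hj j hji, sub_self, mul_zero]

theorem HasTraces.forall_mem {X : Type*} {f : ℝ → ℝ → X} {t x s : ℝ} {fm fp : X}
    (h : HasTraces f t x s fm fp) {Q : X → Prop} (hQ : ∀ y, Q (f t y)) : Q fm ∧ Q fp := by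
  obtain ⟨y, hy⟩ := h.eventually_left.exists
  obtain ⟨z, hz⟩ := h.eventually_right.exists
  exact ⟨hy ▸ hQ y, hz ▸ hQ z⟩

namespace IsCarriedBy

variable {N : ℕ} {L : Finset (ℝ × ℝ)} {Θ : Set ℝ} {uA : Finset (ℝ × ℝ) → Mat N}
  {uψ : Finset (ℝ × ℝ) → Vec N} {A : ℝ → ℝ → Mat N} {ψ : ℝ → ℝ → Vec N} {w : ℝ → ℝ → Fin N → ℝ}
  {lo hi : Fin N → ℝ} {rbar : Fin N → Vec N} {m g W V wmin c κ₁ κ₂ K B δ : ℝ}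

theorem isRegularMat_below (h : IsCarriedBy L Θ uA uψ A ψ w)
    (hA : IsUniformlyHyperbolicBV lo hi rbar δ V A) (hrbar : CoordBound m rbar) (hm : 0 ≤ m)
    (hδm : m * δ ≤ 1 / 2) {t x : ℝ} (ht : 0 ≤ t) (hx : OffLines L t x) :
    IsRegularMat lo hi rbar (2 * m) δ (uA (below L t x)) := by
  rw [← h.matrix_eq t ht x hx]
  exact hA.isRegularMat hrbar hm hδm ht (h.locConst t x ht hx)

theorem densityOf_ends (h : IsCarriedBy L Θ uA uψ A ψ w)
    (hA : IsUniformlyHyperbolicBV lo hi rbar δ V A) (hrbar : CoordBound m rbar) (hm : 0 ≤ m)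
    (hδm : m * δ ≤ 1 / 2) (hψ : Integrable (ψ 0)) (uw : Finset (ℝ × ℝ) → Fin N → ℝ) :
    (densityOf rbar uA uψ uw ∅ = 0 ∧ densityOf rbar uA uψ uw L = 0) ∧
    fluxOf rbar uA uψ uw ∅ = 0 ∧ fluxOf rbar uA uψ uw L = 0 := by
  have h1 : IsRegularMat lo hi rbar (2 * m) δ (uA ∅) := by
    obtain ⟨x₀, hx₀⟩ := exists_below_eq_empty L 0
    obtain ⟨hx, hb⟩ := hx₀ (x₀ - 1) (by linarith)
    have := h.isRegularMat_below hA hrbar hm hδm le_rfl hx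
    rwa [hb] at this
  have h2 : IsRegularMat lo hi rbar (2 * m) δ (uA L) := by
    obtain ⟨x₀, hx₀⟩ := exists_below_eq_self L 0
    obtain ⟨hx, hb⟩ := hx₀ (x₀ + 1) (by linarith)
    have := h.isRegularMat_below hA hrbar hm hδm le_rfl hx
    rwa [hb] at this
  simp [densityOf, fluxOf, h.solution_empty hψ, h.solution_self hψ, h1.charComp_zero,
    h2.charComp_zero]

/-- The weighted fluxes lost at the line `p`, at a generic time. -/
theorem line_flux_le (h : IsCarriedBy L Θ uA uψ A ψ w)
    (hA : IsUniformlyHyperbolicBV lo hi rbar δ V A) (hvec : EigvecJumpBound lo hi rbar c A)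
    (hsmall : HasSmallShocks lo hi δ A) (hψ : IsWeakSolution A ψ)
    (hcon : WeightConstraints lo hi rbar κ₁ κ₂ K A ψ w)
    (hbd : ∀ t x j, 0 ≤ t → w t x j ∈ Icc wmin W)
    (hrbar : CoordBound m rbar) (hm : 0 ≤ m)
    (hB : IsBigConstant N (2 * m) g W |c| κ₁ κ₂ B) (hg : 0 < g)
    (hκ₁ : 0 < κ₁) (hκ₂ : 0 < κ₂) (hwmin : 0 < wmin) (hK : 4 * B ^ 2 ≤ K)
    (hδ : 16 * B ^ 3 * δ ≤ 1) (hδw : 2 * B ^ 2 * δ ≤ wmin) (hδm : 2 * m * δ ≤ 1 / 4)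
    (hgap : ∀ j k : Fin N, j < k → g ≤ lo k - hi j) {t : ℝ} (ht : 0 < t) (hgen : IsGeneric L t)
    {p : ℝ × ℝ} (hp : p ∈ L) {wm wp : Fin N → ℝ}
    (hw : HasTraces w t (linePos p t) p.2 wm wp)
    (hadj : IsJump w t (linePos p t) p.2 wm wp →
      (∃ s' Am Ap, IsJump A t (linePos p t) s' Am Ap) ∨
      (∃ M, HasTraces A t (linePos p t) p.2 M M ∧ ∃ i, p.2 = eigval M i ∧
        ∀ j, j ≠ i → wp j = wm j)) :
    ∑ j, ((lineShock L uA uψ t p).βm rbar j * wm j - (lineShock L uA uψ t p).βp rbar j * wp j) ≤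
      2 * B ^ 2 * ((lineShock L uA uψ t p).strength * rarefactionSup lo hi rbar κ₂ A ψ t) := by
  classical
  have hTA := h.hasTraces_matrix ht hgen hp
  have hTψ := h.hasTraces_solution ht hgen hp
  have hRH := hψ.rankineHugoniot ht hTA hTψ
  set S := lineShock L uA uψ t p with hS
  have hreg : IsRegularMat lo hi rbar (2 * m) δ S.Am ∧ IsRegularMat lo hi rbar (2 * m) δ S.Ap := by
    obtain ⟨⟨y, hy, hym⟩, ⟨z, hz, hzp⟩⟩ := hTA.exists_locConstAt
    rw [← hym, ← hzp]
    exact ⟨hA.isRegularMat hrbar hm (by linarith) ht.le hy,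
      hA.isRegularMat hrbar hm (by linarith) ht.le hz⟩
  have hσ := rarefactionSup_nonneg lo hi rbar κ₂ A ψ t
  have hstr0 : 0 ≤ S.strength := norm_nonneg _
  by_cases hne : S.Am = S.Ap
  · have hzero : ∑ j, (S.βm rbar j * wm j - S.βp rbar j * wp j) = 0 := by
      have hTA' := hTA
      rw [← hne] at hTA' hRH
      have := sum_flux_eq_zero hreg.1 (wm := wm) (wp := wp) hRH ?_
      · refine Eq.trans ?_ this
        simp only [Shock.βm, Shock.βp, Shock.αm, Shock.αp, ← hne]
        rfl
      · by_cases hww : wm = wp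
        · exact Or.inl hww
        · right
          rcases hadj ⟨ht, hww, hw⟩ with ⟨s', Am, Ap, -, hne', hT'⟩ | ⟨M, hM, i, hi, hj⟩
          · exact absurd ((hT'.left_unique hTA').trans (hT'.right_unique hTA').symm) hne'
          · rw [hTA'.left_unique hM]
            exact ⟨i, hi, hj⟩
    rw [hzero]
    positivity
  · have hjump : IsJump A t (linePos p t) S.speed S.Am S.Ap := ⟨ht, hne, hTA⟩
    have hsh : IsShockAt A ψ t (linePos p t) S := ⟨hjump, hTψ⟩
    obtain ⟨i, hi⟩ := hA.speed_mem _ _ _ _ _ hjump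
    obtain ⟨h1, h2, h3⟩ := hsmall _ _ _ _ _ i hjump hi
    have h4 : S.eigvecJump rbar i ≤ |c| * S.lamJump i :=
      (hvec _ _ _ _ _ i hjump hi).trans
        (mul_le_mul_of_nonneg_right (le_abs_self c) (abs_nonneg _))
    have hwb : (∀ j, wm j ∈ Icc wmin W) ∧ (∀ j, wp j ∈ Icc wmin W) :=
      hw.forall_mem (Q := fun v => ∀ j, v j ∈ Icc wmin W) fun y j => hbd t y j ht.le
    have key := Shock.sum_flux_le (K := K) (i := i) hB (by positivity) hg (abs_nonneg c) hκ₁ hκ₂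
      hwmin hK hδ hδw hδm hgap hreg.1 hreg.2 hRH hi h1 h2 h3 h4 hwb.1 hwb.2
      (fun j => hcon.lower _ _ _ _ _ i j hsh hw hi) (fun j => hcon.upper _ _ _ _ _ i j hsh hw hi)
      (hcon.slow_strong _ _ _ _ _ i hsh hw hi) (hcon.fast_strong _ _ _ _ _ i hsh hw hi)
      (hcon.slow_weak _ _ _ _ _ i hsh hw hi) (hcon.fast_weak _ _ _ _ _ i hsh hw hi)
    refine key.trans ?_
    split_ifs with hif
    · have := h.le_rarefactionSup hsh hi hif.1 hif.2
      gcongr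
    · positivity

/-- At a generic time, the density of the weighted norm is integrable, and the weighted norm is
differentiable, with a derivative controlled by the rarefaction shocks. -/
theorem weightedNorm_hasDerivAt (h : IsCarriedBy L Θ uA uψ A ψ w)
    (hA : IsUniformlyHyperbolicBV lo hi rbar δ V A) (hvec : EigvecJumpBound lo hi rbar c A)
    (hsmall : HasSmallShocks lo hi δ A) (hψ : IsWeakSolution A ψ) (hψ0 : Integrable (ψ 0))
    (hcon : WeightConstraints lo hi rbar κ₁ κ₂ K A ψ w)
    (hbd : ∀ t x j, 0 ≤ t → w t x j ∈ Icc wmin W)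
    (hrbar : CoordBound m rbar) (hm : 0 ≤ m)
    (hB : IsBigConstant N (2 * m) g W |c| κ₁ κ₂ B) (hg : 0 < g)
    (hκ₁ : 0 < κ₁) (hκ₂ : 0 < κ₂) (hwmin : 0 < wmin) (hK : 4 * B ^ 2 ≤ K)
    (hδ : 16 * B ^ 3 * δ ≤ 1) (hδw : 2 * B ^ 2 * δ ≤ wmin) (hδm : 2 * m * δ ≤ 1 / 4)
    (hgap : ∀ j k : Fin N, j < k → g ≤ lo k - hi j) {t : ℝ} (ht : 0 < t) (hgen : IsGeneric L t)
    (htΘ : t ∉ Θ)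
    (hadj : ∀ x s wm wp, IsJump w t x s wm wp → (∃ s' Am Ap, IsJump A t x s' Am Ap) ∨
      (∃ M, HasTraces A t x s M M ∧ ∃ i, s = eigval M i ∧ ∀ j, j ≠ i → wp j = wm j)) :
    Integrable (weightedDensity rbar A ψ w t) ∧
    ∃ F', HasDerivAt (weightedNorm rbar A ψ w) F' t ∧
      F' ≤ 2 * B ^ 2 * max V 0 * rarefactionSup lo hi rbar κ₂ A ψ t := by
  obtain ⟨a, b, ha, hat, htb, uw, huw⟩ := h.exists_weight_of_notMem ht htΘ
  have hJ : Ioo a b ⊆ Ici 0 := fun τ hτ => ha.trans hτ.1.le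
  have hJt : Ioo a b ∈ 𝓝 t := Ioo_mem_nhds hat htb
  obtain ⟨⟨hd0, hd1⟩, hf0, hf1⟩ := h.densityOf_ends hA hrbar hm (by linarith) hψ0 uw
  refine ⟨(integrable_comp_below hd0 hd1 t).congr
    (h.weightedDensity_eq rbar hJ huw ⟨hat, htb⟩).symm,
    -∑ p ∈ L, lineJump L (densityOf rbar uA uψ uw) t p * p.2, ?_, ?_⟩
  · refine (hasDerivAt_integral_comp_below hd0 hd1 hgen).congr_of_eventuallyEq ?_
    filter_upwards [hJt] with τ hτ
    exact integral_congr_ae (h.weightedDensity_eq rbar hJ huw hτ)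
  · -- the fluxes vanish at both ends, so that their jumps may be added to the sum
    have hflux := sum_lineJump hgen (fluxOf rbar uA uψ uw)
    rw [hf0, hf1, sub_zero] at hflux
    have e : ∀ p ∈ L, lineJump L (fluxOf rbar uA uψ uw) t p -
        lineJump L (densityOf rbar uA uψ uw) t p * p.2 =
        ∑ j, ((lineShock L uA uψ t p).βm rbar j * uw (below L t (linePos p t)) j -
          (lineShock L uA uψ t p).βp rbar j * uw (insert p (below L t (linePos p t))) j) := by
      intro p _
      simp only [lineJump, fluxOf, densityOf, Shock.βm, Shock.βp, Shock.αm, Shock.αp, lineShock]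
      rw [← Finset.sum_sub_distrib, ← Finset.sum_sub_distrib, Finset.sum_mul,
        ← Finset.sum_sub_distrib]
      exact Finset.sum_congr rfl fun j _ => by ring
    have hle : ∀ p ∈ L, lineJump L (fluxOf rbar uA uψ uw) t p -
        lineJump L (densityOf rbar uA uψ uw) t p * p.2 ≤
        2 * B ^ 2 * ((lineShock L uA uψ t p).strength * rarefactionSup lo hi rbar κ₂ A ψ t) := by
      intro p hp
      rw [e p hp]
      exact h.line_flux_le hA hvec hsmall hψ hcon hbd hrbar hm hB hg hκ₁ hκ₂ hwmin hK hδ hδw hδm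
        hgap ht hgen hp (hasTraces_of_comp_below huw hJt hgen hp) (hadj _ _ _ _)
    have hsum := Finset.sum_le_sum hle
    rw [Finset.sum_sub_distrib, hflux, zero_sub, ← Finset.mul_sum, ← Finset.sum_mul] at hsum
    refine hsum.trans ?_
    rw [mul_assoc (2 * B ^ 2)]
    exact mul_le_mul_of_nonneg_left (mul_le_mul_of_nonneg_right
      (h.sum_strength_le ht hgen (hA.variation t ht.le))
      (rarefactionSup_nonneg lo hi rbar κ₂ A ψ t)) (by positivity)

end IsCarriedBy

/-! ### Integration in time -/

/-- A function with nonpositive derivative off a finite set, and whose jumps are nonpositive,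
decreases. -/
theorem le_of_deriv_nonpos_of_jumps {f f' : ℝ → ℝ} {T : Set ℝ} (hT : T.Finite)
    (hd : ∀ t, 0 < t → t ∉ T → HasDerivAt f (f' t) t ∧ f' t ≤ 0)
    (hj : ∀ t, 0 < t → ∃ y z, Tendsto f (𝓝[<] t) (𝓝 y) ∧ Tendsto f (𝓝[>] t) (𝓝 z) ∧ z ≤ y)
    {a b : ℝ} (ha : 0 < a) (hab : a < b) (haT : a ∉ T) (hbT : b ∉ T) : f b ≤ f a := by
  have key : ∀ n : ℕ, ∀ a b, 0 < a → a < b → a ∉ T → b ∉ T → (T ∩ Ioo a b).ncard ≤ n →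
      f b ≤ f a := by
    intro n
    induction n with
    | zero =>
      intro a b ha hab haT hbT hn
      have hempty : T ∩ Ioo a b = ∅ :=
        (ncard_eq_zero (hT.subset inter_subset_left)).1 (Nat.le_zero.1 hn)
      have hdI : ∀ t ∈ Icc a b, HasDerivAt f (f' t) t ∧ f' t ≤ 0 := by
        intro t ht
        refine hd t (ha.trans_le ht.1) fun htT => ?_
        rcases ht.1.eq_or_lt with h | h
        · exact haT (h ▸ htT)
        rcases ht.2.eq_or_lt with h' | h'
        · exact hbT (h' ▸ htT)
        exact hempty.subset ⟨htT, h, h'⟩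
      refine antitoneOn_of_hasDerivWithinAt_nonpos (convex_Icc a b) (f' := f')
        (fun t ht => (hdI t ht).1.continuousAt.continuousWithinAt)
        (fun t ht => (hdI t (interior_subset ht)).1.hasDerivWithinAt)
        (fun t ht => (hdI t (interior_subset ht)).2) (left_mem_Icc.2 hab.le)
        (right_mem_Icc.2 hab.le) hab.le
    | succ n ih =>
      intro a b ha hab haT hbT hn
      by_cases hempty : (T ∩ Ioo a b).Nonempty
      · obtain ⟨t, htT, hat, htb⟩ := hempty
        obtain ⟨y, z, hy, hz, hzy⟩ := hj t (ha.trans hat)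
        have hTc : ∀ᶠ τ in 𝓝[≠] t, τ ∉ T := by
          have : ∀ᶠ τ in cofinite, τ ∉ T := by simpa [eventually_cofinite] using hT
          exact this.filter_mono (nhdsNE_le_cofinite t)
        have hless : ∀ a' b', a ≤ a' → b' ≤ b → t ∉ Ioo a' b' → (T ∩ Ioo a' b').ncard ≤ n := by
          intro a' b' h1 h2 h3
          have hss : T ∩ Ioo a' b' ⊂ T ∩ Ioo a b :=
            ⟨inter_subset_inter_right _ (Ioo_subset_Ioo h1 h2),
              fun h => h3 (h ⟨htT, hat, htb⟩).2⟩
          have := ncard_lt_ncard hss (hT.subset inter_subset_left)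
          omega
        have h1 : f b ≤ z := by
          refine ge_of_tendsto hz ?_
          filter_upwards [hTc.filter_mono (nhdsWithin_mono _ fun τ (h : t < τ) => h.ne'),
            Ioo_mem_nhdsGT htb] with τ hτ hτb
          exact ih τ b ((ha.trans hat).trans hτb.1) hτb.2 hτ hbT
            (hless τ b (hat.trans hτb.1).le le_rfl fun h => absurd h.1 hτb.1.not_gt)
        have h2 : y ≤ f a := by
          refine le_of_tendsto hy ?_
          filter_upwards [hTc.filter_mono (nhdsWithin_mono _ fun τ (h : τ < t) => h.ne),
            Ioo_mem_nhdsLT hat] with τ hτ hτa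
          exact ih a τ ha hτa.1 haT hτ
            (hless a τ le_rfl (hτa.2.trans htb).le fun h => absurd h.2 hτa.2.not_gt)
        exact h1.trans (hzy.trans h2)
      · rw [not_nonempty_iff_eq_empty] at hempty
        exact ih a b ha hab haT hbT (by simp [hempty])
  exact key _ a b ha hab haT hbT le_rfl

namespace IsCarriedBy

variable {N : ℕ} {L : Finset (ℝ × ℝ)} {Θ : Set ℝ} {uA : Finset (ℝ × ℝ) → Mat N}
  {uψ : Finset (ℝ × ℝ) → Vec N} {A : ℝ → ℝ → Mat N} {ψ : ℝ → ℝ → Vec N} {w : ℝ → ℝ → Fin N → ℝ}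
  {lo hi : Fin N → ℝ} {rbar : Fin N → Vec N} {m W V wmin δ : ℝ}

/-- The weighted norm has one-sided limits in time, and only nonpositive jumps, because the weight
decreases. -/
theorem weightedNorm_jump (h : IsCarriedBy L Θ uA uψ A ψ w)
    (hA : IsUniformlyHyperbolicBV lo hi rbar δ V A) (hrbar : CoordBound m rbar) (hm : 0 ≤ m)
    (hδm : m * δ ≤ 1 / 2) (hψ : Integrable (ψ 0)) {t : ℝ} (ht : 0 < t)
    (hdec : ∀ᶠ x in cofinite, ∀ j, ∀ᶠ τ in 𝓝[>] t, ∀ᶠ σ in 𝓝[<] t, w τ x j ≤ w σ x j) :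
    ∃ y z, Tendsto (weightedNorm rbar A ψ w) (𝓝[<] t) (𝓝 y) ∧
      Tendsto (weightedNorm rbar A ψ w) (𝓝[>] t) (𝓝 z) ∧ z ≤ y := by
  obtain ⟨a, b, ha, hat, htb, hab⟩ := h.exists_isolated_time ht
  obtain ⟨um, hum⟩ := h.exists_weight (a := a) (b := t) ha
    fun τ hτ => hab τ ⟨hτ.1, hτ.2.trans htb⟩ hτ.2.ne
  obtain ⟨up, hup⟩ := h.exists_weight (a := t) (b := b) ht.le
    fun τ hτ => hab τ ⟨hat.trans hτ.1, hτ.2⟩ hτ.1.ne'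
  obtain ⟨⟨hm0, hm1⟩, -⟩ := h.densityOf_ends hA hrbar hm hδm hψ um
  obtain ⟨⟨hp0, hp1⟩, -⟩ := h.densityOf_ends hA hrbar hm hδm hψ up
  refine ⟨∫ x, densityOf rbar uA uψ um (below L t x), ∫ x, densityOf rbar uA uψ up (below L t x),
    ?_, ?_, ?_⟩
  · refine (((continuous_integral_comp_below hm0 hm1).tendsto t).mono_left
      nhdsWithin_le_nhds).congr' ?_
    filter_upwards [Ioo_mem_nhdsLT hat] with τ hτ
    exact (integral_congr_ae (h.weightedDensity_eq rbar
      (fun τ hτ => ha.trans hτ.1.le) hum hτ)).symm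
  · refine (((continuous_integral_comp_below hp0 hp1).tendsto t).mono_left
      nhdsWithin_le_nhds).congr' ?_
    filter_upwards [Ioo_mem_nhdsGT htb] with τ hτ
    exact (integral_congr_ae (h.weightedDensity_eq rbar
      (fun τ hτ => ht.le.trans hτ.1.le) hup hτ)).symm
  · refine integral_mono_ae (integrable_comp_below hp0 hp1 t) (integrable_comp_below hm0 hm1 t) ?_
    have hdec' : ∀ᵐ x : ℝ, ∀ j, ∀ᶠ τ in 𝓝[>] t, ∀ᶠ σ in 𝓝[<] t, w τ x j ≤ w σ x j := by
      rw [ae_iff]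
      exact (eventually_cofinite.1 hdec).measure_zero _
    filter_upwards [ae_offLines L t, hdec'] with x hx hdx
    refine Finset.sum_le_sum fun j _ => mul_le_mul_of_nonneg_left ?_ (abs_nonneg _)
    have hnear : ∀ᶠ τ in 𝓝 t, OffLines L τ x ∧ below L τ x = below L t x :=
      ((by fun_prop : Continuous fun τ : ℝ => (τ, x)).tendsto t).eventually (eventually_below_eq hx)
    obtain ⟨τ, ⟨hτ1, hτ2⟩, hτ3⟩ := (((hdx j).and
      (hnear.filter_mono nhdsWithin_le_nhds)).and (Ioo_mem_nhdsGT htb)).exists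
    obtain ⟨σ, ⟨hσ1, hσ2⟩, hσ3⟩ := ((hτ1.and
      (hnear.filter_mono nhdsWithin_le_nhds)).and (Ioo_mem_nhdsLT hat)).exists
    rwa [hup τ hτ3 x hτ2.1, hτ2.2, hum σ hσ3 x hσ2.1, hσ2.2] at hσ1

/-- The density of the weighted norm is comparable to the norm of the solution. -/
theorem weightedDensity_bounds (h : IsCarriedBy L Θ uA uψ A ψ w)
    (hA : IsUniformlyHyperbolicBV lo hi rbar δ V A) (hrbar : CoordBound m rbar) (hm : 0 ≤ m)
    (hδm : m * δ ≤ 1 / 2) (hbd : ∀ t x j, 0 ≤ t → w t x j ∈ Icc wmin W) (hwmin : 0 ≤ wmin)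
    (hW : 0 ≤ W) {t : ℝ} (ht : 0 ≤ t) :
    ∀ᵐ x, wmin * ‖ψ t x‖ ≤ weightedDensity rbar A ψ w t x ∧
      weightedDensity rbar A ψ w t x ≤ W * (2 * m) * ‖ψ t x‖ := by
  filter_upwards [ae_offLines L t] with x hx
  have hreg := hA.isRegularMat hrbar hm hδm ht (h.locConst t x ht hx)
  constructor
  · refine (mul_le_mul_of_nonneg_left (hreg.norm_le_sum_abs_charComp (ψ t x)) hwmin).trans ?_
    rw [Finset.mul_sum]
    refine Finset.sum_le_sum fun j _ => ?_
    rw [mul_comm]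
    exact mul_le_mul_of_nonneg_left (hbd t x j ht).1 (abs_nonneg _)
  · rw [mul_assoc]
    refine le_trans ?_ (mul_le_mul_of_nonneg_left (hreg.sum_abs_charComp_le (ψ t x)) hW)
    rw [Finset.mul_sum]
    refine Finset.sum_le_sum fun j _ => ?_
    rw [mul_comm W]
    exact mul_le_mul_of_nonneg_left (hbd t x j ht).2 (abs_nonneg _)

end IsCarriedBy

/-- Passage to the limit from the right, off a finite set of times. -/
theorem le_of_forall_notMem_finite {f g : ℝ → ℝ} (hf : Continuous f) (hg : Continuous g)
    {T : Set ℝ} (hT : T.Finite) {a b : ℝ} (hab : a < b)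
    (hfg : ∀ t, a < t → t < b → t ∉ T → f t ≤ g t) : f a ≤ g a := by
  have hTc : ∀ᶠ τ in 𝓝[>] a, τ ∉ T := by
    have : ∀ᶠ τ in cofinite, τ ∉ T := by simpa [eventually_cofinite] using hT
    exact (this.filter_mono (nhdsNE_le_cofinite a)).filter_mono
      (nhdsWithin_mono _ fun τ (h : a < τ) => h.ne')
  refine le_of_tendsto_of_tendsto ((hf.tendsto a).mono_left (nhdsWithin_le_nhds (s := Ioi a)))
    ((hg.tendsto a).mono_left nhdsWithin_le_nhds) ?_
  filter_upwards [hTc, Ioo_mem_nhdsGT hab] with τ h1 h2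
  exact hfg τ h2.1 h2.2 h1

end LinHyp

theorem mainTheorem4 {N : ℕ} (lo hi : Fin N → ℝ) (hI : ∀ j k : Fin N, j < k → hi j < lo k)
    (rbar : Fin N → LinHyp.Vec N) (hrbar : LinearIndependent ℝ rbar)
    (V c wmin wmax κ₁ κ₂ : ℝ) (hwmin : 0 < wmin) (hκ₁ : 0 < κ₁) (hκ₂ : 0 < κ₂) :
    ∃ K₀ δ₀ C : ℝ, 0 < K₀ ∧ 0 < δ₀ ∧ 0 < C ∧
      ∀ K : ℝ, K₀ ≤ K →
      ∀ A : ℝ → ℝ → LinHyp.Mat N,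
        LinHyp.IsUniformlyHyperbolicBV lo hi rbar δ₀ V A →
        LinHyp.EigvecJumpBound lo hi rbar c A →
        LinHyp.HasSmallShocks lo hi δ₀ A →
      ∀ ψ : ℝ → ℝ → LinHyp.Vec N,
        LinHyp.IsPiecewiseConstant ψ → LinHyp.IsWeakSolution A ψ → Integrable (ψ 0) →
      ∀ w : ℝ → ℝ → Fin N → ℝ,
        LinHyp.IsAdjointWeight A wmin wmax w →
        LinHyp.WeightConstraints lo hi rbar κ₁ κ₂ K A ψ w →
        (∃ T : Set ℝ, T.Finite ∧ ∀ t : ℝ, 0 < t → t ∉ T →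
          Integrable (LinHyp.weightedDensity rbar A ψ w t) ∧
          DifferentiableAt ℝ (LinHyp.weightedNorm rbar A ψ w) t ∧
          deriv (LinHyp.weightedNorm rbar A ψ w) t
            ≤ C * LinHyp.rarefactionSup lo hi rbar κ₂ A ψ t) ∧
        (∀ t : ℝ, 0 ≤ t →
          Integrable (ψ t) ∧
          IntervalIntegrable (LinHyp.rarefactionSup lo hi rbar κ₂ A ψ) volume 0 t ∧
          ∫ x, ‖ψ t x‖ ≤ C * ((∫ x, ‖ψ 0 x‖) +
            ∫ s in (0 : ℝ)..t, LinHyp.rarefactionSup lo hi rbar κ₂ A ψ s)) := by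
  open LinHyp in
  obtain ⟨m, hm, hcoord⟩ := exists_coordBound hrbar
  obtain ⟨g, hg, hgap⟩ := exists_gap hI
  set W := max wmax 0 with hW
  obtain ⟨B, hB⟩ := exists_isBigConstant N (2 * m) g W |c| κ₁ κ₂
  have hB1 := hB.one_le
  -- the amplitude of the shocks is chosen after the constants
  obtain ⟨δ, hδ0, hδ1, hδ2, hδ3⟩ : ∃ δ : ℝ, 0 < δ ∧ 16 * B ^ 3 * δ ≤ 1 ∧ 2 * B ^ 2 * δ ≤ wmin ∧
      2 * m * δ ≤ 1 / 4 := by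
    have hsmall : ∀ k ε : ℝ, 0 < ε → ∀ᶠ δ : ℝ in 𝓝[>] 0, k * δ ≤ ε := by
      intro k ε hε
      have : Tendsto (fun δ : ℝ => k * δ) (𝓝[>] 0) (𝓝 0) := by
        have h := (continuous_const_mul k).tendsto (0 : ℝ)
        rw [mul_zero] at h
        exact h.mono_left nhdsWithin_le_nhds
      exact this.eventually (ge_mem_nhds hε)
    obtain ⟨δ, ⟨⟨h1, h2⟩, h3⟩, h4⟩ := ((((hsmall (16 * B ^ 3) 1 one_pos).and
      (hsmall (2 * B ^ 2) wmin hwmin)).and (hsmall (2 * m) (1 / 4) (by norm_num))).and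
      self_mem_nhdsWithin).exists
    exact ⟨δ, h4, h1, h2, h3⟩
  have hW0 : 0 ≤ W := le_max_right _ _
  set C₁ := 2 * B ^ 2 * max V 0 with hC₁
  have hC₁0 : 0 ≤ C₁ := by positivity
  refine ⟨4 * B ^ 2, δ, C₁ + W * (2 * m) / wmin + C₁ / wmin + 1, by positivity, hδ0,
    by positivity, ?_⟩
  intro K hK A hA hvec hsh ψ hψpc hψ hψ0 w hw hcon
  obtain ⟨L, Θ, uA, uψ, hc⟩ := exists_isCarriedBy hA.piecewiseConstant hψpc hw.piecewiseConstant
  obtain ⟨E, hE, hadj⟩ := hw.adjoint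
  have hbd : ∀ t x j, 0 ≤ t → w t x j ∈ Icc wmin W := fun t x j ht =>
    ⟨(hw.bounds t x j ht).1, (hw.bounds t x j ht).2.trans (le_max_left _ _)⟩
  have hδm : m * δ ≤ 1 / 2 := by linarith
  set T : Set ℝ := {t | ¬ IsGeneric L t} ∪ Θ ∪ Prod.fst '' E with hT
  have hTfin : T.Finite := ((finite_not_isGeneric L).union hc.finite).union (hE.image _)
  set σ := rarefactionSup lo hi rbar κ₂ A ψ with hσ
  set F := weightedNorm rbar A ψ w with hF
  have hσ0 : ∀ t, 0 ≤ σ t := rarefactionSup_nonneg lo hi rbar κ₂ A ψ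
  have hgen : ∀ t, t ∉ T → IsGeneric L t := fun t ht => by
    by_contra hcon'
    exact ht (Or.inl (Or.inl hcon'))
  have hderiv : ∀ t, 0 < t → t ∉ T → Integrable (weightedDensity rbar A ψ w t) ∧
      ∃ F', HasDerivAt F F' t ∧ F' ≤ C₁ * σ t := by
    intro t ht htT
    refine hc.weightedNorm_hasDerivAt hA hvec hsh hψ hψ0 hcon hbd hcoord hm.le hB hg hκ₁ hκ₂ hwmin
      hK hδ1 hδ2 hδ3 hgap ht (hgen t htT) (fun h => htT (Or.inl (Or.inr h))) ?_
    exact fun x s wm wp hj => hadj t x s wm wp (fun h => htT (Or.inr ⟨_, h, rfl⟩)) hj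
  obtain ⟨hσmeas, hσint⟩ := hc.intervalIntegrable_rarefactionSup lo hi rbar κ₂
  -- the `L¹` norm of the solution is continuous in time
  have hu0 := hc.solution_empty hψ0
  have hu1 := hc.solution_self hψ0
  set I : ℝ → ℝ := fun t => ∫ x, ‖uψ (below L t x)‖ with hIdef
  have hIcont : Continuous I := continuous_integral_comp_below
    (u := fun s => ‖uψ s‖) (by simp [hu0]) (by simp [hu1])
  have hIeq : ∀ t, 0 ≤ t → ∫ x, ‖ψ t x‖ = I t := fun t ht =>
    integral_congr_ae ((hc.solution_ae_eq ht).mono fun x hx => by simp only [hx])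
  have hψint : ∀ t, 0 ≤ t → Integrable (ψ t) := fun t ht =>
    (integrable_comp_below hu0 hu1 t).congr (hc.solution_ae_eq ht).symm
  set S : ℝ → ℝ := fun t => ∫ s in (0 : ℝ)..t, σ s with hS
  have hScont : Continuous S := intervalIntegral.continuous_primitive (fun a b => hσint a b) 0
  have hS0 : ∀ t, 0 ≤ t → 0 ≤ S t := fun t ht =>
    intervalIntegral.integral_nonneg ht fun s _ => hσ0 s
  have hSderiv : ∀ t, 0 < t → t ∉ T → HasDerivAt S (σ t) t := by
    intro t ht htT
    refine intervalIntegral.integral_hasDerivAt_right (hσint 0 t)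
      hσmeas.stronglyMeasurableAtFilter ?_
    refine continuousAt_const.congr (f := fun _ => σ t) ?_
    filter_upwards [hc.eventually_rarefactionSup_eq lo hi rbar κ₂ ht (hgen t htT)] with τ hτ
    exact hτ.symm
  have hlow : ∀ t, 0 < t → t ∉ T → wmin * I t ≤ F t := by
    intro t ht htT
    rw [← hIeq t ht.le, ← integral_const_mul]
    exact integral_mono_ae ((hψint t ht.le).norm.const_mul _) (hderiv t ht htT).1
      ((hc.weightedDensity_bounds hA hcoord hm.le hδm hbd hwmin.le hW0 ht.le).mono fun x hx => hx.1)
  have hup : ∀ t, 0 < t → t ∉ T → F t ≤ W * (2 * m) * I t := by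
    intro t ht htT
    rw [← hIeq t ht.le, ← integral_const_mul]
    exact integral_mono_ae (hderiv t ht htT).1 ((hψint t ht.le).norm.const_mul _)
      ((hc.weightedDensity_bounds hA hcoord hm.le hδm hbd hwmin.le hW0 ht.le).mono fun x hx => hx.2)
  have hmono : ∀ a b, 0 < a → a < b → a ∉ T → b ∉ T → F b - C₁ * S b ≤ F a - C₁ * S a := by
    intro a b ha hab haT hbT
    refine le_of_deriv_nonpos_of_jumps (f := fun t => F t - C₁ * S t)
      (f' := fun t => deriv F t - C₁ * σ t) hTfin (fun t ht htT => ?_) (fun t ht => ?_) ha hab haT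
      hbT
    · obtain ⟨-, F', hF', hle⟩ := hderiv t ht htT
      rw [hF'.deriv]
      exact ⟨hF'.sub ((hSderiv t ht htT).const_mul C₁), by linarith⟩
    · obtain ⟨y, z, hy, hz, hzy⟩ := hc.weightedNorm_jump hA hcoord hm.le hδm hψ0 ht
        (hw.decreasing t ht)
      have hSt : Tendsto (fun t => C₁ * S t) (𝓝 t) (𝓝 (C₁ * S t)) :=
        (continuous_const.mul hScont).tendsto t
      exact ⟨_, _, hy.sub (hSt.mono_left nhdsWithin_le_nhds),
        hz.sub (hSt.mono_left nhdsWithin_le_nhds), by linarith⟩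
  have hgrowth : ∀ t, 0 < t → t ∉ T → wmin * I t ≤ W * (2 * m) * I 0 + C₁ * S t := by
    intro t ht htT
    refine le_of_forall_notMem_finite (f := fun _ => wmin * I t)
      (g := fun a => W * (2 * m) * I a + C₁ * S t) continuous_const
      ((continuous_const.mul hIcont).add continuous_const) hTfin ht fun a ha hat haT => ?_
    have h1 := hmono a t ha hat haT htT
    have h2 := mul_nonneg hC₁0 (hS0 a ha.le)
    have h3 := hlow t ht htT
    have h4 := hup a ha haT
    linarith
  have hall : ∀ t, 0 ≤ t → wmin * I t ≤ W * (2 * m) * I 0 + C₁ * S t := fun t ht =>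
    le_of_forall_notMem_finite (f := fun t => wmin * I t)
      (g := fun t => W * (2 * m) * I 0 + C₁ * S t) (continuous_const.mul hIcont)
      (continuous_const.add (continuous_const.mul hScont)) hTfin (lt_add_one t)
      fun τ hτ _ hτT => hgrowth τ (ht.trans_lt hτ) hτT
  refine ⟨⟨T, hTfin, fun t ht htT => ?_⟩, fun t ht => ⟨hψint t ht, hσint 0 t, ?_⟩⟩
  · obtain ⟨hint, F', hF', hle⟩ := hderiv t ht htT
    refine ⟨hint, hF'.differentiableAt, ?_⟩
    rw [hF'.deriv]
    refine hle.trans (mul_le_mul_of_nonneg_right ?_ (hσ0 t))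
    have h1 : 0 ≤ W * (2 * m) / wmin := by positivity
    have h2 : 0 ≤ C₁ / wmin := by positivity
    linarith
  · rw [hIeq t ht, hIeq 0 le_rfl]
    change I t ≤ _ * (I 0 + S t)
    have hI0 : 0 ≤ I 0 := integral_nonneg fun x => norm_nonneg _
    have hSt := hS0 t ht
    have h1 : I t ≤ W * (2 * m) / wmin * I 0 + C₁ / wmin * S t := by
      have h2 : W * (2 * m) / wmin * I 0 + C₁ / wmin * S t =
          (W * (2 * m) * I 0 + C₁ * S t) / wmin := by ring
      rw [h2, le_div_iff₀ hwmin, mul_comm]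
      exact hall t ht
    refine h1.trans ?_
    rw [mul_add]
    have h3 : 0 ≤ W * (2 * m) / wmin := by positivity
    have h4 : 0 ≤ C₁ / wmin := by positivity
    refine add_le_add (mul_le_mul_of_nonneg_right ?_ hI0) (mul_le_mul_of_nonneg_right ?_ hSt) <;>
    linarith
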